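/- Consider the class $\mathscr P_0$ of equations $$ i\psi_t+\psi_{xx}+\sigma\psi\ln|\psi|+V(t,x)\psi=0 $$ for a complex-valued function $\psi$ of two real variables $t,x$, where $\sigma$ is a non-zero complex constant and $V$ is a smooth complex-valued function on an open set of $(t,x)$; the variable $\psi$ is restricted to $\psi\ne0$. The arbitrary element is $S=\sigma\ln|\psi|+V(t,x)$. All transformations are smooth and locally defined, with smooth inverses (diffeomorphisms between open sets). A point transformation $\varphi$ of the $(t,x,\psi)$-space maps an equation $\mathcal L_\theta$ to $\mathcal L_{\tilde\theta}$ if a second-order jet over the domain of $\varphi$ lies on the manifold of $\mathcal L_\theta$ in the jet space if and only if its image under the second prolongation of $\varphi$ (where this image exists) lies on the manifold of $\mathcal L_{\tilde\theta}$; then $(\theta,\tilde\theta,\varphi)$ is called an admissible transformation. The equivalence group $G^\sim_{\mathscr P_0}$ is the pseudogroup of point transformations $\Phi$ of the space of $(t,x,\psi,S)$ that project to a point transformation $\Phi|_{(t,x,\psi)}$ of the space of $(t,x,\psi)$ and (locally) map each arbitrary element $\theta$ of the class to an arbitrary element $\Phi\theta$ of the class in such a way that $\Phi|_{(t,x,\psi)}$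 maps $\mathcal L_\theta$ to $\mathcal L_{\Phi\theta}$. The class is normalized if for each admissible transformation $(\theta,\tilde\theta,\varphi)$ there is $\Phi\in G^\sim_{\mathscr P_0}$ with $\varphi=\Phi|_{(t,x,\psi)}$ and $\tilde\theta=\Phi\theta$ (on the domain of $\varphi$). For $\beta\in\mathbb C$ put $\hat\beta=\beta$ if $T_t>0$ and $\hat\beta=\beta^*$ (complex conjugate) if $T_t<0$. **Theorem.** (i) $G^\sim_{\mathscr P_0}$ is formed by the transformations $$ \tilde t=T,\quad \tilde x=\varepsilon x|T_t|^{1/2}+X,\quad \tilde\psi=\hat\psi\exp\Bigl(\frac i8\frac{T_{tt}}{|T_t|}x^2+\frac i2\frac{\varepsilon\varepsilon'X_t}{|T_t|^{1/2}}x+\Theta+i\Psi\Bigr), $$ $$ \tilde S=\frac{\hat S}{|T_t|}+\frac{2T_{ttt}T_t-3T_{tt}^2}{16\varepsilon'T_t^3}x^2+\frac{\varepsilon\varepsilon'}{2|T_t|^{1/2}}\Bigl(\frac{X_t}{T_t}\Bigr)_t x+\frac{\Psi_t-i\Theta_t}{T_t}-\frac{X_t^2+iT_{tt}}{4T_t^2}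 $$ with $T_{tt}=0$, where $T,X,\Theta,\Psi$ are smooth real-valued functions of $t$, $T_t\ne0$, $\varepsilon=\pm1$, $\varepsilon'=\operatorname{sign}T_t$. More precisely, a projectable point transformation $\Phi$ of the $(t,x,\psi,S)$-space belongs to $G^\sim_{\mathscr P_0}$ if and only if on every connected open subset of its domain whose sections $t=\mathrm{const}$ are connected it has this form; and for every open interval $I$ and all such $\varepsilon,T,X,\Theta,\Psi$ on $I$ the formulas define an element of $G^\sim_{\mathscr P_0}$ with domain $\{t\in I,\ \psi\ne0\}$. (ii) The corresponding transformations with respect to $\sigma$ and $V$ have the form $$ \tilde\sigma=\frac{\hat\sigma}{|T_t|},\qquad \tilde V=\frac{\hat V}{|T_t|}+\frac{\varepsilon X_{tt}}{2|T_t|^{3/2}}x-\hat\sigma\frac{\Theta}{|T_t|}-\frac14\frac{X_t^2}{T_t^2}+\frac{\Psi_t}{T_t}-i\frac{\Theta_t}{T_t}, $$ where $\tilde V$ is evaluated at $(\tilde t,\tilde x)$ and $V$ at $(t,x)$: on an open set where $\Phi$ has the form in (i), $\Phi$ maps the arbitrary element given by $(\sigma,V)$ to the one given by $(\tilde\sigma,\tilde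 V)$ if and only if these formulas hold there. (iii) The class $\mathscr P_0$ is normalized. -/

import Mathlib

open scoped ContDiff Topology

noncomputable section

namespace LogSchrodinger

/-- The space of the variables `(t, x, ψ)`; `t` and `x` are real, `ψ` is complex. -/
abbrev Var : Type := ℝ × ℝ × ℂ

/-- The space of the variables `((t, x, ψ), S)`. -/
abbrev ExtVar : Type := Var × ℂ

/-- The pair of independent variables `(t, x)` of a point `(t, x, ψ)`. -/
def indep (z : Var) : ℝ × ℝ := (z.1, z.2.1)

/-- An equation `iψ_t + ψ_xx + σ ψ ln|ψ| + V(t,x) ψ = 0` of the class, i.e. a non-zero complex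
constant `σ` and a smooth complex-valued potential `V` defined on an open set of `(t, x)`. -/
structure Equation where
  dom : Set (ℝ × ℝ)
  isOpen_dom : IsOpen dom
  σ : ℂ
  σ_ne_zero : σ ≠ 0
  V : ℝ × ℝ → ℂ
  contDiffOn_V : ContDiffOn ℝ ∞ V dom

namespace Equation

/-- The set of `(t, x, ψ)` where the equation is considered: `(t, x)` is in the domain of the
potential and `ψ ≠ 0`, so that `ln|ψ|` makes sense. -/
def domain (θ : Equation) : Set Var := {z | indep z ∈ θ.dom ∧ z.2.2 ≠ 0}

/-- The arbitrary element `S = σ ln|ψ| + V(t, x)`, as a function of `(t, x, ψ)`. -/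
def S (θ : Equation) (z : Var) : ℂ := θ.σ * (Real.log ‖z.2.2‖ : ℂ) + θ.V (indep z)

/-- The function `u` satisfies `i u_t + u_xx + S u = 0` at the single point `p = (t, x)`, i.e. the
second-order jet of `u` at `p` lies on the manifold determined by the equation in the jet space. -/
def HoldsAt (θ : Equation) (u : ℝ × ℝ → ℂ) (p : ℝ × ℝ) : Prop :=
  Complex.I * deriv (fun s : ℝ => u (s, p.2)) p.1
    + iteratedDeriv 2 (fun y : ℝ => u (p.1, y)) p.2
    + θ.S (p.1, p.2, u p) * u p = 0

end Equation

/-- The transformation `φ` maps, near the point `p`, the graph of the function `u` of `(t, x)`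
to (a part of) the graph of the function `v` of `(t̃, x̃)`.  For `u` and `v` smooth at `p` and at
the image point respectively, the jet of `v` at the image point is then the prolonged
transformation applied to the jet of `u` at `p`. -/
def MapsGraph (φ : Var → Var) (u v : ℝ × ℝ → ℂ) (p : ℝ × ℝ) : Prop :=
  ∀ᶠ q in 𝓝 p, v (indep (φ (q.1, q.2, u q))) = (φ (q.1, q.2, u q)).2.2

/-- A (locally defined) point transformation in the space of `(t, x, ψ)` with `ψ ≠ 0`:
a diffeomorphism between two open sets. -/
structure IsPointTransformation (φ : OpenPartialHomeomorph Var Var) : Prop where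
  contDiffOn : ContDiffOn ℝ ∞ φ φ.source
  contDiffOn_symm : ContDiffOn ℝ ∞ φ.symm φ.target
  source_ne_zero : ∀ z ∈ φ.source, z.2.2 ≠ 0
  target_ne_zero : ∀ z ∈ φ.target, z.2.2 ≠ 0

/-- Over the set `N` of `(t, x, ψ)`, the transformation `φ` maps the equation `θ` to the equation
`θ'`: a second-order jet over a point of `N` lies on the manifold of `θ` if and only if its image
under the second prolongation of `φ` lies on the manifold of `θ'`. -/
structure CarriesOn (φ : OpenPartialHomeomorph Var Var) (N : Set Var) (θ θ' : Equation) :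
    Prop where
  subset_source : N ⊆ φ.source
  subset_domain : N ⊆ θ.domain
  mapsTo_domain : ∀ z ∈ N, φ z ∈ θ'.domain
  holdsAt_iff : ∀ (p : ℝ × ℝ) (u v : ℝ × ℝ → ℂ), (p.1, p.2, u p) ∈ N →
    ContDiffAt ℝ ∞ u p → ContDiffAt ℝ ∞ v (indep (φ (p.1, p.2, u p))) →
    MapsGraph φ u v p →
    (θ.HoldsAt u p ↔ θ'.HoldsAt v (indep (φ (p.1, p.2, u p))))

/-- `(θ, θ', φ)` is an admissible transformation of the class: `φ` is a point transformation
mapping the equation `θ` to the equation `θ'`. -/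
def IsAdmissible (θ θ' : Equation) (φ : OpenPartialHomeomorph Var Var) : Prop :=
  IsPointTransformation φ ∧ CarriesOn φ φ.source θ θ'

/-- A (locally defined) point transformation `ext` in the space of `(t, x, ψ, S)` which is
projectable on the space of `(t, x, ψ)`, together with its projection `base`. -/
structure ExtTransformation where
  ext : OpenPartialHomeomorph ExtVar ExtVar
  base : OpenPartialHomeomorph Var Var
  contDiffOn_ext : ContDiffOn ℝ ∞ ext ext.source
  contDiffOn_ext_symm : ContDiffOn ℝ ∞ ext.symm ext.target
  isPointTransformation_base : IsPointTransformation base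
  base_source : base.source = Prod.fst '' ext.source
  ext_fst : ∀ q ∈ ext.source, (ext q).1 = base q.1

namespace ExtTransformation

/-- Over the set `N` of `(t, x, ψ)`, the transformation maps the arbitrary element `S` of `θ` to
the arbitrary element of `θ'`, i.e. it maps points of the graph of the first function to points of
the graph of the second one. -/
def ActsOn (P : ExtTransformation) (N : Set Var) (θ θ' : Equation) : Prop :=
  ∀ z ∈ N, z ∈ θ.domain ∧ (z, θ.S z) ∈ P.ext.source ∧ P.base z ∈ θ'.domain ∧
    (P.ext (z, θ.S z)).2 = θ'.S (P.base z)

end ExtTransformation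

/-- The (usual) equivalence group (pseudogroup) of the class: the projectable point transformations
of `(t, x, ψ, S)` which map every arbitrary element `θ` of the class to an arbitrary element `θ'`
of the class such that the projection to `(t, x, ψ)` maps the equation `θ` to the equation `θ'`.
Transformations and arbitrary elements being locally defined, this is required near every point of
the graph of `θ` lying in the domain of the transformation. -/
def equivalenceGroup : Set ExtTransformation :=
  {P | ∀ (θ : Equation), ∀ z ∈ θ.domain, (z, θ.S z) ∈ P.ext.source →
    ∃ (θ' : Equation) (N : Set Var), IsOpen N ∧ z ∈ N ∧
      P.ActsOn N θ θ' ∧ CarriesOn P.base N θ θ'}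

/-- The class is normalized: every admissible transformation `(θ, θ', φ)` is induced by a
transformation from the equivalence group. -/
def IsNormalizedClass : Prop :=
  ∀ (θ θ' : Equation) (φ : OpenPartialHomeomorph Var Var), IsAdmissible θ θ' φ →
    ∃ P ∈ equivalenceGroup, P.base = φ ∧ P.ActsOn φ.source θ θ'

/-- `β̂ = β` if `T_t > 0` and `β̂ = β*` if `T_t < 0`; here `a` is the value of `T_t`. -/
def hat (a : ℝ) (β : ℂ) : ℂ := if 0 < a then β else starRingEnd ℂ β

/-- The parameters `ε`, `T(t)`, `X(t)`, `Θ(t)`, `Ψ(t)` of a transformation. -/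
structure Params where
  ε : ℝ
  T : ℝ → ℝ
  X : ℝ → ℝ
  Θ : ℝ → ℝ
  Ψ : ℝ → ℝ

namespace Params

/-- `ε = ±1`, the functions `T`, `X`, `Θ`, `Ψ` are smooth on the set `I` of values of `t`,
and `T_t ≠ 0` there. -/
structure RegularOn (p : Params) (I : Set ℝ) : Prop where
  ε_eq : p.ε = 1 ∨ p.ε = -1
  contDiffOn_T : ContDiffOn ℝ ∞ p.T I
  contDiffOn_X : ContDiffOn ℝ ∞ p.X I
  contDiffOn_Θ : ContDiffOn ℝ ∞ p.Θ I
  contDiffOn_Ψ : ContDiffOn ℝ ∞ p.Ψ I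
  deriv_T_ne_zero : ∀ t ∈ I, deriv p.T t ≠ 0

/-- `ε' = sign T_t`. -/
def ε' (p : Params) (t : ℝ) : ℝ := Real.sign (deriv p.T t)

/-- `x̃ = ε x |T_t|^{1/2} + X`. -/
def newX (p : Params) (t x : ℝ) : ℝ := p.ε * x * √|deriv p.T t| + p.X t

/-- `ψ̃ = ψ̂ exp((i/8) (T_tt/|T_t|) x² + (i/2) (ε ε' X_t/|T_t|^{1/2}) x + Θ + iΨ)`. -/
def newψ (p : Params) (t x : ℝ) (ψ : ℂ) : ℂ :=
  hat (deriv p.T t) ψ * Complex.exp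
    (Complex.I / 8 * ((deriv (deriv p.T) t / |deriv p.T t| * x ^ 2 : ℝ) : ℂ)
      + Complex.I / 2 * ((p.ε * p.ε' t * deriv p.X t / √|deriv p.T t| * x : ℝ) : ℂ)
      + (p.Θ t : ℂ) + Complex.I * (p.Ψ t : ℂ))

/-- `S̃ = Ŝ/|T_t| + (2 T_ttt T_t - 3 T_tt²)/(16 ε' T_t³) x² + ε ε'/(2 |T_t|^{1/2}) (X_t/T_t)_t x
+ (Ψ_t - iΘ_t)/T_t - (X_t² + i T_tt)/(4 T_t²)`. -/
def newS (p : Params) (t x : ℝ) (s : ℂ) : ℂ :=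
  hat (deriv p.T t) s / (|deriv p.T t| : ℝ)
    + (((2 * deriv (deriv (deriv p.T)) t * deriv p.T t - 3 * deriv (deriv p.T) t ^ 2)
        / (16 * p.ε' t * deriv p.T t ^ 3) * x ^ 2 : ℝ) : ℂ)
    + ((p.ε * p.ε' t / (2 * √|deriv p.T t|)
        * deriv (fun r => deriv p.X r / deriv p.T r) t * x : ℝ) : ℂ)
    + (((deriv p.Ψ t : ℝ) : ℂ) - Complex.I * ((deriv p.Θ t : ℝ) : ℂ)) / ((deriv p.T t : ℝ) : ℂ)
    - (((deriv p.X t : ℝ) : ℂ) ^ 2 + Complex.I * ((deriv (deriv p.T) t : ℝ) : ℂ))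
        / (4 * ((deriv p.T t : ℝ) : ℂ) ^ 2)

/-- The transformation `t̃ = T(t)`, `x̃`, `ψ̃`, `S̃` of the space of `(t, x, ψ, S)` with the given
parameters. -/
def toFun (p : Params) (q : ExtVar) : ExtVar :=
  ((p.T q.1.1, p.newX q.1.1 q.1.2.1, p.newψ q.1.1 q.1.2.1 q.1.2.2),
    p.newS q.1.1 q.1.2.1 q.2)

/-- `σ̃ = σ̂/|T_t|`. -/
def newσ (p : Params) (t : ℝ) (σ : ℂ) : ℂ :=
  hat (deriv p.T t) σ / (|deriv p.T t| : ℝ)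

/-- `Ṽ = V̂/|T_t| + ε X_tt/(2 |T_t|^{3/2}) x - σ̂ Θ/|T_t| - X_t²/(4 T_t²) + Ψ_t/T_t - iΘ_t/T_t`;
here `v` is the value of `V` at `(t, x)`. -/
def newV (p : Params) (t x : ℝ) (σ v : ℂ) : ℂ :=
  hat (deriv p.T t) v / (|deriv p.T t| : ℝ)
    + ((p.ε * deriv (deriv p.X) t / (2 * |deriv p.T t| ^ (3 / 2 : ℝ)) * x : ℝ) : ℂ)
    - hat (deriv p.T t) σ * ((p.Θ t / |deriv p.T t| : ℝ) : ℂ)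
    - ((1 / 4 * (deriv p.X t ^ 2 / deriv p.T t ^ 2) : ℝ) : ℂ)
    + ((deriv p.Ψ t / deriv p.T t : ℝ) : ℂ)
    - Complex.I * ((deriv p.Θ t / deriv p.T t : ℝ) : ℂ)

end Params

/-- The set of values of `t` on a set of points `(t, x, ψ, S)`. -/
def times (W : Set ExtVar) : Set ℝ := (fun q : ExtVar => q.1.1) '' W

/-- On the set `W`, the transformation `P` is the one with the parameters `p`, these being
regular for the values of `t` occurring in `W` and satisfying `T_tt = 0`. -/
structure HasFormOn (P : ExtTransformation) (p : Params) (W : Set ExtVar) : Prop where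
  subset_source : W ⊆ P.ext.source
  regularOn : p.RegularOn (times W)
  deriv_deriv_T : ∀ t ∈ times W, deriv (deriv p.T) t = 0
  ext_eq : ∀ q ∈ W, P.ext q = p.toFun q

/-- `W` is an open connected set of points `(t, x, ψ, S)` whose sections `t = const` are
connected (or empty), so that functions locally depending only on `t` are functions of `t`. -/
structure IsTimeConnected (W : Set ExtVar) : Prop where
  isOpen : IsOpen W
  isPreconnected : IsPreconnected W
  isPreconnected_section : ∀ t : ℝ, IsPreconnected {q ∈ W | q.1.1 = t}

end LogSchrodinger

end

/-! An admissible `φ` is studied through its first and second derivatives at each point. A function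
`u` with a prescribed 2-jet is pushed forward to a function `v`, and the chain rule expresses the
2-jet of `v` through that of `u` (`prolongation`, `CarriesOn.jet`). The equation leaves `u_tt`,
`u_x`, `u_xx` free and then fixes `u_t`; the transformed equation must hold for all values of the
free variables, which splits it into determining equations.

Freedom of `u_tt` forces the new time to depend on `t` alone (`CarriesOn.fderiv_time`). Freedom of
`u_xx` makes `ψ̃_ψ` complex linear or antilinear, according to the sign of `T_t`, and gives `(D_x
x̃)⁴ = T_t²` (`CarriesOn.multiplier`). Freedom of `u_x` then gives `x̃_ψ = 0`, hence `x̃_x² =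
|T_t|`, as well as `ψ̃_ψψ = 0` and a relation between `ψ̃_xψ` and `x̃_t`
(`CarriesOn.determining_second`).

One equation remains, relating the old and new arbitrary elements, and here the logarithms matter.
It is differentiated in a direction `w` of `ψ`; a suitable combination of `w = 1` and `w = i` kills
every term that is linear or antilinear of the right type and leaves only the derivatives of the
logarithms (`CarriesOn.wirtinger`). Taking absolute values gives `|T_t| = |σ|/|σ̃|`, so `T_t` is
locally constant. Two further vertical derivatives show that `ψ̃ = ψ̃_ψ(ψ)`, without an additive
term (`CarriesOn.apply_eq`). These facts make up `HasInfinitesimalForm`, which integrates to `ε, T,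
X, Θ, Ψ` on time-connected sets (`IsTimeConnected.exists_params`).

Conversely, by `Params.transform_identity` a transformation of this form with `T_t` locally constant
takes the left-hand side of an equation to its hat times a non-zero factor, with the value `s` of
the arbitrary element replaced by `newS`. Hence such transformations preserve the class, and `S̃` is
determined by `φ` (`carriesOn_of_form`, `CarriesOn.S_eq`). The analysis uses a single pair of
equations, so every admissible `φ` has the form; it extends to `S` by an affine map fitted to that
pair, which yields normalization. -/

noncomputable section

namespace LogSchrodinger

/-! ### Derivatives along curves and in fixed directions. -/

section Calculus

variable {E F : Type*} [NormedAddCommGroup E] [NormedSpace ℝ E]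
  [NormedAddCommGroup F] [NormedSpace ℝ F]

/-- The first and second derivatives of a function along a curve. -/
theorem hasDerivAt_comp_curve {f : E → F} {α α' : ℝ → E} {α'' : E} {s : ℝ}
    (hf : ContDiffAt ℝ 2 f (α s)) (hα : ∀ᶠ r in 𝓝 s, HasDerivAt α (α' r) r)
    (hα' : HasDerivAt α' α'' s) :
    (∀ᶠ r in 𝓝 s, HasDerivAt (fun r => f (α r)) (fderiv ℝ f (α r) (α' r)) r) ∧
      HasDerivAt (fun r => fderiv ℝ f (α r) (α' r))
        (fderiv ℝ (fderiv ℝ f) (α s) (α' s) (α' s) + fderiv ℝ f (α s) α'') s := by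
  have hc : ContinuousAt α s := hα.self_of_nhds.continuousAt
  constructor
  · have h1 : ∀ᶠ z in 𝓝 (α s), ContDiffAt ℝ 2 f z := hf.eventually (by decide)
    filter_upwards [hα, hc.eventually h1] with r h2 h3
    exact (h3.differentiableAt (by decide)).hasFDerivAt.comp_hasDerivAt r h2
  · have h1 : ContDiffAt ℝ 1 (fderiv ℝ f) (α s) := hf.fderiv_right (by norm_num)
    have h2 := (h1.differentiableAt (by decide)).hasFDerivAt.comp_hasDerivAt s hα.self_of_nhds
    exact h2.clm_apply hα'

theorem hasDerivAt_add_smul (z e : E) (s : ℝ) : HasDerivAt (fun r : ℝ => z + r • e) e s := by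
  simpa using ((hasDerivAt_id s).smul_const e).const_add z

/-- The derivative of a function in a given direction, as a function of the point. -/
def dirDeriv (e : E) (f : E → F) (z : E) : F := fderiv ℝ f z e

theorem dirDeriv_congr {e : E} {f g : E → F} {z : E} (h : f =ᶠ[𝓝 z] g) :
    dirDeriv e f z = dirDeriv e g z := by
  rw [dirDeriv, h.fderiv_eq, dirDeriv]

theorem dirDeriv_eq_of_hasDerivAt {e : E} {f : E → F} {z : E} {c : F}
    (hf : DifferentiableAt ℝ f z) (h : HasDerivAt (fun s : ℝ => f (z + s • e)) c 0) :
    dirDeriv e f z = c := by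
  have h2 : HasFDerivAt f (fderiv ℝ f z) (z + (0 : ℝ) • e) := by simpa using hf.hasFDerivAt
  exact (h2.comp_hasDerivAt 0 (hasDerivAt_add_smul z e 0)).unique h

theorem hasDerivAt_line {e : E} {f : E → F} {z : E} (hf : DifferentiableAt ℝ f z) :
    HasDerivAt (fun s : ℝ => f (z + s • e)) (dirDeriv e f z) 0 := by
  have h2 : HasFDerivAt f (fderiv ℝ f z) (z + (0 : ℝ) • e) := by simpa using hf.hasFDerivAt
  exact h2.comp_hasDerivAt 0 (hasDerivAt_add_smul z e 0)

theorem contDiffAt_dirDeriv {e : E} {f : E → F} {z : E} (hf : ContDiffAt ℝ ∞ f z) :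
    ContDiffAt ℝ ∞ (dirDeriv e f) z :=
  (hf.fderiv_right (m := ∞) (by simp)).clm_apply contDiffAt_const

theorem dirDeriv_dirDeriv (e k : E) {f : E → F} {z : E} (hf : ContDiffAt ℝ 2 f z) :
    dirDeriv k (dirDeriv e f) z = fderiv ℝ (fderiv ℝ f) z k e := by
  have h1 : ContDiffAt ℝ 1 (fderiv ℝ f) z := hf.fderiv_right (by norm_num)
  have h2 := (h1.differentiableAt (by decide)).hasFDerivAt.clm_apply
    (hasFDerivAt_const (𝕜 := ℝ) e z)
  have h3 := congrArg (fun L => L k) h2.fderiv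
  have h4 : dirDeriv e f = fun y => fderiv ℝ f y e := rfl
  rw [← h4] at h3
  change fderiv ℝ (dirDeriv e f) z k = _
  simpa using h3

theorem dirDeriv_comm (e k : E) {f : E → F} {z : E} (hf : ContDiffAt ℝ 2 f z) :
    dirDeriv k (dirDeriv e f) z = dirDeriv e (dirDeriv k f) z := by
  rw [dirDeriv_dirDeriv e k hf, dirDeriv_dirDeriv k e hf]
  exact (hf.isSymmSndFDerivAt (by simp)).eq k e

end Calculus

/-! ### Jets of functions and their prolongation. -/

theorem deriv_fst_eq {F : Type*} [NormedAddCommGroup F] [NormedSpace ℝ F] {u : ℝ × ℝ → F}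
    {p : ℝ × ℝ} (hu : DifferentiableAt ℝ u p) :
    deriv (fun s : ℝ => u (s, p.2)) p.1 = fderiv ℝ u p (1, 0) := by
  have h1 : HasDerivAt (fun s : ℝ => ((s, p.2) : ℝ × ℝ)) (1, 0) p.1 :=
    (hasDerivAt_id p.1).prodMk (hasDerivAt_const p.1 p.2)
  exact (HasFDerivAt.comp_hasDerivAt p.1 (f := fun s : ℝ => ((s, p.2) : ℝ × ℝ))
    hu.hasFDerivAt h1).deriv

theorem iteratedDeriv_two_snd_eq {F : Type*} [NormedAddCommGroup F] [NormedSpace ℝ F]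
    {u : ℝ × ℝ → F} {p : ℝ × ℝ} (hu : ContDiffAt ℝ 2 u p) :
    iteratedDeriv 2 (fun y : ℝ => u (p.1, y)) p.2 =
      fderiv ℝ (fderiv ℝ u) p (0, 1) (0, 1) := by
  have h1 : ∀ r, HasDerivAt (fun s : ℝ => ((p.1, s) : ℝ × ℝ)) (0, 1) r := fun r =>
    (hasDerivAt_const r p.1).prodMk (hasDerivAt_id r)
  obtain ⟨h2, h3⟩ := hasDerivAt_comp_curve (α := fun s : ℝ => ((p.1, s) : ℝ × ℝ))
    (α' := fun _ => (0, 1)) (s := p.2) hu (.of_forall h1) (hasDerivAt_const _ _)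
  rw [iteratedDeriv_succ, iteratedDeriv_one]
  have h4 : deriv (fun y : ℝ => u (p.1, y)) =ᶠ[𝓝 p.2] fun r => fderiv ℝ u (p.1, r) (0, 1) := by
    filter_upwards [h2] with r hr using hr.deriv
  rw [h4.deriv_eq, h3.deriv]
  simp

/-- The equation at a point in terms of the Fréchet derivatives of the function. -/
theorem Equation.holdsAt_iff_fderiv (θ : Equation) {u : ℝ × ℝ → ℂ} {p : ℝ × ℝ}
    (hu : ContDiffAt ℝ 2 u p) :
    θ.HoldsAt u p ↔ Complex.I * fderiv ℝ u p (1, 0) + fderiv ℝ (fderiv ℝ u) p (0, 1) (0, 1)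
      + θ.S (p.1, p.2, u p) * u p = 0 := by
  rw [Equation.HoldsAt, deriv_fst_eq (hu.differentiableAt (by decide)),
    iteratedDeriv_two_snd_eq hu]

/-- `indep` as a continuous linear map. -/
def indepL : Var →L[ℝ] ℝ × ℝ :=
  (ContinuousLinearMap.fst ℝ ℝ (ℝ × ℂ)).prod
    ((ContinuousLinearMap.fst ℝ ℝ ℂ).comp (ContinuousLinearMap.snd ℝ ℝ (ℝ × ℂ)))

theorem indepL_apply (z : Var) : indepL z = indep z := rfl

/-- First- and second-order prolongation of a point transformation, along a line. -/
theorem prolongation {φ : Var → Var} {u v : ℝ × ℝ → ℂ} {p : ℝ × ℝ}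
    (hφ : ContDiffAt ℝ 2 φ (p.1, p.2, u p)) (hu : ContDiffAt ℝ 2 u p)
    (hv : ContDiffAt ℝ 2 v (indep (φ (p.1, p.2, u p)))) (hm : MapsGraph φ u v p)
    (h : ℝ × ℝ) {z e k : Var} (hz : z = (p.1, p.2, u p)) (he : e = (h.1, h.2, fderiv ℝ u p h))
    (hk : k = (0, 0, fderiv ℝ (fderiv ℝ u) p h h)) :
    fderiv ℝ v (indep (φ z)) (indep (fderiv ℝ φ z e)) = (fderiv ℝ φ z e).2.2 ∧
    fderiv ℝ (fderiv ℝ v) (indep (φ z)) (indep (fderiv ℝ φ z e)) (indep (fderiv ℝ φ z e))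
        + fderiv ℝ v (indep (φ z)) (indep (fderiv ℝ (fderiv ℝ φ) z e e + fderiv ℝ φ z k))
      = (fderiv ℝ (fderiv ℝ φ) z e e + fderiv ℝ φ z k).2.2 := by
  set γ : ℝ → ℝ × ℝ := fun s => p + s • h with hγ
  have hγ0 : γ 0 = p := by simp [hγ]
  have hγ' : ∀ r, HasDerivAt γ h r := fun r => hasDerivAt_add_smul p h r
  obtain ⟨a1, a2⟩ := hasDerivAt_comp_curve (f := u) (α := γ) (α' := fun _ => h) (s := 0)
    (by rwa [hγ0]) (.of_forall hγ') (hasDerivAt_const _ _)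
  set U : ℝ → Var := fun s => ((γ s).1, (γ s).2, u (γ s)) with hU
  have hU0 : U 0 = z := by simp [hU, hγ0, hz]
  have b1 : ∀ᶠ r in 𝓝 0, HasDerivAt U (h.1, h.2, fderiv ℝ u (γ r) h) r := by
    filter_upwards [a1] with r hr
    exact (hγ' r).fst.prodMk ((hγ' r).snd.prodMk hr)
  have b2 : HasDerivAt (fun r => ((h.1, h.2, fderiv ℝ u (γ r) h) : Var)) k 0 := by
    have := (hasDerivAt_const (0 : ℝ) h.1).prodMk ((hasDerivAt_const (0 : ℝ) h.2).prodMk a2)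
    simpa [hγ0, hk] using this
  obtain ⟨c1, c2⟩ := hasDerivAt_comp_curve (f := φ) (α := U) (s := 0)
    (by rw [hU0, hz]; exact hφ) b1 b2
  set β : ℝ → ℝ × ℝ := fun s => indep (φ (U s)) with hβ
  have hβ0 : β 0 = indep (φ z) := by simp [hβ, hU0]
  have d1 : ∀ᶠ r in 𝓝 0, HasDerivAt β
      (indepL (fderiv ℝ φ (U r) (h.1, h.2, fderiv ℝ u (γ r) h))) r := by
    filter_upwards [c1] with r hr
    exact indepL.hasFDerivAt.comp_hasDerivAt r hr
  have d2 := indepL.hasFDerivAt.comp_hasDerivAt (0 : ℝ) c2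
  obtain ⟨e1, e2⟩ := hasDerivAt_comp_curve (f := v) (α := β) (s := 0)
    (by rw [hβ0, hz]; exact hv) d1 d2
  have hγc : Filter.Tendsto γ (𝓝 0) (𝓝 p) := by
    simpa [ContinuousAt, hγ0] using (hγ' 0).continuousAt
  -- Along the lifted line the graph relation is an identity in the parameter; it is differentiated
  -- twice and compared with the chain rule through uniqueness of derivatives.
  have hev : (fun r => v (β r)) =ᶠ[𝓝 0] fun r => (φ (U r)).2.2 := hγc.eventually hm
  have e3 : ∀ᶠ r in 𝓝 0, fderiv ℝ v (β r)
      (indepL (fderiv ℝ φ (U r) (h.1, h.2, fderiv ℝ u (γ r) h))) =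
      (fderiv ℝ φ (U r) (h.1, h.2, fderiv ℝ u (γ r) h)).2.2 := by
    filter_upwards [e1, c1, hev.eventually_nhds] with r h1 h2 h3
    exact (h1.congr_of_eventuallyEq (Filter.EventuallyEq.symm h3)).unique h2.snd.snd
  constructor
  · have := e3.self_of_nhds
    simpa only [hβ0, hU0, hγ0, ← he, indepL_apply] using this
  · have := (e2.congr_of_eventuallyEq (Filter.EventuallyEq.symm e3)).unique c2.snd.snd
    simpa only [hβ0, hU0, hγ0, ← he, indepL_apply, Function.comp] using this

theorem two_le_infty : (2 : WithTop ℕ∞) ≤ ∞ :=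
  WithTop.coe_le_coe.2 (le_top : (2 : ℕ∞) ≤ ⊤)

/-- The quadratic function of `(t, x)` with prescribed value `ψ`, `u_x = a`, `u_t = b`,
`u_tt = c`, `u_xx = w` and `u_tx = 0` at the point `p`. -/
def quadJet (p : ℝ × ℝ) (ψ a b c w : ℂ) (q : ℝ × ℝ) : ℂ :=
  ψ + ((q.1 - p.1 : ℝ) : ℂ) * b + ((q.2 - p.2 : ℝ) : ℂ) * a
    + ((q.1 - p.1 : ℝ) : ℂ) ^ 2 * (c / 2) + ((q.2 - p.2 : ℝ) : ℂ) ^ 2 * (w / 2)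

theorem quadJet_self (p : ℝ × ℝ) (ψ a b c w : ℂ) : quadJet p ψ a b c w p = ψ := by
  simp [quadJet]

theorem contDiff_quadJet (p : ℝ × ℝ) (ψ a b c w : ℂ) : ContDiff ℝ ∞ (quadJet p ψ a b c w) := by
  have h : ∀ g : ℝ × ℝ → ℝ, ContDiff ℝ ∞ g → ContDiff ℝ ∞ fun q => ((g q : ℝ) : ℂ) :=
    fun g hg => Complex.ofRealCLM.contDiff.comp hg
  have h1 := h (fun q => q.1 - p.1) (by fun_prop)
  have h2 := h (fun q => q.2 - p.2) (by fun_prop)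
  unfold quadJet
  fun_prop

/-- On a line through `p` the function is a quadratic polynomial of the parameter, so both
derivatives are read off from one real variable. -/
theorem fderiv_quadJet (p : ℝ × ℝ) (ψ a b c w : ℂ) (h : ℝ × ℝ) :
    fderiv ℝ (quadJet p ψ a b c w) p h = h.1 * b + h.2 * a ∧
    fderiv ℝ (fderiv ℝ (quadJet p ψ a b c w)) p h h = h.1 ^ 2 * c + h.2 ^ 2 * w := by
  have hu := contDiff_quadJet p ψ a b c w
  set u := quadJet p ψ a b c w with hudef
  obtain ⟨h1, h2⟩ := hasDerivAt_comp_curve (f := u) (α := fun s : ℝ => p + s • h)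
    (α' := fun _ => h) (s := 0) (hu.contDiffAt.of_le two_le_infty)
    (.of_forall fun r => hasDerivAt_add_smul p h r) (hasDerivAt_const _ _)
  have h3 : ∀ r : ℝ, HasDerivAt (fun s : ℝ => u (p + s • h))
      (h.1 * b + h.2 * a + r * (h.1 ^ 2 * c + h.2 ^ 2 * w)) r := by
    intro r
    have he : (fun s : ℝ => u (p + s • h)) = fun s : ℝ =>
        ψ + (s : ℂ) * (h.1 * b + h.2 * a) + (s : ℂ) ^ 2 * ((h.1 ^ 2 * c + h.2 ^ 2 * w) / 2) := by
      funext s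
      simp [hudef, quadJet]
      ring
    rw [he]
    have hs : HasDerivAt (fun s : ℝ => (s : ℂ)) 1 r := Complex.ofRealCLM.hasDerivAt
    have := ((hs.mul_const (h.1 * b + h.2 * a : ℂ)).const_add ψ).add
      ((hs.pow 2).mul_const ((h.1 ^ 2 * c + h.2 ^ 2 * w) / 2 : ℂ))
    refine this.congr_deriv ?_
    simp
    ring
  have h4 : ∀ᶠ r : ℝ in 𝓝 0, fderiv ℝ u (p + (r : ℝ) • h) h =
      h.1 * b + h.2 * a + r * (h.1 ^ 2 * c + h.2 ^ 2 * w) := by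
    filter_upwards [h1] with r hr
    exact hr.unique (h3 r)
  constructor
  · simpa using h4.self_of_nhds
  · have hs : HasDerivAt (fun s : ℝ => (s : ℂ)) 1 0 := Complex.ofRealCLM.hasDerivAt
    have h5 := (hs.mul_const (h.1 ^ 2 * c + h.2 ^ 2 * w : ℂ)).const_add (h.1 * b + h.2 * a : ℂ)
    have h6 := h2.unique (h5.congr_of_eventuallyEq h4)
    simpa using h6

/-- The image of the graph of a smooth function under a transformation which is not vertical
along it is locally the graph of a smooth function. -/
theorem exists_mapsGraph {φ : Var → Var} {u : ℝ × ℝ → ℂ} {p : ℝ × ℝ}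
    (hφ : ContDiffAt ℝ ∞ φ (p.1, p.2, u p)) (hu : ContDiffAt ℝ ∞ u p)
    (hJ : ∀ h : ℝ × ℝ,
      indep (fderiv ℝ φ (p.1, p.2, u p) (h.1, h.2, fderiv ℝ u p h)) = 0 → h = 0) :
    ∃ v : ℝ × ℝ → ℂ, ContDiffAt ℝ ∞ v (indep (φ (p.1, p.2, u p))) ∧ MapsGraph φ u v p := by
  have hU : ContDiffAt ℝ ∞ (fun q : ℝ × ℝ => ((q.1, q.2, u q) : Var)) p :=
    contDiffAt_fst.prodMk (contDiffAt_snd.prodMk hu)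
  have hφU : ContDiffAt ℝ ∞ (fun q : ℝ × ℝ => φ (q.1, q.2, u q)) p :=
    ContDiffAt.comp p (f := fun q : ℝ × ℝ => ((q.1, q.2, u q) : Var)) hφ hU
  set f : ℝ × ℝ → ℝ × ℝ := fun q => indep (φ (q.1, q.2, u q)) with hf
  have hfs : ContDiffAt ℝ ∞ f p := indepL.contDiff.contDiffAt.comp p hφU
  have hfd : ∀ h, fderiv ℝ f p h =
      indep (fderiv ℝ φ (p.1, p.2, u p) (h.1, h.2, fderiv ℝ u p h)) := by
    intro h
    have h1 : HasFDerivAt (fun q : ℝ × ℝ => ((q.1, q.2, u q) : Var)) _ p :=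
      hasFDerivAt_fst.prodMk (hasFDerivAt_snd.prodMk
        (hu.differentiableAt (by simp)).hasFDerivAt)
    have h2 := HasFDerivAt.comp p (f := fun q : ℝ × ℝ => ((q.1, q.2, u q) : Var))
      (hφ.differentiableAt (by simp)).hasFDerivAt h1
    have h3 : HasFDerivAt f _ p := indepL.hasFDerivAt.comp p h2
    rw [h3.fderiv]
    rfl
  have hinj : Function.Injective (fderiv ℝ f p : ℝ × ℝ →ₗ[ℝ] ℝ × ℝ) := by
    rw [injective_iff_map_eq_zero]
    intro h hh
    exact hJ h (by rw [← hfd]; exact hh)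
  set e : (ℝ × ℝ) ≃L[ℝ] (ℝ × ℝ) :=
    (LinearEquiv.ofInjectiveEndo (fderiv ℝ f p : ℝ × ℝ →ₗ[ℝ] ℝ × ℝ) hinj).toContinuousLinearEquiv
    with he
  have hfe : HasFDerivAt f (e : ℝ × ℝ →L[ℝ] ℝ × ℝ) p := by
    have h1 : (e : ℝ × ℝ →L[ℝ] ℝ × ℝ) = fderiv ℝ f p := by
      ext <;> simp [he]
    rw [h1]
    exact (hfs.differentiableAt (by simp)).hasFDerivAt
  have hne : (∞ : WithTop ℕ∞) ≠ 0 := by simp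
  have hst : HasStrictFDerivAt f (e : ℝ × ℝ →L[ℝ] ℝ × ℝ) p := hfs.hasStrictFDerivAt' hfe hne
  have hg := hfs.to_localInverse hfe hne
  have hgp : hfs.localInverse hfe hne (f p) = p := hfs.localInverse_apply_image hfe hne
  -- The new function is the `ψ̃`-component along the graph, composed with the local inverse of `(t,
  -- x) ↦ (t̃, x̃)` given by the inverse function theorem.
  refine ⟨fun y => (φ ((hfs.localInverse hfe hne y).1, (hfs.localInverse hfe hne y).2,
    u (hfs.localInverse hfe hne y))).2.2, ?_, ?_⟩
  · have h1 : ContDiffAt ℝ ∞ (fun q : ℝ × ℝ => (φ (q.1, q.2, u q)).2.2) p := hφU.snd.snd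
    exact ContDiffAt.comp (f p) (g := fun q : ℝ × ℝ => (φ (q.1, q.2, u q)).2.2)
      (by rw [hgp]; exact h1) hg
  · have h2 : ∀ᶠ q in 𝓝 p, hfs.localInverse hfe hne (f q) = q := hst.eventually_left_inverse
    filter_upwards [h2] with q hq
    have hq' : hfs.localInverse hfe hne (indep (φ (q.1, q.2, u q))) = q := hq
    rw [hq']

theorem IsPointTransformation.contDiffAt {φ : OpenPartialHomeomorph Var Var}
    (hφ : IsPointTransformation φ) {z : Var} (hz : z ∈ φ.source) : ContDiffAt ℝ ∞ φ z :=
  hφ.contDiffOn.contDiffAt (φ.open_source.mem_nhds hz)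

/-- The relation between the jets at a point and their images, for jets with `u_tx = 0`. -/
theorem CarriesOn.jet {φ : OpenPartialHomeomorph Var Var} {N : Set Var} {θ θ' : Equation}
    (hφ : IsPointTransformation φ) (hC : CarriesOn φ N θ θ') {z : Var} (hz : z ∈ N)
    (a b c w : ℂ)
    (hJ : ∀ h : ℝ × ℝ, indep (fderiv ℝ φ z (h.1, h.2, h.1 * b + h.2 * a)) = 0 → h = 0) :
    ∃ (Λ : ℝ × ℝ →L[ℝ] ℂ) (M : ℝ × ℝ →L[ℝ] ℝ × ℝ →L[ℝ] ℂ),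
      (∀ (h : ℝ × ℝ) (e k : Var), e = (h.1, h.2, h.1 * b + h.2 * a) →
        k = (0, 0, h.1 ^ 2 * c + h.2 ^ 2 * w) →
        Λ (indep (fderiv ℝ φ z e)) = (fderiv ℝ φ z e).2.2 ∧
        M (indep (fderiv ℝ φ z e)) (indep (fderiv ℝ φ z e))
          + Λ (indep (fderiv ℝ (fderiv ℝ φ) z e e + fderiv ℝ φ z k))
          = (fderiv ℝ (fderiv ℝ φ) z e e + fderiv ℝ φ z k).2.2) ∧
      (Complex.I * b + w + θ.S z * z.2.2 = 0 ↔
        Complex.I * Λ (1, 0) + M (0, 1) (0, 1) + θ'.S (φ z) * (φ z).2.2 = 0) := by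
  obtain ⟨t, x, ψ⟩ := z
  set u := quadJet (t, x) ψ a b c w with hudef
  have hus : ContDiffAt ℝ ∞ u (t, x) := (contDiff_quadJet _ _ _ _ _ _).contDiffAt
  have hu0 : u (t, x) = ψ := quadJet_self _ _ _ _ _ _
  have hud := fderiv_quadJet (t, x) ψ a b c w
  rw [← hudef] at hud
  have hφs : ContDiffAt ℝ ∞ φ (t, x, ψ) := hφ.contDiffAt (hC.subset_source hz)
  obtain ⟨v, hv, hm⟩ := exists_mapsGraph (φ := φ) (u := u) (p := (t, x))
    (by simpa only [hu0] using hφs) hus (by simpa only [hu0, hud] using hJ)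
  have hv' := hv
  rw [hu0] at hv'
  refine ⟨fderiv ℝ v (indep (φ (t, x, ψ))), fderiv ℝ (fderiv ℝ v) (indep (φ (t, x, ψ))), ?_, ?_⟩
  · intro h e k he hk
    refine prolongation (φ := φ) (u := u) (v := v) (p := (t, x)) ?_ (hus.of_le two_le_infty)
      (hv.of_le two_le_infty) hm h (by rw [hu0]) (by rw [he, (hud h).1]) (by rw [hk, (hud h).2])
    rw [hu0]
    exact hφs.of_le two_le_infty
  · have h1 := hC.holdsAt_iff (t, x) u v (by simpa only [hu0] using hz) hus hv hm
    rw [θ.holdsAt_iff_fderiv (hus.of_le two_le_infty),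
      θ'.holdsAt_iff_fderiv (hv.of_le two_le_infty)] at h1
    have h2 : v (indep (φ (t, x, ψ))) = (φ (t, x, ψ)).2.2 := by
      have := hm.self_of_nhds
      simpa only [hu0] using this
    rw [(hud _).1, (hud _).2] at h1
    simp only [hu0, h2] at h1
    simpa [indep] using h1

/-! ### The new time depends on the old time only. -/

section Determining

variable {φ : OpenPartialHomeomorph Var Var} {N : Set Var} {θ θ' : Equation} {z : Var}

theorem IsPointTransformation.fderiv_injective (hφ : IsPointTransformation φ)
    (hz : z ∈ φ.source) : Function.Injective (fderiv ℝ φ z) := by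
  have h1 : HasFDerivAt φ (fderiv ℝ φ z) z :=
    ((hφ.contDiffAt hz).differentiableAt (by simp)).hasFDerivAt
  have h2 : ContDiffAt ℝ ∞ φ.symm (φ z) :=
    hφ.contDiffOn_symm.contDiffAt (φ.open_target.mem_nhds (φ.map_source hz))
  have h3 := (h2.differentiableAt (by simp)).hasFDerivAt.comp z h1
  have h4 : (φ.symm ∘ φ) =ᶠ[𝓝 z] id := φ.eventually_left_inverse hz
  have h5 := (h3.congr_of_eventuallyEq h4.symm).unique (hasFDerivAt_id z)
  intro e k hek
  have h6 := congrArg (fun L => L e) h5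
  have h7 := congrArg (fun L => L k) h5
  simp only [ContinuousLinearMap.comp_apply, ContinuousLinearMap.id_apply] at h6 h7
  rw [← h6, ← h7, hek]

theorem IsPointTransformation.fderiv_surjective (hφ : IsPointTransformation φ)
    (hz : z ∈ φ.source) : Function.Surjective (fderiv ℝ φ z) :=
  (LinearMap.injective_iff_surjective (f := (fderiv ℝ φ z : Var →ₗ[ℝ] Var))).1
    (hφ.fderiv_injective hz)

/-- The equation contains no `u_tt`. Two solution jets that differ only in `u_tt` must have images
with the same `v_x̃x̃`. If the new time varied in the direction `(0, 1, a)`, then `u_tt` would enter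
`v_x̃x̃`. -/
theorem CarriesOn.fderiv_time_aux (hφ : IsPointTransformation φ)
    (hC : CarriesOn φ N θ θ') (hz : z ∈ N) (a : ℂ) : (fderiv ℝ φ z (0, 1, a)).1 = 0 := by
  by_contra hd
  have hinj := hφ.fderiv_injective (hC.subset_source hz)
  have hsurj := hφ.fderiv_surjective (hC.subset_source hz)
  set D := fderiv ℝ φ z with hD
  set d := D (0, 1, a) with hdd
  -- A value `b` of `u_t` for which the image of the graph is again a graph. If the Jacobian
  -- vanished for all `b`, the functional `e ↦ (D e).1 * d.2.1 - d.1 * (D e).2.1` would be zero, but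
  -- it is `-d.1` at a preimage of `(0, 1, 0)`.
  obtain ⟨b, hb⟩ : ∃ b : ℂ, (D (1, 0, b)).1 * d.2.1 - d.1 * (D (1, 0, b)).2.1 ≠ 0 := by
    by_contra! hall
    obtain ⟨y, hy⟩ := hsurj (0, 1, 0)
    have h1 : y = y.1 • ((1, 0, 0) : Var) + y.2.1 • ((0, 1, a) : Var)
        + ((1, 0, y.2.2 - y.2.1 * a) - (1, 0, 0) : Var) := by
      ext <;> simp
    have h2 := congrArg D h1
    rw [hy, map_add, map_add, map_sub, map_smul, map_smul, ← hdd] at h2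
    have h3 := hall 0
    have h4 := hall (y.2.2 - y.2.1 * a)
    have h5 := congrArg (fun q : Var => q.1) h2
    have h6 := congrArg (fun q : Var => q.2.1) h2
    simp at h5 h6
    apply hd
    linear_combination d.1 * h6 - d.2.1 * h5 - (y.1 - 1) * h3 - h4
  -- The value of `u_xx` for which the jet satisfies the equation.
  set w : ℂ := -Complex.I * b - θ.S z * z.2.2
  have hDe : ∀ h : ℝ × ℝ, D (h.1, h.2, h.1 * b + h.2 * a) = h.1 • D (1, 0, b) + h.2 • d := by
    intro h
    rw [hdd, ← map_smul, ← map_smul, ← map_add]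
    congr 1
    ext <;> simp
  have hJ : ∀ h : ℝ × ℝ, indep (D (h.1, h.2, h.1 * b + h.2 * a)) = 0 → h = 0 := by
    intro h hh
    rw [hDe] at hh
    simp only [indep, Prod.mk_eq_zero] at hh
    obtain ⟨h1, h2⟩ := hh
    simp at h1 h2
    have h3 : h.1 * ((D (1, 0, b)).1 * d.2.1 - d.1 * (D (1, 0, b)).2.1) = 0 := by
      linear_combination d.2.1 * h1 - d.1 * h2
    have h4 : h.1 = 0 := (mul_eq_zero.1 h3).resolve_right hb
    rw [h4] at h1
    have h5 : h.2 = 0 := by simpa [hd] using h1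
    exact Prod.ext h4 h5
  have hfs : ∀ y : ℝ × ℝ, ∃ h : ℝ × ℝ, indep (D (h.1, h.2, h.1 * b + h.2 * a)) = y := by
    intro y
    set J := (D (1, 0, b)).1 * d.2.1 - d.1 * (D (1, 0, b)).2.1 with hJdef
    refine ⟨((y.1 * d.2.1 - d.1 * y.2) / J,
      ((D (1, 0, b)).1 * y.2 - (D (1, 0, b)).2.1 * y.1) / J), ?_⟩
    rw [hDe]
    ext
    · simp [indep]
      field_simp
      rw [hJdef]
      ring
    · simp [indep]
      field_simp
      rw [hJdef]
      ring
  obtain ⟨Λ₀, M₀, hL₀, he₀⟩ := hC.jet hφ hz a b 0 w hJ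
  obtain ⟨Λ₁, M₁, hL₁, he₁⟩ := hC.jet hφ hz a b 1 w hJ
  have hΛ : Λ₀ = Λ₁ := by
    refine ContinuousLinearMap.ext fun y => ?_
    obtain ⟨h, rfl⟩ := hfs y
    rw [(hL₀ h _ _ rfl rfl).1, (hL₁ h _ _ rfl rfl).1]
  have hw : Complex.I * b + w + θ.S z * z.2.2 = 0 := by simp only [w]; ring
  have hM : M₀ (0, 1) (0, 1) = M₁ (0, 1) (0, 1) := by
    have h1 := he₀.1 hw
    have h2 := he₁.1 hw
    rw [hΛ] at h1
    linear_combination h1 - h2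
  -- The direction `h` is carried to the `x̃`-axis. Changing `u_tt` by 1 shifts the second-order
  -- relation along it by the image of the vertical vector `h.1 ^ 2`; since `v_x̃x̃` is unchanged,
  -- that image is tangent to the new graph, and injectivity of `D` gives `h.1 = 0`.
  obtain ⟨h, hh⟩ := hfs (0, 1)
  have e0 := (hL₀ h _ _ rfl rfl).2
  have e1 := (hL₁ h _ _ rfl rfl).2
  rw [← hD, hh] at e0 e1
  rw [hM, hΛ] at e0
  have hk : ((0, 0, (h.1 : ℂ) ^ 2 * 1 + h.2 ^ 2 * w) : Var) =
      (0, 0, (h.1 : ℂ) ^ 2 * 0 + h.2 ^ 2 * w) + (0, 0, (h.1 : ℂ) ^ 2) := by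
    ext <;> simp [add_comm]
  rw [hk, map_add] at e1
  simp only [← indepL_apply, map_add] at e0 e1
  have h3 : Λ₁ (indepL (D (0, 0, (h.1 : ℂ) ^ 2))) = (D (0, 0, (h.1 : ℂ) ^ 2)).2.2 := by
    simp only [Prod.snd_add] at e0 e1
    linear_combination e1 - e0
  obtain ⟨h', hh'⟩ := hfs (indepL (D (0, 0, (h.1 : ℂ) ^ 2)))
  have h4 := (hL₁ h' _ _ rfl rfl).1
  rw [← hD, hh', h3] at h4
  have h5 : D (h'.1, h'.2, h'.1 * b + h'.2 * a) = D (0, 0, (h.1 : ℂ) ^ 2) :=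
    Prod.ext (congrArg (fun q : ℝ × ℝ => q.1) hh')
      (Prod.ext (congrArg (fun q : ℝ × ℝ => q.2) hh') h4.symm)
  have h6 := hinj h5
  have h7 : h'.1 = 0 := congrArg (fun q : Var => q.1) h6
  have h8 : h'.2 = 0 := congrArg (fun q : Var => q.2.1) h6
  have h9 := congrArg (fun q : Var => q.2.2) h6
  simp [h7, h8] at h9
  have h12 : h.1 = 0 := by simpa using h9.symm
  have h10 := congrArg Prod.fst hh
  rw [hDe, h12] at h10
  simp [indep, hd] at h10
  have h11 := congrArg Prod.snd hh
  rw [hDe, h12, h10] at h11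
  simp [indep] at h11

/-- The new time depends only on the old one. -/
theorem CarriesOn.fderiv_time (hφ : IsPointTransformation φ) (hC : CarriesOn φ N θ θ')
    (hz : z ∈ N) {e : Var} (he : e.1 = 0) : (fderiv ℝ φ z e).1 = 0 := by
  have h0 := hC.fderiv_time_aux hφ hz 0
  have h1 := hC.fderiv_time_aux hφ hz (e.2.2 + 1 - 1 - (e.2.1 - 1) * 0)
  -- Vectors with zero time component are spanned by those covered by the auxiliary lemma; the
  -- padded last entry is just `e.2.2`.
  have h2 : e = (e.2.1 - 1) • ((0, 1, 0) : Var) + (0, 1, e.2.2 + 1 - 1 - (e.2.1 - 1) * 0) := by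
    ext <;> simp [he]
  rw [h2, map_add, map_smul]
  simp [h0]
  simpa using h1

theorem CarriesOn.fderiv_time_ne_zero (hφ : IsPointTransformation φ) (hC : CarriesOn φ N θ θ')
    (hz : z ∈ N) : (fderiv ℝ φ z (1, 0, 0)).1 ≠ 0 := by
  intro h0
  obtain ⟨y, hy⟩ := hφ.fderiv_surjective (hC.subset_source hz) (1, 0, 0)
  have h1 : y = y.1 • ((1, 0, 0) : Var) + (0, y.2) := by ext <;> simp
  have h2 := congrArg (fun q : Var => q.1) hy
  simp only at h2
  rw [h1, map_add, map_smul] at h2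
  simp [h0, hC.fderiv_time hφ hz (e := (0, y.2)) rfl] at h2

end Determining

/-! ### First-order determining equations. -/

/-- The inclusion of the vertical direction `ψ`. -/
def vert : ℂ →L[ℝ] Var := (ContinuousLinearMap.inr ℝ ℝ (ℝ × ℂ)).comp (ContinuousLinearMap.inr ℝ ℝ ℂ)

theorem vert_apply (w : ℂ) : vert w = (0, 0, w) := rfl

/-- The projections of the space of `(t, x, ψ)`. -/
def projT : Var →L[ℝ] ℝ := ContinuousLinearMap.fst ℝ ℝ (ℝ × ℂ)
def projX : Var →L[ℝ] ℝ :=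
  (ContinuousLinearMap.fst ℝ ℝ ℂ).comp (ContinuousLinearMap.snd ℝ ℝ (ℝ × ℂ))
def projψ : Var →L[ℝ] ℂ :=
  (ContinuousLinearMap.snd ℝ ℝ ℂ).comp (ContinuousLinearMap.snd ℝ ℝ (ℝ × ℂ))

theorem projT_apply (z : Var) : projT z = z.1 := rfl
theorem projX_apply (z : Var) : projX z = z.2.1 := rfl
theorem projψ_apply (z : Var) : projψ z = z.2.2 := rfl

theorem map_fderiv_fderiv {G : Type*} [NormedAddCommGroup G] [NormedSpace ℝ G]
    (P : Var →L[ℝ] G) {φ : Var → Var} {z : Var} (hφ : ContDiffAt ℝ ∞ φ z) (k e : Var) :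
    P (fderiv ℝ (fderiv ℝ φ) z k e) = fderiv ℝ (fun y => P (fderiv ℝ φ y e)) z k := by
  rw [← dirDeriv_dirDeriv e k (hφ.of_le two_le_infty)]
  have h1 := (contDiffAt_dirDeriv (e := e) hφ).differentiableAt (by simp)
  have h2 : HasFDerivAt (fun y => P (fderiv ℝ φ y e)) _ z := P.hasFDerivAt.comp z h1.hasFDerivAt
  rw [h2.fderiv]
  rfl

theorem fderiv_fderiv_symm {φ : Var → Var} {z : Var} (hφ : ContDiffAt ℝ ∞ φ z) (k e : Var) :
    fderiv ℝ (fderiv ℝ φ) z k e = fderiv ℝ (fderiv ℝ φ) z e k :=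
  ((hφ.of_le two_le_infty).isSymmSndFDerivAt (by simp)).eq k e

/-- First-order relations hold on an open set, so they may be differentiated in any direction. -/
theorem map_fderiv_fderiv_eq_zero {G : Type*} [NormedAddCommGroup G] [NormedSpace ℝ G]
    (P : Var →L[ℝ] G) {φ : Var → Var} {z : Var} (hφ : ContDiffAt ℝ ∞ φ z) (k e : Var) {c : G}
    (hc : ∀ᶠ y in 𝓝 z, P (fderiv ℝ φ y e) = c) :
    P (fderiv ℝ (fderiv ℝ φ) z k e) = 0 := by
  rw [map_fderiv_fderiv P hφ]
  have h1 : (fun y => P (fderiv ℝ φ y e)) =ᶠ[𝓝 z] fun _ => c := hc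
  rw [h1.fderiv_eq]
  simp

section Determining

variable {φ : OpenPartialHomeomorph Var Var} {N : Set Var} {θ θ' : Equation} {z : Var}

theorem CarriesOn.contDiffAt (hφ : IsPointTransformation φ) (hC : CarriesOn φ N θ θ')
    (hz : z ∈ N) : ContDiffAt ℝ ∞ φ z := hφ.contDiffAt (hC.subset_source hz)

theorem CarriesOn.fderiv_fderiv_time (hφ : IsPointTransformation φ) (hC : CarriesOn φ N θ θ')
    (hN : IsOpen N) (hz : z ∈ N) {e : Var} (he : e.1 = 0) (k : Var) :
    (fderiv ℝ (fderiv ℝ φ) z k e).1 = 0 := by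
  refine map_fderiv_fderiv_eq_zero projT (hC.contDiffAt hφ hz) k e (c := 0) ?_
  filter_upwards [hN.mem_nhds hz] with y hy using hC.fderiv_time hφ hy he

/-- The transformed equation in terms of the old jet variables. -/
theorem CarriesOn.determining (hφ : IsPointTransformation φ) (hC : CarriesOn φ N θ θ')
    (hN : IsOpen N) (hz : z ∈ N) (a w l : ℂ) (τ χ : ℝ)
    (hτ : (fderiv ℝ φ z (1, 0, 0)).1 = τ) (hχ : (fderiv ℝ φ z (0, 1, a)).2.1 = χ) (hχ0 : χ ≠ 0)
    (hl : (fderiv ℝ φ z (0, 1, a)).2.2 = χ * l)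
    (L : ℂ → ℂ) (hL : ∀ c, L c =
      (fderiv ℝ φ z (vert c)).2.2 - (fderiv ℝ φ z (vert c)).2.1 * l) :
    Complex.I / τ * ((fderiv ℝ φ z (1, 0, 0)).2.2 - (fderiv ℝ φ z (1, 0, 0)).2.1 * l
        + L (Complex.I * w) + L (Complex.I * (θ.S z * z.2.2)))
      + ((fderiv ℝ (fderiv ℝ φ) z (0, 1, a) (0, 1, a)).2.2
        - (fderiv ℝ (fderiv ℝ φ) z (0, 1, a) (0, 1, a)).2.1 * l + L w) / (χ : ℂ) ^ 2
      + θ'.S (φ z) * (φ z).2.2 = 0 := by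
  have hτ0 : τ ≠ 0 := by rw [← hτ]; exact hC.fderiv_time_ne_zero hφ hz
  have hT : ∀ e : Var, e.1 = 0 → (fderiv ℝ φ z e).1 = 0 := fun e he => hC.fderiv_time hφ hz he
  have hTT : (fderiv ℝ (fderiv ℝ φ) z (0, 1, a) (0, 1, a)).1 = 0 :=
    hC.fderiv_fderiv_time hφ hN hz rfl _
  -- This is `u_t` solved from the equation, with `u_x = a` and `u_xx = w` left free.
  set b : ℂ := Complex.I * w + Complex.I * (θ.S z * z.2.2) with hb
  have hJ : ∀ h : ℝ × ℝ, indep (fderiv ℝ φ z (h.1, h.2, h.1 * b + h.2 * a)) = 0 → h = 0 := by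
    intro h hh
    have h1 : ((h.1, h.2, h.1 * b + h.2 * a) : Var) =
        h.1 • (1, 0, 0) + h.2 • (0, 1, a) + h.1 • vert b := by
      ext <;> simp [vert_apply, add_comm]
    rw [h1, map_add, map_add, map_smul, map_smul, map_smul] at hh
    simp only [indep, Prod.mk_eq_zero] at hh
    obtain ⟨h2, h3⟩ := hh
    simp [hτ, hT _ (show ((0, 1, a) : Var).1 = 0 from rfl),
      hT _ (show (vert b).1 = 0 from rfl), hτ0] at h2
    simp [h2, hχ, hχ0] at h3
    exact Prod.ext h2 h3
  obtain ⟨Λ, M, h1, h2⟩ := hC.jet hφ hz a b 0 w hJ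
  have hz0 : Complex.I * b + w + θ.S z * z.2.2 = 0 := by
    rw [hb]
    linear_combination (w + θ.S z * z.2.2) * Complex.I_mul_I
  have h3 := h2.1 hz0
  -- The direction `(0, 1)` is carried to a multiple of the `x̃`-axis and yields `v_x̃ = l` and
  -- `v_x̃x̃`; the direction `(1, 0)` then yields `v_t̃`.
  obtain ⟨p1, p2⟩ := h1 (0, 1) (0, 1, a) (vert w) (by simp) (by simp [vert_apply])
  obtain ⟨q1, -⟩ := h1 (1, 0) ((1, 0, 0) + vert b) 0 (by simp [vert_apply]) (by simp; rfl)
  have i1 : indep (fderiv ℝ φ z (0, 1, a)) = χ • ((0, 1) : ℝ × ℝ) := by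
    ext
    · simp [indep, hT]
    · simp [indep, hχ]
  have i2 : indep (fderiv ℝ (fderiv ℝ φ) z (0, 1, a) (0, 1, a) + fderiv ℝ φ z (vert w)) =
      ((fderiv ℝ (fderiv ℝ φ) z (0, 1, a) (0, 1, a)).2.1 + (fderiv ℝ φ z (vert w)).2.1)
        • ((0, 1) : ℝ × ℝ) := by
    ext
    · simp [indep, hTT, hT _ (show (vert w).1 = 0 from rfl)]
    · simp [indep]
  have i3 : indep (fderiv ℝ φ z ((1, 0, 0) + vert b)) = τ • ((1, 0) : ℝ × ℝ) +
      ((fderiv ℝ φ z (1, 0, 0)).2.1 + (fderiv ℝ φ z (vert b)).2.1) • ((0, 1) : ℝ × ℝ) := by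
    rw [map_add]
    ext
    · simp [indep, hτ, hT _ (show (vert b).1 = 0 from rfl)]
    · simp [indep]
  rw [i1] at p1 p2
  rw [i2] at p2
  rw [i3, map_add] at q1
  simp only [map_smul, map_add, _root_.smul_apply, Complex.real_smul,
    Prod.snd_add] at p1 p2 q1
  have hχc : (χ : ℂ) ≠ 0 := by exact_mod_cast hχ0
  have hτc : (τ : ℂ) ≠ 0 := by exact_mod_cast hτ0
  have hΛ : Λ (0, 1) = l := by
    rw [hl] at p1
    exact mul_left_cancel₀ hχc p1
  rw [hΛ] at p2 q1
  have hLb : L b = L (Complex.I * w) + L (Complex.I * (θ.S z * z.2.2)) := by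
    simp only [hL, hb, map_add, Prod.snd_add, Prod.fst_add]
    push_cast
    ring
  have hM : M (0, 1) (0, 1) = ((fderiv ℝ (fderiv ℝ φ) z (0, 1, a) (0, 1, a)).2.2
        - (fderiv ℝ (fderiv ℝ φ) z (0, 1, a) (0, 1, a)).2.1 * l + L w) / (χ : ℂ) ^ 2 := by
    rw [hL, eq_div_iff (pow_ne_zero 2 hχc)]
    push_cast at p2
    linear_combination p2
  have hΛ1 : Complex.I * Λ (1, 0) = Complex.I / τ * ((fderiv ℝ φ z (1, 0, 0)).2.2
      - (fderiv ℝ φ z (1, 0, 0)).2.1 * l + L b) := by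
    rw [hL]
    push_cast at q1
    field_simp
    linear_combination q1
  rw [hM, hΛ1, hLb] at h3
  linear_combination h3

/-- The transformed equation is real-affine in the free value `w` of `u_xx`, so its linear part
vanishes, which is the first relation. Applying that relation twice and using `i² = -1` gives
`(τ/χ²)² = 1`. -/
theorem CarriesOn.multiplier (hφ : IsPointTransformation φ) (hC : CarriesOn φ N θ θ')
    (hN : IsOpen N) (hz : z ∈ N) (a l : ℂ) (τ χ : ℝ)
    (hτ : (fderiv ℝ φ z (1, 0, 0)).1 = τ) (hχ : (fderiv ℝ φ z (0, 1, a)).2.1 = χ) (hχ0 : χ ≠ 0)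
    (hl : (fderiv ℝ φ z (0, 1, a)).2.2 = χ * l)
    (L : ℂ → ℂ) (hL : ∀ c, L c =
      (fderiv ℝ φ z (vert c)).2.2 - (fderiv ℝ φ z (vert c)).2.1 * l) :
    (∀ w, L (Complex.I * w) = Complex.I * (τ / χ ^ 2) * L w) ∧ χ ^ 4 = τ ^ 2 := by
  have hτ0 : τ ≠ 0 := by rw [← hτ]; exact hC.fderiv_time_ne_zero hφ hz
  have hχc : (χ : ℂ) ≠ 0 := by exact_mod_cast hχ0
  have hτc : (τ : ℂ) ≠ 0 := by exact_mod_cast hτ0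
  have h0 := hC.determining hφ hN hz a 0 l τ χ hτ hχ hχ0 hl L hL
  have hL0 : L 0 = 0 := by simp [hL]
  have h1 : ∀ w, L (Complex.I * w) = Complex.I * (τ / χ ^ 2) * L w := by
    intro w
    have hw := hC.determining hφ hN hz a w l τ χ hτ hχ hχ0 hl L hL
    rw [mul_zero, hL0] at h0
    have h2 : Complex.I / τ * L (Complex.I * w) + L w / (χ : ℂ) ^ 2 = 0 := by
      linear_combination hw - h0
    field_simp at h2 ⊢
    linear_combination (-Complex.I) * h2 + L (Complex.I * w) * χ ^ 2 * Complex.I_sq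
  refine ⟨h1, ?_⟩
  -- Otherwise `χ • vert 1 - m • (0, 1, a)` would lie in the kernel of the derivative of `φ`.
  have hL1 : L 1 ≠ 0 := by
    intro h
    rw [hL] at h
    set m := (fderiv ℝ φ z (vert 1)).2.1
    have h2 : fderiv ℝ φ z (χ • vert 1 - m • (0, 1, a)) = 0 := by
      rw [map_sub, map_smul, map_smul]
      ext : 1
      · simp [hC.fderiv_time hφ hz (show (vert 1).1 = 0 from rfl),
          hC.fderiv_time hφ hz (show ((0, 1, a) : Var).1 = 0 from rfl)]
      ext : 1
      · simp only [Prod.snd_sub, Prod.fst_sub, Prod.smul_snd, Prod.smul_fst, hχ, smul_eq_mul,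
          Prod.snd_zero, Prod.fst_zero]
        ring
      · simp only [Prod.snd_sub, Prod.smul_snd, hl, Complex.real_smul, Prod.snd_zero]
        linear_combination (χ : ℂ) * h
    have h3 : χ • vert 1 - m • ((0, 1, a) : Var) = 0 :=
      hφ.fderiv_injective (hC.subset_source hz) (by rw [h2, map_zero])
    have h4 := congrArg (fun q : Var => q.2.1) h3
    simp [vert_apply] at h4
    have h5 := congrArg (fun q : Var => q.2.2) h3
    simp [vert_apply, h4, hχ0] at h5
  have h2 : L (Complex.I * (Complex.I * 1)) = -L 1 := by
    rw [← mul_assoc, Complex.I_mul_I, hL, hL, neg_one_mul, map_neg, map_neg]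
    simp
    ring
  rw [h1, h1] at h2
  have h3 : ((τ : ℂ) / χ ^ 2) ^ 2 = 1 := by
    apply mul_right_cancel₀ hL1
    linear_combination -h2 + ((τ : ℂ) / χ ^ 2) ^ 2 * L 1 * Complex.I_sq
  have h4 : (χ : ℂ) ^ 4 = τ ^ 2 := by
    field_simp at h3
    rw [h3]
  exact_mod_cast h4

/-- The new space variable does not depend on `ψ`. -/
theorem CarriesOn.fderiv_space_vert (hφ : IsPointTransformation φ) (hC : CarriesOn φ N θ θ')
    (hN : IsOpen N) (hz : z ∈ N) (w : ℂ) : (fderiv ℝ φ z (vert w)).2.1 = 0 := by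
  by_contra hd
  set d := (fderiv ℝ φ z (vert w)).2.1 with hdd
  set τ := (fderiv ℝ φ z (1, 0, 0)).1 with hτ
  -- If `x̃` depended on `ψ`, a choice of `u_x` could give `D_x x̃` any real value, whereas `χ ^ 4 =
  -- τ ^ 2` is forced. The value `1 + τ ^ 2` violates this for every `τ`.
  set χ : ℝ := 1 + τ ^ 2
  have hχ0 : χ ≠ 0 := by positivity
  set s : ℝ := (χ - (fderiv ℝ φ z (0, 1, 0)).2.1) / d
  have hχ : (fderiv ℝ φ z (0, 1, s * w)).2.1 = χ := by
    have h1 : ((0, 1, s * w) : Var) = (0, 1, 0) + s • vert w := by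
      ext <;> simp [vert_apply]
    rw [h1, map_add, map_smul]
    simp only [Prod.snd_add, Prod.fst_add, Prod.smul_snd, Prod.smul_fst, smul_eq_mul, ← hdd, s]
    field_simp
    ring
  have hχc : (χ : ℂ) ≠ 0 := by exact_mod_cast hχ0
  have h2 := (hC.multiplier hφ hN hz (s * w) _ τ χ hτ.symm hχ hχ0
    (mul_div_cancel₀ _ hχc).symm _ (fun c => rfl)).2
  simp only [χ] at h2
  nlinarith [sq_nonneg τ, sq_nonneg (τ ^ 2), sq_nonneg (τ ^ 3), sq_nonneg (τ ^ 4)]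

theorem CarriesOn.fderiv_space_ne_zero (hφ : IsPointTransformation φ)
    (hC : CarriesOn φ N θ θ') (hN : IsOpen N) (hz : z ∈ N) :
    (fderiv ℝ φ z (0, 1, 0)).2.1 ≠ 0 := by
  intro h0
  obtain ⟨y, hy⟩ := hφ.fderiv_surjective (hC.subset_source hz) (0, 1, 0)
  have h1 : y = y.1 • ((1, 0, 0) : Var) + y.2.1 • (0, 1, 0) + vert y.2.2 := by
    ext <;> simp [vert_apply]
  rw [h1, map_add, map_add, map_smul, map_smul] at hy
  have h2 := congrArg (fun q : Var => q.1) hy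
  have h3 := congrArg (fun q : Var => q.2.1) hy
  simp [hC.fderiv_time hφ hz (show (vert y.2.2).1 = 0 from rfl),
    hC.fderiv_time hφ hz (show ((0, 1, 0) : Var).1 = 0 from rfl),
    hC.fderiv_time_ne_zero hφ hz] at h2
  simp [h0, h2, hC.fderiv_space_vert hφ hN hz] at h3

theorem CarriesOn.fderiv_space_sq (hφ : IsPointTransformation φ)
    (hC : CarriesOn φ N θ θ') (hN : IsOpen N) (hz : z ∈ N) :
    (fderiv ℝ φ z (0, 1, 0)).2.1 ^ 2 = |(fderiv ℝ φ z (1, 0, 0)).1| := by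
  have h0 := hC.fderiv_space_ne_zero hφ hN hz
  have h1 := (hC.multiplier hφ hN hz 0 _ _ _ rfl rfl h0
    (mul_div_cancel₀ _ (by exact_mod_cast h0)).symm _ (fun c => rfl)).2
  rw [← abs_of_nonneg (sq_nonneg (fderiv ℝ φ z (0, 1, 0)).2.1), ← sq_eq_sq_iff_abs_eq_abs, ← h1]
  ring

/-- The dependence of the new `ψ` on the old one is linear or antilinear to first order. -/
theorem CarriesOn.fderiv_vert_I_mul (hφ : IsPointTransformation φ)
    (hC : CarriesOn φ N θ θ') (hN : IsOpen N) (hz : z ∈ N) (w : ℂ) :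
    (fderiv ℝ φ z (vert (Complex.I * w))).2.2 = Complex.I *
      (SignType.sign (fderiv ℝ φ z (1, 0, 0)).1 : ℝ) * (fderiv ℝ φ z (vert w)).2.2 := by
  have h0 := hC.fderiv_space_ne_zero hφ hN hz
  have h1 := (hC.multiplier hφ hN hz 0 _ _ _ rfl rfl h0
    (mul_div_cancel₀ _ (by exact_mod_cast h0)).symm _ (fun c => rfl)).1 w
  have h2 := hC.fderiv_time_ne_zero hφ hz
  simp only [hC.fderiv_space_vert hφ hN hz, Complex.ofReal_zero, zero_mul, sub_zero] at h1
  have h3 : (fderiv ℝ φ z (1, 0, 0)).1 / |(fderiv ℝ φ z (1, 0, 0)).1| =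
      (SignType.sign (fderiv ℝ φ z (1, 0, 0)).1 : ℝ) := by
    rw [div_eq_iff (abs_ne_zero.2 h2), sign_mul_abs]
  rw [h1, ← h3, ← hC.fderiv_space_sq hφ hN hz]
  push_cast
  rfl

end Determining

/-! ### Differentiation along lines, the logarithm, and the hat operation. -/

theorem hasDerivAt_map_fderiv_line {G : Type*} [NormedAddCommGroup G] [NormedSpace ℝ G]
    (P : Var →L[ℝ] G) {φ : Var → Var} {z : Var} (hφ : ContDiffAt ℝ ∞ φ z) (k e : Var) :
    HasDerivAt (fun s : ℝ => P (fderiv ℝ φ (z + s • k) e))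
      (P (fderiv ℝ (fderiv ℝ φ) z k e)) 0 := by
  rw [map_fderiv_fderiv P hφ]
  have h1 := (contDiffAt_dirDeriv (e := e) hφ).differentiableAt (by simp)
  have h2 : DifferentiableAt ℝ (fun y => P (fderiv ℝ φ y e)) z :=
    P.differentiableAt.comp z h1
  exact hasDerivAt_line h2

theorem tendsto_line (z k : Var) : Filter.Tendsto (fun s : ℝ => z + s • k) (𝓝 0) (𝓝 z) := by
  simpa [ContinuousAt] using (hasDerivAt_add_smul z k 0).continuousAt

theorem hasDerivAt_log_norm {g : ℝ → ℂ} {g' : ℂ} {s : ℝ} (hg : HasDerivAt g g' s)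
    (h0 : g s ≠ 0) : HasDerivAt (fun r => Real.log ‖g r‖) (g' / g s).re s := by
  have h1 : (fun r => Real.log ‖g r‖) =
      fun r => 1 / 2 * Real.log ((g r).re * (g r).re + (g r).im * (g r).im) := by
    funext r
    rw [Complex.norm_def, Complex.normSq_apply, Real.log_sqrt (add_nonneg (mul_self_nonneg _) (mul_self_nonneg _))]
    ring
  have hre : HasDerivAt (fun r => (g r).re) g'.re s := Complex.reCLM.hasFDerivAt.comp_hasDerivAt s hg
  have him : HasDerivAt (fun r => (g r).im) g'.im s := Complex.imCLM.hasFDerivAt.comp_hasDerivAt s hg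
  have hp : (g s).re * (g s).re + (g s).im * (g s).im ≠ 0 := by
    rw [← Complex.normSq_apply]
    simpa using h0
  rw [h1]
  refine ((((hre.mul hre).add (him.mul him)).log hp).const_mul (1 / 2)).congr_deriv ?_
  rw [Complex.div_re, Complex.normSq_apply]
  simp only [Pi.add_apply, Pi.mul_apply]
  field_simp
  ring

/-- Both cases of the hat are written with one sign, the form in which the sign of `T_t` enters the
determining equations. -/
theorem hat_eq (τ : ℝ) (hτ : τ ≠ 0) (β : ℂ) :
    hat τ β = β.re + Complex.I * (SignType.sign τ : ℝ) * β.im := by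
  rcases lt_or_gt_of_ne hτ with h | h
  · rw [hat, if_neg h.not_gt, sign_neg h]
    apply Complex.ext <;> simp
  · rw [hat, if_pos h, sign_pos h]
    apply Complex.ext <;> simp

theorem hat_mul (τ : ℝ) (β γ : ℂ) : hat τ (β * γ) = hat τ β * hat τ γ := by
  unfold hat; split_ifs <;> simp

theorem hat_add (τ : ℝ) (β γ : ℂ) : hat τ (β + γ) = hat τ β + hat τ γ := by
  unfold hat; split_ifs <;> simp

theorem hat_inv (τ : ℝ) (β : ℂ) : hat τ β⁻¹ = (hat τ β)⁻¹ := by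
  unfold hat; split_ifs <;> simp

theorem hat_ofReal (τ r : ℝ) : hat τ (r : ℂ) = r := by
  unfold hat; split_ifs <;> simp

theorem hat_hat (τ : ℝ) (β : ℂ) : hat τ (hat τ β) = β := by
  unfold hat; split_ifs <;> simp

theorem hat_ne_zero {τ : ℝ} {β : ℂ} (h : β ≠ 0) : hat τ β ≠ 0 := by
  unfold hat; split_ifs <;> simpa using h

theorem norm_hat (τ : ℝ) (β : ℂ) : ‖hat τ β‖ = ‖β‖ := by
  unfold hat; split_ifs <;> simp

/-- `β ↦ β̂` as a continuous real-linear map. -/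
def hatL (τ : ℝ) : ℂ →L[ℝ] ℂ :=
  if 0 < τ then ContinuousLinearMap.id ℝ ℂ else Complex.conjCLE.toContinuousLinearMap

theorem hatL_apply (τ : ℝ) (β : ℂ) : hatL τ β = hat τ β := by
  unfold hat hatL; split_ifs <;> simp

theorem hat_I (τ : ℝ) (hτ : τ ≠ 0) : hat τ Complex.I = Complex.I * (SignType.sign τ : ℝ) := by
  simp [hat_eq τ hτ]

/-! ### Second-order determining equations. -/

section Determining

variable {φ : OpenPartialHomeomorph Var Var} {N : Set Var} {θ θ' : Equation} {z : Var}

theorem CarriesOn.eventually_line (hN : IsOpen N) (hz : z ∈ N) (k : Var) :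
    ∀ᶠ s : ℝ in 𝓝 0, z + s • k ∈ N := (tendsto_line z k).eventually (hN.mem_nhds hz)

/-- Since `T_t` is continuous and non-zero, the hat is locally one fixed real-linear map, so
relations containing it can be differentiated. -/
theorem CarriesOn.eventually_sign (hφ : IsPointTransformation φ) (hC : CarriesOn φ N θ θ')
    (hz : z ∈ N) : ∀ᶠ y in 𝓝 z, (0 < (fderiv ℝ φ y (1, 0, 0)).1 ↔
      0 < (fderiv ℝ φ z (1, 0, 0)).1) ∧ SignType.sign (fderiv ℝ φ y (1, 0, 0)).1 =
      SignType.sign (fderiv ℝ φ z (1, 0, 0)).1 := by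
  have h0 := hC.fderiv_time_ne_zero hφ hz
  have hc : ContinuousAt (fun y => (fderiv ℝ φ y (1, 0, 0)).1) z :=
    (contDiffAt_dirDeriv (e := (1, 0, 0)) (hC.contDiffAt hφ hz)).fst.continuousAt
  rcases lt_or_gt_of_ne h0 with h | h
  · filter_upwards [hc.eventually_lt_const h] with y hy
    simp [hy.not_gt, h.not_gt, sign_neg hy, sign_neg h]
  · filter_upwards [hc.eventually_const_lt h] with y hy
    simp [hy, h, sign_pos hy, sign_pos h]

theorem CarriesOn.fderiv_fderiv_space_vert (hφ : IsPointTransformation φ)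
    (hC : CarriesOn φ N θ θ') (hN : IsOpen N) (hz : z ∈ N) (k : Var) (w : ℂ) :
    (fderiv ℝ (fderiv ℝ φ) z k (vert w)).2.1 = 0 := by
  refine map_fderiv_fderiv_eq_zero projX (hC.contDiffAt hφ hz) k _ (c := 0) ?_
  filter_upwards [hN.mem_nhds hz] with y hy using hC.fderiv_space_vert hφ hN hy w

theorem CarriesOn.fderiv_fderiv_timeDeriv (hφ : IsPointTransformation φ)
    (hC : CarriesOn φ N θ θ') (hN : IsOpen N) (hz : z ∈ N) {k : Var} (hk : k.1 = 0) :
    (fderiv ℝ (fderiv ℝ φ) z k (1, 0, 0)).1 = 0 := by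
  rw [fderiv_fderiv_symm (hC.contDiffAt hφ hz)]
  exact hC.fderiv_fderiv_time hφ hN hz hk _

/-- In `χ ^ 4 = τ ^ 2` the right-hand side does not vary in directions with `t` fixed, and `χ ≠ 0`;
no constancy of `T_t` in time is needed here. -/
theorem CarriesOn.fderiv_fderiv_space (hφ : IsPointTransformation φ)
    (hC : CarriesOn φ N θ θ') (hN : IsOpen N) (hz : z ∈ N) {k : Var} (hk : k.1 = 0) :
    (fderiv ℝ (fderiv ℝ φ) z k (0, 1, 0)).2.1 = 0 := by
  have h1 := hasDerivAt_map_fderiv_line projX (hC.contDiffAt hφ hz) k (0, 1, 0)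
  have h2 := hasDerivAt_map_fderiv_line projT (hC.contDiffAt hφ hz) k (1, 0, 0)
  have h3 : (fun s : ℝ => (projX (fderiv ℝ φ (z + s • k) (0, 1, 0))) ^ 4) =ᶠ[𝓝 0]
      fun s => (projT (fderiv ℝ φ (z + s • k) (1, 0, 0))) ^ 2 := by
    filter_upwards [CarriesOn.eventually_line hN hz k] with s hs
    have := hC.fderiv_space_sq hφ hN hs
    rw [projX_apply, projT_apply, ← sq_abs (fderiv ℝ φ (z + s • k) (1, 0, 0)).1, ← this]
    ring
  have h4 := (h1.pow 4).unique ((h2.pow 2).congr_of_eventuallyEq h3)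
  rw [projT_apply (fderiv ℝ (fderiv ℝ φ) z k (1, 0, 0)),
    hC.fderiv_fderiv_timeDeriv hφ hN hz hk] at h4
  simpa [projX_apply, hC.fderiv_space_ne_zero hφ hN hz] using h4

/-- With `u_xx = 0` the transformed equation is a real polynomial of degree two in `u_x = a`.
Comparing `a`, `-a` and `0` separates its homogeneous parts, and polarization turns the vanishing
quadratic part into a bilinear statement. -/
theorem CarriesOn.determining_second (hφ : IsPointTransformation φ) (hC : CarriesOn φ N θ θ')
    (hN : IsOpen N) (hz : z ∈ N) :
    (∀ a b, (fderiv ℝ (fderiv ℝ φ) z (vert a) (vert b)).2.2 = 0) ∧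
    (∀ a, 2 * (fderiv ℝ (fderiv ℝ φ) z (0, 1, 0) (vert a)).2.2
        / ((fderiv ℝ φ z (0, 1, 0)).2.1 : ℂ) ^ 2 =
      Complex.I / (fderiv ℝ φ z (1, 0, 0)).1 * ((fderiv ℝ φ z (1, 0, 0)).2.1
        * (fderiv ℝ φ z (vert a)).2.2 / (fderiv ℝ φ z (0, 1, 0)).2.1)) ∧
    Complex.I / (fderiv ℝ φ z (1, 0, 0)).1 * ((fderiv ℝ φ z (1, 0, 0)).2.2
        - (fderiv ℝ φ z (1, 0, 0)).2.1 * ((fderiv ℝ φ z (0, 1, 0)).2.2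
          / (fderiv ℝ φ z (0, 1, 0)).2.1)
        + (fderiv ℝ φ z (vert (Complex.I * (θ.S z * z.2.2)))).2.2)
      + (fderiv ℝ (fderiv ℝ φ) z (0, 1, 0) (0, 1, 0)).2.2
        / ((fderiv ℝ φ z (0, 1, 0)).2.1 : ℂ) ^ 2
      + θ'.S (φ z) * (φ z).2.2 = 0 := by
  set χ := (fderiv ℝ φ z (0, 1, 0)).2.1 with hχdef
  have hχ0 : χ ≠ 0 := hC.fderiv_space_ne_zero hφ hN hz
  have hχc : (χ : ℂ) ≠ 0 := by exact_mod_cast hχ0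
  set τ := (fderiv ℝ φ z (1, 0, 0)).1 with hτdef
  have hτc : (τ : ℂ) ≠ 0 := by exact_mod_cast hC.fderiv_time_ne_zero hφ hz
  have hs := fderiv_fderiv_symm (hC.contDiffAt hφ hz)
  have main : ∀ a, Complex.I / τ * ((fderiv ℝ φ z (1, 0, 0)).2.2
        - (fderiv ℝ φ z (1, 0, 0)).2.1 * (((fderiv ℝ φ z (0, 1, 0)).2.2
          + (fderiv ℝ φ z (vert a)).2.2) / χ)
        + (fderiv ℝ φ z (vert (Complex.I * (θ.S z * z.2.2)))).2.2)
      + ((fderiv ℝ (fderiv ℝ φ) z (0, 1, 0) (0, 1, 0)).2.2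
        + 2 * (fderiv ℝ (fderiv ℝ φ) z (0, 1, 0) (vert a)).2.2
        + (fderiv ℝ (fderiv ℝ φ) z (vert a) (vert a)).2.2) / (χ : ℂ) ^ 2
      + θ'.S (φ z) * (φ z).2.2 = 0 := by
    intro a
    have e1 : ((0, 1, a) : Var) = (0, 1, 0) + vert a := by ext <;> simp [vert_apply]
    have hχa : (fderiv ℝ φ z (0, 1, a)).2.1 = χ := by
      rw [e1, map_add]
      simp [hC.fderiv_space_vert hφ hN hz, hχdef]
    have h1 := hC.determining hφ hN hz a 0 ((fderiv ℝ φ z (0, 1, a)).2.2 / χ) τ χ rfl hχa hχ0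
      (mul_div_cancel₀ _ hχc).symm _ (fun c => rfl)
    have h2 : fderiv ℝ (fderiv ℝ φ) z (0, 1, a) (0, 1, a) =
        fderiv ℝ (fderiv ℝ φ) z (0, 1, 0) (0, 1, 0)
        + (2 : ℝ) • fderiv ℝ (fderiv ℝ φ) z (0, 1, 0) (vert a)
        + fderiv ℝ (fderiv ℝ φ) z (vert a) (vert a) := by
      rw [e1]
      simp only [map_add, _root_.add_apply]
      rw [hs (vert a) (0, 1, 0), two_smul]
      abel
    rw [h2, e1] at h1
    simp [hC.fderiv_space_vert hφ hN hz, hC.fderiv_fderiv_space_vert hφ hN hz,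
      hC.fderiv_fderiv_space hφ hN hz (show ((0, 1, 0) : Var).1 = 0 from rfl)] at h1
    linear_combination h1
  have m0 := main 0
  simp only [map_zero, Prod.snd_zero, add_zero, mul_zero] at m0
  have hq : ∀ a, (fderiv ℝ (fderiv ℝ φ) z (vert a) (vert a)).2.2 = 0 := by
    intro a
    have m1 := main a
    have m2 := main (-a)
    simp only [map_neg, _root_.neg_apply, Prod.snd_neg, neg_neg] at m2
    have h1 : (fderiv ℝ (fderiv ℝ φ) z (vert a) (vert a)).2.2 / (χ : ℂ) ^ 2 = 0 := by
      linear_combination (m1 + m2) / 2 - m0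
    simpa [hχc] using h1
  refine ⟨fun a b => ?_, fun a => ?_, m0⟩
  · have h1 := hq (a + b)
    simp only [map_add, _root_.add_apply, Prod.snd_add, hq] at h1
    rw [hs (vert b) (vert a)] at h1
    linear_combination h1 / 2
  · have m1 := main a
    rw [hq a] at m1
    linear_combination m1 - m0

theorem CarriesOn.fderiv_fderiv_vert_I_mul (hφ : IsPointTransformation φ)
    (hC : CarriesOn φ N θ θ') (hN : IsOpen N) (hz : z ∈ N) (k : Var) (w : ℂ) :
    (fderiv ℝ (fderiv ℝ φ) z k (vert (Complex.I * w))).2.2 = Complex.I *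
      (SignType.sign (fderiv ℝ φ z (1, 0, 0)).1 : ℝ)
        * (fderiv ℝ (fderiv ℝ φ) z k (vert w)).2.2 := by
  have h1 := hasDerivAt_map_fderiv_line projψ (hC.contDiffAt hφ hz) k (vert (Complex.I * w))
  have h2 := (hasDerivAt_map_fderiv_line projψ (hC.contDiffAt hφ hz) k (vert w)).const_mul
    (Complex.I * (SignType.sign (fderiv ℝ φ z (1, 0, 0)).1 : ℝ))
  refine h1.unique (h2.congr_of_eventuallyEq ?_)
  filter_upwards [CarriesOn.eventually_line hN hz k,
    (tendsto_line z k).eventually (hC.eventually_sign hφ hz)] with s hs hs'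
  rw [projψ_apply, projψ_apply, hC.fderiv_vert_I_mul hφ hN hs, hs'.2]

theorem CarriesOn.fderiv_vert (hφ : IsPointTransformation φ)
    (hC : CarriesOn φ N θ θ') (hN : IsOpen N) (hz : z ∈ N) (w : ℂ) :
    (fderiv ℝ φ z (vert w)).2.2 =
      (fderiv ℝ φ z (vert 1)).2.2 * hat (fderiv ℝ φ z (1, 0, 0)).1 w := by
  have h1 : w = w.re • (1 : ℂ) + w.im • (Complex.I * 1) := by
    apply Complex.ext <;> simp
  rw [hat_eq _ (hC.fderiv_time_ne_zero hφ hz)]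
  conv_lhs => rw [h1, map_add, map_smul, map_smul, map_add, map_smul, map_smul]
  simp only [Prod.snd_add, Prod.smul_snd, hC.fderiv_vert_I_mul hφ hN hz, Complex.real_smul]
  ring

theorem CarriesOn.fderiv_vert_one_ne_zero (hφ : IsPointTransformation φ)
    (hC : CarriesOn φ N θ θ') (hN : IsOpen N) (hz : z ∈ N) :
    (fderiv ℝ φ z (vert 1)).2.2 ≠ 0 := by
  intro h
  have h1 : fderiv ℝ φ z (vert 1) = 0 := by
    ext : 1
    · exact hC.fderiv_time hφ hz rfl
    ext : 1
    · exact hC.fderiv_space_vert hφ hN hz 1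
    · exact h
  have h2 := hφ.fderiv_injective (hC.subset_source hz) (h1.trans (map_zero _).symm)
  have h3 := congrArg (fun q : Var => q.2.2) h2
  simp [vert_apply] at h3

end Determining

/-! ### Matching the logarithms; the infinitesimal form. -/

/-- The infinitesimal form of the transformation `φ` at the point `z`. -/
structure HasInfinitesimalForm (φ : Var → Var) (z : Var) : Prop where
  contDiffAt : ContDiffAt ℝ ∞ φ z
  time : ∀ e : Var, e.1 = 0 → (fderiv ℝ φ z e).1 = 0
  timeDeriv_ne_zero : (fderiv ℝ φ z (1, 0, 0)).1 ≠ 0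
  timeDeriv_const : ∀ᶠ y in 𝓝 z, (fderiv ℝ φ y (1, 0, 0)).1 = (fderiv ℝ φ z (1, 0, 0)).1
  space_vert : ∀ w, (fderiv ℝ φ z (vert w)).2.1 = 0
  space_sq : (fderiv ℝ φ z (0, 1, 0)).2.1 ^ 2 = |(fderiv ℝ φ z (1, 0, 0)).1|
  vert_vert : ∀ w, (fderiv ℝ φ z (vert w)).2.2 =
    (φ z).2.2 * (hat (fderiv ℝ φ z (1, 0, 0)).1 w / hat (fderiv ℝ φ z (1, 0, 0)).1 z.2.2)
  vert_space : (fderiv ℝ φ z (0, 1, 0)).2.2 = Complex.I / 2 * ((fderiv ℝ φ z (0, 1, 0)).2.1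
    * (fderiv ℝ φ z (1, 0, 0)).2.1 / (fderiv ℝ φ z (1, 0, 0)).1) * (φ z).2.2

section Determining

variable {φ : OpenPartialHomeomorph Var Var} {N : Set Var} {θ θ' : Equation} {z : Var}

theorem Equation.hasDerivAt_S (θ : Equation) {α : ℝ → Var} {α' : Var}
    (hα : HasDerivAt α α' 0) (h0 : α 0 ∈ θ.domain) (hi : indep α' = 0) :
    HasDerivAt (fun s => θ.S (α s)) (θ.σ * ((α'.2.2 / (α 0).2.2).re : ℂ)) 0 := by
  have h1 := (hasDerivAt_log_norm hα.snd.snd h0.2).ofReal_comp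
  have h2 : HasFDerivAt θ.V (fderiv ℝ θ.V (indep (α 0))) (indep (α 0)) :=
    ((θ.contDiffOn_V.contDiffAt (θ.isOpen_dom.mem_nhds h0.1)).differentiableAt
      (by simp)).hasFDerivAt
  have h3 : HasDerivAt (fun s => indepL (α s)) (indepL α') 0 :=
    indepL.hasFDerivAt.comp_hasDerivAt 0 hα
  have h4 := h2.comp_hasDerivAt (0 : ℝ) (f := fun s => indepL (α s)) h3
  rw [indepL_apply, hi, map_zero] at h4
  have h5 := (h1.const_mul θ.σ).add h4
  rw [add_zero] at h5
  exact h5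

theorem hasDerivAt_apply_line {φ : Var → Var} {z : Var} (hφ : DifferentiableAt ℝ φ z) (k : Var) :
    HasDerivAt (fun s : ℝ => φ (z + s • k)) (fderiv ℝ φ z k) 0 := hasDerivAt_line hφ

/-- The function `H` is the third derivative `ψ̃_xxψ`. Exchanging the order of differentiation lets
it inherit the linearity or antilinearity of `ψ̃_ψ`. -/
theorem CarriesOn.fderiv_third_vert_I_mul (hφ : IsPointTransformation φ)
    (hC : CarriesOn φ N θ θ') (hN : IsOpen N) (hz : z ∈ N) :
    ∃ H : ℂ → ℂ, (∀ w, H (Complex.I * w) = Complex.I *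
        (SignType.sign (fderiv ℝ φ z (1, 0, 0)).1 : ℝ) * H w) ∧
      ∀ w, HasDerivAt (fun s : ℝ => (fderiv ℝ (fderiv ℝ φ) (z + s • vert w) (0, 1, 0)
        (0, 1, 0)).2.2) (H w) 0 := by
  set h : Var → ℂ := fun y => projψ (dirDeriv (0, 1, 0) φ y) with hh
  have hs : ∀ y ∈ N, ContDiffAt ℝ ∞ h y := fun y hy =>
    projψ.contDiff.contDiffAt.comp y (contDiffAt_dirDeriv (hC.contDiffAt hφ hy))
  have hd : ∀ y ∈ N, ∀ k, dirDeriv k h y = (fderiv ℝ (fderiv ℝ φ) y k (0, 1, 0)).2.2 :=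
    fun y hy k => (map_fderiv_fderiv projψ (hC.contDiffAt hφ hy) k (0, 1, 0)).symm
  have hNz := hN.mem_nhds hz
  refine ⟨fun w => dirDeriv (vert w) (dirDeriv (0, 1, 0) h) z, fun w => ?_, fun w => ?_⟩
  · beta_reduce
    have hcomm : ∀ c, dirDeriv (vert c) (dirDeriv (0, 1, 0) h) z =
        dirDeriv (0, 1, 0) (dirDeriv (vert c) h) z := fun c =>
      dirDeriv_comm _ _ ((hs z hz).of_le two_le_infty)
    rw [hcomm, hcomm]
    have h1 : dirDeriv (vert (Complex.I * w)) h =ᶠ[𝓝 z] fun y => (Complex.I *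
        (SignType.sign (fderiv ℝ φ z (1, 0, 0)).1 : ℝ)) * dirDeriv (vert w) h y := by
      filter_upwards [hNz, hC.eventually_sign hφ hz] with y hy hy'
      rw [hd y hy, hd y hy, fderiv_fderiv_symm (hC.contDiffAt hφ hy),
        hC.fderiv_fderiv_vert_I_mul hφ hN hy, hy'.2,
        fderiv_fderiv_symm (hC.contDiffAt hφ hy) (0, 1, 0)]
    have h2 : DifferentiableAt ℝ (dirDeriv (vert w) h) z :=
      (contDiffAt_dirDeriv (hs z hz)).differentiableAt (by simp)
    rw [dirDeriv_congr h1, dirDeriv, (h2.hasFDerivAt.const_mul _).fderiv]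
    rfl
  · have h2 : DifferentiableAt ℝ (dirDeriv (0, 1, 0) h) z :=
      (contDiffAt_dirDeriv (hs z hz)).differentiableAt (by simp)
    refine (hasDerivAt_line h2).congr_of_eventuallyEq ?_
    filter_upwards [CarriesOn.eventually_line hN hz (vert w)] with s hs'
    rw [hd _ hs']

/-- Only `ln|ψ|` and `ln|ψ̃|` have a derivative in `ψ` that is a real part, hence neither linear nor
antilinear. Projecting the differentiated equation onto the other type isolates these two terms. -/
theorem CarriesOn.wirtinger (hφ : IsPointTransformation φ) (hC : CarriesOn φ N θ θ')
    (hN : IsOpen N) (hz : z ∈ N) :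
    (fderiv ℝ φ z (vert 1)).2.2 * hat (fderiv ℝ φ z (1, 0, 0)).1 θ.σ
        * hat (fderiv ℝ φ z (1, 0, 0)).1 z.2.2 * starRingEnd ℂ (φ z).2.2 =
      |(fderiv ℝ φ z (1, 0, 0)).1| * θ'.σ * (φ z).2.2
        * starRingEnd ℂ ((fderiv ℝ φ z (vert 1)).2.2
          * hat (fderiv ℝ φ z (1, 0, 0)).1 z.2.2) := by
  obtain ⟨H₂, hH₂, hH₂'⟩ := hC.fderiv_third_vert_I_mul hφ hN hz
  have hsm := hC.contDiffAt hφ hz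
  have hdom := hC.subset_domain hz
  have hdom' := hC.mapsTo_domain z hz
  set s : ℝ := (SignType.sign (fderiv ℝ φ z (1, 0, 0)).1 : ℝ) with hsdef
  set χ := (fderiv ℝ φ z (0, 1, 0)).2.1 with hχdef
  have hχ0 : χ ≠ 0 := hC.fderiv_space_ne_zero hφ hN hz
  have hχc : (χ : ℂ) ≠ 0 := by exact_mod_cast hχ0
  set τ := (fderiv ℝ φ z (1, 0, 0)).1 with hτdef
  have hτ0 : τ ≠ 0 := hC.fderiv_time_ne_zero hφ hz
  have hτc : (τ : ℂ) ≠ 0 := by exact_mod_cast hτ0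
  set L : ℂ → ℂ := fun w => (fderiv ℝ φ z (vert w)).2.2 with hLdef
  have hL : ∀ w, L w = L 1 * hat τ w := hC.fderiv_vert hφ hN hz
  set H₀ : ℂ → ℂ := fun w => (fderiv ℝ (fderiv ℝ φ) z (1, 0, 0) (vert w)).2.2
  set H₁ : ℂ → ℂ := fun w => (fderiv ℝ (fderiv ℝ φ) z (0, 1, 0) (vert w)).2.2
  have hH₀ : ∀ w, H₀ (Complex.I * w) = Complex.I * s * H₀ w :=
    hC.fderiv_fderiv_vert_I_mul hφ hN hz _
  have hH₁ : ∀ w, H₁ (Complex.I * w) = Complex.I * s * H₁ w :=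
    hC.fderiv_fderiv_vert_I_mul hφ hN hz _
  set ρ := (fderiv ℝ φ z (1, 0, 0)).2.1
  have hsymm := fderiv_fderiv_symm hsm
  -- The derivative, in the direction `w` of `ψ`, of the part of the determining equation free of
  -- `u_x` and `u_xx`.
  have main : ∀ w, Complex.I / τ * (H₀ w - ρ * (H₁ w / χ)
        + L (Complex.I * (θ.σ * ((w / z.2.2).re : ℂ) * z.2.2 + θ.S z * w)))
      + H₂ w / (χ : ℂ) ^ 2
      + (θ'.σ * ((L w / (φ z).2.2).re : ℂ) * (φ z).2.2 + θ'.S (φ z) * L w) = 0 := by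
    intro w
    have hk : (vert w).1 = 0 := rfl
    have dτ := (hasDerivAt_map_fderiv_line projT hsm (vert w) (1, 0, 0)).ofReal_comp
    rw [projT_apply (fderiv ℝ (fderiv ℝ φ) z _ _), hC.fderiv_fderiv_timeDeriv hφ hN hz hk] at dτ
    have dρ := (hasDerivAt_map_fderiv_line projX hsm (vert w) (1, 0, 0)).ofReal_comp
    rw [projX_apply (fderiv ℝ (fderiv ℝ φ) z _ _), hsymm,
      hC.fderiv_fderiv_space_vert hφ hN hz] at dρ
    have dχ := (hasDerivAt_map_fderiv_line projX hsm (vert w) (0, 1, 0)).ofReal_comp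
    rw [projX_apply (fderiv ℝ (fderiv ℝ φ) z _ _), hC.fderiv_fderiv_space hφ hN hz hk] at dχ
    have d0 := hasDerivAt_map_fderiv_line projψ hsm (vert w) (1, 0, 0)
    rw [projψ_apply (fderiv ℝ (fderiv ℝ φ) z _ _), hsymm] at d0
    have d1 := hasDerivAt_map_fderiv_line projψ hsm (vert w) (0, 1, 0)
    rw [projψ_apply (fderiv ℝ (fderiv ℝ φ) z _ _), hsymm] at d1
    have dz := hasDerivAt_add_smul z (vert w) 0
    have dφ := hasDerivAt_apply_line (hsm.differentiableAt (by simp)) (vert w)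
    have dS := θ.hasDerivAt_S dz (by simpa using hdom) (by simp [indep, vert_apply])
    have dS' := θ'.hasDerivAt_S dφ (by simpa using hdom') (by
      simp [indep, hC.fderiv_space_vert hφ hN hz, hC.fderiv_time hφ hz hk])
    have dψ : HasDerivAt (fun r : ℝ => (z + r • vert w).2.2) w 0 := dz.snd.snd
    have dη : HasDerivAt (fun r : ℝ => (φ (z + r • vert w)).2.2) (L w) 0 := dφ.snd.snd
    have dSψ := vert.hasFDerivAt.comp_hasDerivAt (0 : ℝ) ((dS.mul dψ).const_mul Complex.I)
    have dLin : HasDerivAt (fun r : ℝ => fderiv ℝ φ (z + r • vert w))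
        (fderiv ℝ (fderiv ℝ φ) z (vert w)) 0 :=
      hasDerivAt_line ((hsm.fderiv_right (m := ∞) (by simp)).differentiableAt (by simp))
    have dL := projψ.hasFDerivAt.comp_hasDerivAt (0 : ℝ) (dLin.clm_apply dSψ)
    have hτ' : ((projT (fderiv ℝ φ (z + (0 : ℝ) • vert w) (1, 0, 0)) : ℝ) : ℂ) ≠ 0 := by
      simpa [projT_apply] using hτ0
    have hχ' : ((projX (fderiv ℝ φ (z + (0 : ℝ) • vert w) (0, 1, 0)) : ℝ) : ℂ) ≠ 0 := by
      simpa [projX_apply] using hχ0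
    have tot := ((((hasDerivAt_const (0 : ℝ) Complex.I).div dτ hτ').mul
      ((d0.sub (dρ.mul (d1.div dχ hχ'))).add dL)).add
      ((hH₂' w).div (dχ.pow 2) (pow_ne_zero 2 hχ'))).add (dS'.mul dη)
    have hev : ∀ᶠ r : ℝ in 𝓝 0, z + r • vert w ∈ N := CarriesOn.eventually_line hN hz _
    have tot0 := tot.unique ((hasDerivAt_const (0 : ℝ) (0 : ℂ)).congr_of_eventuallyEq (by
      filter_upwards [hev] with r hr using (hC.determining_second hφ hN hr).2.2))
    have hq := (hC.determining_second hφ hN hz).1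
    simp only [zero_smul, add_zero, projT_apply, projX_apply, projψ_apply, vert_apply,
      Complex.ofReal_zero, mul_zero, zero_mul, sub_zero, zero_div, zero_add,
      Function.comp_apply, Prod.snd_add, Pi.mul_apply, Pi.add_apply, Pi.sub_apply,
      Pi.div_apply, Pi.pow_apply] at tot0 hq
    have r1 : ∀ c : ℂ, c * χ / (χ : ℂ) ^ 2 = c / χ := fun c => by field_simp
    have r2 : ∀ c : ℂ, c * (χ : ℂ) ^ 2 / ((χ : ℂ) ^ 2) ^ 2 = c / (χ : ℂ) ^ 2 := fun c => by
      field_simp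
    rw [hq, zero_add, ← hχdef, r1, r2] at tot0
    exact tot0
  have hLI : ∀ w, L (Complex.I * w) = Complex.I * s * L w := hC.fderiv_vert_I_mul hφ hN hz
  have hs2 : (s : ℂ) ^ 2 = 1 := by
    have : s ^ 2 = 1 := by
      rw [hsdef]
      rcases lt_or_gt_of_ne hτ0 with h | h
      · simp [sign_neg h]
      · simp [sign_pos h]
    exact_mod_cast this
  have hLadd : ∀ c d, L (c + d) = L c + L d := by
    intro c d
    simp [hLdef, map_add]
  have hLre : ∀ (r : ℝ) c, L (Complex.I * (θ.σ * r * z.2.2 + c)) =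
      r * L (Complex.I * (θ.σ * z.2.2)) + L (Complex.I * c) := by
    intro r c
    rw [mul_add, hLadd, hL (Complex.I * _), hL (Complex.I * (θ.σ * z.2.2))]
    simp only [hat_mul, hat_ofReal]
    ring
  have m1 := main 1
  have mI := main (Complex.I * 1)
  rw [hLre, hH₀, hH₁, hH₂, hLI 1] at mI
  rw [hLre] at m1
  have e1 : L (Complex.I * (θ.S z * (Complex.I * 1))) =
      Complex.I * s * L (Complex.I * (θ.S z * 1)) := by
    rw [← hLI]; congr 1; ring
  rw [e1] at mI
  have hI2 : (Complex.I * s) ^ 2 = -1 := by rw [mul_pow, hs2, Complex.I_sq]; ring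
  -- Since `(I * s) ^ 2 = -1`, adding `I * s` times the equation for `w = i` to that for `w = 1`
  -- cancels every term `H` with `H (i w) = I * s * H w`.
  have key : Complex.I / τ * L (Complex.I * (θ.σ * z.2.2))
        * (((1 / z.2.2).re : ℂ) + Complex.I * s * ((Complex.I * 1 / z.2.2).re : ℂ))
      + θ'.σ * (φ z).2.2 * (((L 1 / (φ z).2.2).re : ℂ)
        + Complex.I * s * ((Complex.I * s * L 1 / (φ z).2.2).re : ℂ)) = 0 := by
    linear_combination m1 + Complex.I * s * mI - (Complex.I / τ * (H₀ 1 - ρ * (H₁ 1 / χ)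
      + L (Complex.I * (θ.S z * 1))) + H₂ 1 / (χ : ℂ) ^ 2 + θ'.S (φ z) * L 1) * hI2
  have k1 : (((1 / z.2.2).re : ℂ) + Complex.I * s * ((Complex.I * 1 / z.2.2).re : ℂ)) =
      hat τ (starRingEnd ℂ z.2.2)⁻¹ := by
    have : Complex.I * 1 / z.2.2 = Complex.I * z.2.2⁻¹ := by ring
    rw [hat_eq τ hτ0, this, Complex.I_mul_re, one_div, ← map_inv₀, Complex.conj_re,
      Complex.conj_im]
  have k2 : (((L 1 / (φ z).2.2).re : ℂ)
        + Complex.I * s * ((Complex.I * s * L 1 / (φ z).2.2).re : ℂ)) =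
      starRingEnd ℂ (L 1 / (φ z).2.2) := by
    have : Complex.I * s * L 1 / (φ z).2.2 = (s : ℂ) * (Complex.I * (L 1 / (φ z).2.2)) := by ring
    rw [this, Complex.re_ofReal_mul, Complex.I_mul_re]
    push_cast
    have hcj : ∀ m : ℂ, starRingEnd ℂ m = m.re - m.im * Complex.I := fun m => by
      apply Complex.ext <;> simp
    rw [hcj]
    linear_combination (-Complex.I * ((L 1 / (φ z).2.2).im : ℂ)) * hs2
  rw [k1, k2, hL (Complex.I * _), hat_mul, hat_mul, hat_I τ hτ0, hat_inv, map_div₀] at key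
  have hψ : hat τ (starRingEnd ℂ z.2.2) ≠ 0 := hat_ne_zero (by simpa using hdom.2)
  have hη : starRingEnd ℂ (φ z).2.2 ≠ 0 := by simpa using hdom'.2
  have hc : starRingEnd ℂ (hat τ z.2.2) = hat τ (starRingEnd ℂ z.2.2) := by
    unfold hat; split_ifs <;> rfl
  have habs : ((|τ| : ℝ) : ℂ) = s * τ := by
    rw [hsdef, ← Complex.ofReal_mul, sign_mul_self]
  rw [map_mul, hc, habs]
  have hss : (s : ℂ) * s = 1 := by rw [← sq, hs2]
  field_simp at key
  simp only [Complex.I_sq] at key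
  rw [← hsdef] at key
  have hL1 : (fderiv ℝ φ z (vert 1)).2.2 = L 1 := rfl
  rw [hL1]
  linear_combination (-(s : ℂ)) * key
    - L 1 * hat τ θ.σ * hat τ z.2.2 * starRingEnd ℂ (φ z).2.2 * hss

/-- Norms are taken in `wirtinger`, where the remaining factors agree in modulus. The right-hand
side is a constant, which is the source of `T_tt = 0`. -/
theorem CarriesOn.abs_timeDeriv (hφ : IsPointTransformation φ) (hC : CarriesOn φ N θ θ')
    (hN : IsOpen N) (hz : z ∈ N) :
    |(fderiv ℝ φ z (1, 0, 0)).1| = ‖θ.σ‖ / ‖θ'.σ‖ := by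
  have h1 := congrArg norm (hC.wirtinger hφ hN hz)
  simp only [norm_mul, norm_hat, RCLike.norm_conj, Complex.norm_real, Real.norm_eq_abs,
    abs_abs] at h1
  have h2 := norm_ne_zero_iff.2 (hC.fderiv_vert_one_ne_zero hφ hN hz)
  have h3 := norm_ne_zero_iff.2 (hC.subset_domain hz).2
  have h4 := norm_ne_zero_iff.2 (hC.mapsTo_domain z hz).2
  have h5 := norm_ne_zero_iff.2 θ'.σ_ne_zero
  rw [eq_div_iff h5]
  apply mul_right_cancel₀ (mul_ne_zero (mul_ne_zero h2 h3) h4)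
  linear_combination -h1

/-- Along the vertical direction the two sides of `wirtinger` are proportional. -/
theorem CarriesOn.wirtinger_second (hφ : IsPointTransformation φ) (hC : CarriesOn φ N θ θ')
    (hN : IsOpen N) (hz : z ∈ N) :
    hat (fderiv ℝ φ z (1, 0, 0)).1 θ.σ * ((fderiv ℝ φ z (vert 1)).2.2
        * hat (fderiv ℝ φ z (1, 0, 0)).1 z.2.2) =
      |(fderiv ℝ φ z (1, 0, 0)).1| * θ'.σ * (φ z).2.2 := by
  have hsm := hC.contDiffAt hφ hz
  set τ := (fderiv ℝ φ z (1, 0, 0)).1 with hτdef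
  have hτ0 : τ ≠ 0 := hC.fderiv_time_ne_zero hφ hz
  set c₁ := hat τ θ.σ
  set c₂ := |τ| * θ'.σ
  set L : ℂ → ℂ := fun w => (fderiv ℝ φ z (vert w)).2.2 with hLdef
  have hq := (hC.determining_second hφ hN hz).1
  -- The vertical derivative of `wirtinger`: `ψ̃_ψψ = 0` makes `L w` the derivative both of `ψ̃` and
  -- of `L ψ`, and `c₁`, `c₂` are locally constant because `T_t` is.
  have main : ∀ w, c₁ * (L w * starRingEnd ℂ (φ z).2.2 + L z.2.2 * starRingEnd ℂ (L w)) =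
      c₂ * (L w * starRingEnd ℂ (L z.2.2) + (φ z).2.2 * starRingEnd ℂ (L w)) := by
    intro w
    have dz := hasDerivAt_add_smul z (vert w) 0
    have dψ : HasDerivAt (fun r : ℝ => (z + r • vert w).2.2) w 0 := dz.snd.snd
    have dφ := hasDerivAt_apply_line (hsm.differentiableAt (by simp)) (vert w)
    have dη : HasDerivAt (fun r : ℝ => (φ (z + r • vert w)).2.2) (L w) 0 := dφ.snd.snd
    have dLin : HasDerivAt (fun r : ℝ => fderiv ℝ φ (z + r • vert w))
        (fderiv ℝ (fderiv ℝ φ) z (vert w)) 0 :=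
      hasDerivAt_line ((hsm.fderiv_right (m := ∞) (by simp)).differentiableAt (by simp))
    have dL : HasDerivAt (fun r : ℝ => (fderiv ℝ φ (z + r • vert w)
        (vert (z + r • vert w).2.2)).2.2) (L w) 0 := by
      have := projψ.hasFDerivAt.comp_hasDerivAt (0 : ℝ)
        (dLin.clm_apply (vert.hasFDerivAt.comp_hasDerivAt (0 : ℝ) dψ))
      refine this.congr_deriv ?_
      simp [projψ_apply, hq, hLdef]
    have dηc : HasDerivAt (fun r : ℝ => starRingEnd ℂ (φ (z + r • vert w)).2.2)
        (starRingEnd ℂ (L w)) 0 :=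
      Complex.conjCLE.toContinuousLinearMap.hasFDerivAt.comp_hasDerivAt (0 : ℝ) dη
    have dLc : HasDerivAt (fun r : ℝ => starRingEnd ℂ (fderiv ℝ φ (z + r • vert w)
        (vert (z + r • vert w).2.2)).2.2) (starRingEnd ℂ (L w)) 0 :=
      Complex.conjCLE.toContinuousLinearMap.hasFDerivAt.comp_hasDerivAt (0 : ℝ) dL
    have h1 := (dL.mul dηc).const_mul c₁
    have h2 := (dη.mul dLc).const_mul c₂
    have h3 := h1.unique (h2.congr_of_eventuallyEq (by
      filter_upwards [CarriesOn.eventually_line hN hz (vert w),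
        (tendsto_line z (vert w)).eventually (hC.eventually_sign hφ hz)] with r hr hr'
      have e1 := hC.wirtinger hφ hN hr
      have e2 : ∀ β, hat (fderiv ℝ φ (z + r • vert w) (1, 0, 0)).1 β = hat τ β := by
        intro β
        simp only [hat, hr'.1, hτdef]
      have e3 : |(fderiv ℝ φ (z + r • vert w) (1, 0, 0)).1| = |τ| := by
        rw [hC.abs_timeDeriv hφ hN hr, hτdef, hC.abs_timeDeriv hφ hN hz]
      have e4 := hC.fderiv_vert hφ hN hr (z + r • vert w).2.2
      rw [e2, e2, e3] at e1
      rw [e2] at e4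
      simp only [Pi.mul_apply]
      rw [e4]
      linear_combination e1))
    simpa only [zero_smul, add_zero] using h3
  have hL1 : L 1 ≠ 0 := hC.fderiv_vert_one_ne_zero hφ hN hz
  have hs : ((SignType.sign τ : ℝ) : ℂ) ≠ 0 := by
    rcases lt_or_gt_of_ne hτ0 with h | h
    · simp [sign_neg h]
    · simp [sign_pos h]
  have m1 := main 1
  have mI := main (Complex.I * 1)
  have hLI : L (Complex.I * 1) = Complex.I * (SignType.sign τ : ℝ) * L 1 :=
    hC.fderiv_vert_I_mul hφ hN hz 1
  rw [hLI, map_mul, map_mul, Complex.conj_I, Complex.conj_ofReal] at mI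
  -- Here `L w` and its conjugate respond to `w ↦ i w` with opposite signs, so this combination
  -- retains only the conjugate part.
  have k : Complex.I * (SignType.sign τ : ℝ) * starRingEnd ℂ (L 1) * 2
      * (c₁ * L z.2.2 - c₂ * (φ z).2.2) = 0 := by
    linear_combination Complex.I * (SignType.sign τ : ℝ) * m1 - mI
  have hL1c : starRingEnd ℂ (L 1) ≠ 0 := by simpa using hL1
  have k2 : c₁ * L z.2.2 - c₂ * (φ z).2.2 = 0 := by
    simpa [hs, hL1] using k
  have k3 : L z.2.2 = L 1 * hat τ z.2.2 := hC.fderiv_vert hφ hN hz _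
  change c₁ * (L 1 * hat τ z.2.2) = c₂ * _
  linear_combination k2 - c₁ * k3

/-- One more vertical derivative of `wirtinger_second` gives `c₁ = c₂`, that is, `σ̂ = |T_t| σ̃`;
cancelling this constant in `wirtinger_second` leaves the claim. -/
theorem CarriesOn.apply_eq (hφ : IsPointTransformation φ) (hC : CarriesOn φ N θ θ')
    (hN : IsOpen N) (hz : z ∈ N) :
    (φ z).2.2 = (fderiv ℝ φ z (vert z.2.2)).2.2 := by
  have hsm := hC.contDiffAt hφ hz
  set τ := (fderiv ℝ φ z (1, 0, 0)).1 with hτdef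
  set c₁ := hat τ θ.σ
  set c₂ := |τ| * θ'.σ with hc₂
  have hq := (hC.determining_second hφ hN hz).1
  have dz := hasDerivAt_add_smul z (vert 1) 0
  have dψ : HasDerivAt (fun r : ℝ => (z + r • vert 1).2.2) 1 0 := dz.snd.snd
  have dφ := hasDerivAt_apply_line (hsm.differentiableAt (by simp)) (vert 1)
  have dη : HasDerivAt (fun r : ℝ => (φ (z + r • vert 1)).2.2)
    (fderiv ℝ φ z (vert 1)).2.2 0 := dφ.snd.snd
  have dLin : HasDerivAt (fun r : ℝ => fderiv ℝ φ (z + r • vert 1))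
      (fderiv ℝ (fderiv ℝ φ) z (vert 1)) 0 :=
    hasDerivAt_line ((hsm.fderiv_right (m := ∞) (by simp)).differentiableAt (by simp))
  have dL : HasDerivAt (fun r : ℝ => (fderiv ℝ φ (z + r • vert 1)
      (vert (z + r • vert 1).2.2)).2.2) (fderiv ℝ φ z (vert 1)).2.2 0 := by
    have := projψ.hasFDerivAt.comp_hasDerivAt (0 : ℝ)
      (dLin.clm_apply (vert.hasFDerivAt.comp_hasDerivAt (0 : ℝ) dψ))
    refine this.congr_deriv ?_
    simp [projψ_apply, hq]
  have h3 := (dL.const_mul c₁).unique ((dη.const_mul c₂).congr_of_eventuallyEq (by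
    filter_upwards [CarriesOn.eventually_line hN hz (vert 1),
      (tendsto_line z (vert 1)).eventually (hC.eventually_sign hφ hz)] with r hr hr'
    have e1 := hC.wirtinger_second hφ hN hr
    have e2 : ∀ β, hat (fderiv ℝ φ (z + r • vert 1) (1, 0, 0)).1 β = hat τ β := by
      intro β
      simp only [hat, hr'.1, hτdef]
    have e3 : |(fderiv ℝ φ (z + r • vert 1) (1, 0, 0)).1| = |τ| := by
      rw [hC.abs_timeDeriv hφ hN hr, hτdef, hC.abs_timeDeriv hφ hN hz]
    have e4 := hC.fderiv_vert hφ hN hr (z + r • vert 1).2.2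
    rw [e2, e2, e3] at e1
    rw [e2] at e4
    rw [e4, e1]))
  have h4 : c₁ = c₂ := mul_right_cancel₀ (hC.fderiv_vert_one_ne_zero hφ hN hz) h3
  have hc₂0 : c₂ ≠ 0 := by
    rw [hc₂]
    refine mul_ne_zero ?_ θ'.σ_ne_zero
    simpa using hC.fderiv_time_ne_zero hφ hz
  have h5 := hC.wirtinger_second hφ hN hz
  rw [← hC.fderiv_vert hφ hN hz] at h5
  change c₁ * _ = c₂ * _ at h5
  rw [h4] at h5
  exact (mul_left_cancel₀ hc₂0 h5).symm

theorem CarriesOn.hasInfinitesimalForm (hφ : IsPointTransformation φ)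
    (hC : CarriesOn φ N θ θ') (hN : IsOpen N) (hz : z ∈ N) : HasInfinitesimalForm φ z where
  contDiffAt := hC.contDiffAt hφ hz
  time _ he := hC.fderiv_time hφ hz he
  timeDeriv_ne_zero := hC.fderiv_time_ne_zero hφ hz
  timeDeriv_const := by
    filter_upwards [hN.mem_nhds hz, hC.eventually_sign hφ hz] with y hy hy'
    have h1 := hC.abs_timeDeriv hφ hN hy
    rw [← hC.abs_timeDeriv hφ hN hz] at h1
    rw [← sign_mul_abs (fderiv ℝ φ y (1, 0, 0)).1, h1, hy'.2, sign_mul_abs]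
  space_vert := hC.fderiv_space_vert hφ hN hz
  space_sq := hC.fderiv_space_sq hφ hN hz
  vert_vert w := by
    have h0 : hat (fderiv ℝ φ z (1, 0, 0)).1 z.2.2 ≠ 0 := hat_ne_zero (hC.subset_domain hz).2
    rw [hC.fderiv_vert hφ hN hz w, hC.apply_eq hφ hN hz, hC.fderiv_vert hφ hN hz z.2.2]
    field_simp
  -- Differentiating `ψ̃ = ψ̃_ψ(ψ)` in `x` turns `ψ̃_x` into `ψ̃_xψ(ψ)`, which the part of the
  -- determining equation linear in `u_x` expresses through `x̃_t`.
  vert_space := by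
    have hsm := hC.contDiffAt hφ hz
    have dz := hasDerivAt_add_smul z (0, 1, 0) 0
    have dψ : HasDerivAt (fun r : ℝ => (z + r • ((0, 1, 0) : Var)).2.2) 0 0 := dz.snd.snd
    have dφ := hasDerivAt_apply_line (hsm.differentiableAt (by simp)) (0, 1, 0)
    have dη : HasDerivAt (fun r : ℝ => (φ (z + r • ((0, 1, 0) : Var))).2.2)
      (fderiv ℝ φ z (0, 1, 0)).2.2 0 := dφ.snd.snd
    have dLin : HasDerivAt (fun r : ℝ => fderiv ℝ φ (z + r • ((0, 1, 0) : Var)))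
        (fderiv ℝ (fderiv ℝ φ) z (0, 1, 0)) 0 :=
      hasDerivAt_line ((hsm.fderiv_right (m := ∞) (by simp)).differentiableAt (by simp))
    have dL := projψ.hasFDerivAt.comp_hasDerivAt (0 : ℝ)
      (dLin.clm_apply (vert.hasFDerivAt.comp_hasDerivAt (0 : ℝ) dψ))
    have h1 := dη.unique (dL.congr_of_eventuallyEq (by
      filter_upwards [CarriesOn.eventually_line hN hz (0, 1, 0)] with r hr
      exact hC.apply_eq hφ hN hr))
    have h2 := (hC.determining_second hφ hN hz).2.1 z.2.2
    rw [← hC.apply_eq hφ hN hz] at h2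
    have hχc : ((fderiv ℝ φ z (0, 1, 0)).2.1 : ℂ) ≠ 0 := by
      exact_mod_cast hC.fderiv_space_ne_zero hφ hN hz
    have hτc : ((fderiv ℝ φ z (1, 0, 0)).1 : ℂ) ≠ 0 := by
      exact_mod_cast hC.fderiv_time_ne_zero hφ hz
    have h3 : (fderiv ℝ φ z (0, 1, 0)).2.2 =
        (fderiv ℝ (fderiv ℝ φ) z (0, 1, 0) (vert z.2.2)).2.2 := by
      rw [h1]
      simp [projψ_apply]
    rw [h3]
    field_simp at h2 ⊢
    linear_combination h2

end Determining

/-! ### Integration of the infinitesimal form to parameter functions. -/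

theorem IsPreconnected.eq_of_locally_eq {α β : Type*} [TopologicalSpace α] {s : Set α}
    (hs : IsPreconnected s) {f : α → β} (hf : ∀ x ∈ s, ∀ᶠ y in 𝓝[s] x, f y = f x) {x y : α}
    (hx : x ∈ s) (hy : y ∈ s) : f x = f y :=
  hs.induction₂ (fun x y => f x = f y)
    (fun x hx => (hf x hx).mono fun _ h => h.symm)
    (fun _ _ _ _ _ _ h1 h2 => h1.trans h2) (fun _ _ _ _ h => h.symm) hx hy

theorem real_sign_mul_abs (r : ℝ) : Real.sign r * |r| = r := by
  rcases lt_trichotomy r 0 with h | h | h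
  · simp [Real.sign_of_neg h, abs_of_neg h]
  · simp [h]
  · simp [Real.sign_of_pos h, abs_of_pos h]

theorem isOpen_times {W : Set ExtVar} (hW : IsOpen W) : IsOpen (times W) := by
  have h : IsOpenMap (fun q : ExtVar => q.1.1) := isOpenMap_fst.comp isOpenMap_fst
  exact h W hW

theorem IsTimeConnected.isPreconnected_times {W : Set ExtVar} (hW : IsTimeConnected W) :
    IsPreconnected (times W) :=
  hW.isPreconnected.image _ (by fun_prop)

/-- A smooth function whose differential vanishes on the directions `t = const` is a function
of `t` on a time-connected set. -/
theorem IsTimeConnected.exists_function_of_time {F : Type*} [NormedAddCommGroup F]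
    [NormedSpace ℝ F] {W : Set ExtVar} (hW : IsTimeConnected W) {G : Var → F}
    (hG : ∀ q ∈ W, ContDiffAt ℝ ∞ G q.1)
    (hd : ∀ q ∈ W, ∀ e : Var, e.1 = 0 → fderiv ℝ G q.1 e = 0) :
    ∃ g : ℝ → F, ContDiffOn ℝ ∞ g (times W) ∧
      ∀ q ∈ W, G q.1 = g q.1.1 ∧ HasDerivAt g (fderiv ℝ G q.1 (1, 0, 0)) q.1.1 := by
  have hconst : ∀ q ∈ W, ∀ y ∈ W, y.1.1 = q.1.1 → G y.1 = G q.1 := by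
    intro q hq y hy hyq
    refine IsPreconnected.eq_of_locally_eq (f := fun y : ExtVar => G y.1)
      (hW.isPreconnected_section q.1.1) ?_ ⟨hy, hyq⟩ ⟨hq, rfl⟩
    rintro x ⟨hx, hxq⟩
    -- Inside a ball contained in `W`, the segment joining two points of one section stays in that
    -- section, and `G` has zero derivative along it.
    obtain ⟨r, hr, hball⟩ := Metric.isOpen_iff.1 hW.isOpen x hx
    have h1 : ∀ᶠ y in 𝓝[{y ∈ W | y.1.1 = q.1.1}] x, y ∈ Metric.ball x r :=
      mem_nhdsWithin_of_mem_nhds (Metric.ball_mem_nhds x hr)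
    filter_upwards [h1, self_mem_nhdsWithin] with y hyb hyS
    have hk : ((y - x).1).1 = 0 := by
      simp [hxq, hyS.2]
    have hseg : ∀ s ∈ Set.Icc (0 : ℝ) 1, x + s • (y - x) ∈ W := by
      intro s hs
      apply hball
      have := (convex_ball x r).add_smul_sub_mem (Metric.mem_ball_self hr) hyb hs
      simpa using this
    have hder : ∀ s ∈ Set.Icc (0 : ℝ) 1,
        HasDerivAt (fun s : ℝ => G (x.1 + s • (y - x).1)) 0 s := by
      intro s hs
      have h2 := hseg s hs
      have h3 : HasFDerivAt G _ (x.1 + s • (y - x).1) :=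
        ((hG _ h2).differentiableAt (by simp)).hasFDerivAt
      have h4 := h3.comp_hasDerivAt s (hasDerivAt_add_smul x.1 (y - x).1 s)
      refine h4.congr_deriv ?_
      exact hd _ h2 _ hk
    have h5 := constant_of_has_deriv_right_zero (a := 0) (b := 1)
      (f := fun s : ℝ => G (x.1 + s • (y - x).1))
      (fun s hs => (hder s hs).continuousAt.continuousWithinAt)
      (fun s hs => (hder s ⟨hs.1, hs.2.le⟩).hasDerivWithinAt) 1 (by simp)
    simpa using h5
  classical
  set g : ℝ → F := fun t => if h : ∃ q ∈ W, q.1.1 = t then G h.choose.1 else 0 with hg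
  have hgq : ∀ q ∈ W, G q.1 = g q.1.1 := by
    intro q hq
    have h : ∃ q' ∈ W, q'.1.1 = q.1.1 := ⟨q, hq, rfl⟩
    rw [hg]
    beta_reduce
    rw [dif_pos h]
    exact (hconst q hq _ h.choose_spec.1 h.choose_spec.2).symm
  -- Near `q` the chosen function agrees with `G` on the line through `q` in the `t`-direction,
  -- whence its smoothness and derivative.
  have hloc : ∀ q ∈ W, g =ᶠ[𝓝 q.1.1] fun t => G (q.1 + (t - q.1.1) • ((1, 0, 0) : Var)) := by
    intro q hq
    have hc : Filter.Tendsto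
        (fun t : ℝ => ((q.1 + (t - q.1.1) • ((1, 0, 0) : Var), q.2) : ExtVar))
        (𝓝 q.1.1) (𝓝 q) := by
      have : ContinuousAt (fun t : ℝ => ((q.1 + (t - q.1.1) • ((1, 0, 0) : Var), q.2) : ExtVar))
        q.1.1 := by fun_prop
      simpa [ContinuousAt] using this
    filter_upwards [hc.eventually (hW.isOpen.mem_nhds hq)] with t ht
    rw [hgq _ ht]
    simp
  refine ⟨g, ?_, fun q hq => ⟨hgq q hq, ?_⟩⟩
  · rintro _ ⟨q, hq, rfl⟩
    refine ContDiffAt.contDiffWithinAt ?_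
    refine ContDiffAt.congr_of_eventuallyEq ?_ (hloc q hq)
    refine ContDiffAt.comp q.1.1 (g := G)
      (f := fun t => q.1 + (t - q.1.1) • ((1, 0, 0) : Var)) ?_ (by fun_prop)
    simpa using hG q hq
  · refine HasDerivAt.congr_of_eventuallyEq ?_ (hloc q hq)
    have h3 : HasFDerivAt G (fderiv ℝ G q.1) (q.1 + (q.1.1 - q.1.1) • ((1, 0, 0) : Var)) := by
      simpa using ((hG q hq).differentiableAt (by simp)).hasFDerivAt
    refine h3.comp_hasDerivAt q.1.1 ?_
    have := (((hasDerivAt_id q.1.1).sub_const q.1.1).smul_const ((1, 0, 0) : Var)).const_add q.1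
    simpa using this

/-- A smooth non-vanishing function on an interval has a smooth logarithm. -/
theorem exists_smooth_log {J : Set ℝ} (hJo : IsOpen J) (hJ : IsPreconnected J) {f : ℝ → ℂ}
    (hf : ContDiffOn ℝ ∞ f J) (h0 : ∀ t ∈ J, f t ≠ 0) :
    ∃ Θ Ψ : ℝ → ℝ, ContDiffOn ℝ ∞ Θ J ∧ ContDiffOn ℝ ∞ Ψ J ∧
      ∀ t ∈ J, f t = Complex.exp (Θ t + Complex.I * Ψ t) := by
  rcases J.eq_empty_or_nonempty with rfl | ⟨t₀, ht₀⟩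
  · exact ⟨0, 0, by simp, by simp, by simp⟩
  have hord := hJ.ordConnected
  have hd : ContDiffOn ℝ ∞ (deriv f) J := ((contDiffOn_infty_iff_deriv_of_isOpen hJo).1 hf).2
  set l : ℝ → ℂ := fun t => deriv f t / f t with hl
  have hls : ContDiffOn ℝ ∞ l J := by
    simp only [hl, div_eq_mul_inv]
    exact hd.mul (hf.inv h0)
  -- A primitive of `f'/f` that is a logarithm of `f` at `t₀`; then `f * exp (-P)` is constant.
  set P : ℝ → ℂ := fun t => Complex.log (f t₀) + ∫ s in t₀..t, l s with hP
  have hPd : ∀ t ∈ J, HasDerivAt P (l t) t := by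
    intro t ht
    have h1 : ContinuousOn l (Set.uIcc t₀ t) := hls.continuousOn.mono (hord.uIcc_subset ht₀ ht)
    have h2 : ContinuousAt l t := (hls.contDiffAt (hJo.mem_nhds ht)).continuousAt
    exact (intervalIntegral.integral_hasDerivAt_right h1.intervalIntegrable
      (hls.continuousOn.stronglyMeasurableAtFilter hJo t ht) h2).const_add _
  have hPs : ContDiffOn ℝ ∞ P J := by
    refine (contDiffOn_infty_iff_deriv_of_isOpen hJo).2 ⟨fun t ht =>
      (hPd t ht).differentiableAt.differentiableWithinAt, hls.congr fun t ht => (hPd t ht).deriv⟩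
  have hconst : ∀ t ∈ J, f t * Complex.exp (-P t) = f t₀ * Complex.exp (-P t₀) := by
    intro t ht
    refine hJo.is_const_of_deriv_eq_zero (f := fun t => f t * Complex.exp (-P t)) hJ ?_ ?_ ht ht₀
    · exact fun s hs => (((hf.contDiffAt (hJo.mem_nhds hs)).differentiableAt (by simp)).mul
        ((hPd s hs).differentiableAt.neg.cexp)).differentiableWithinAt
    · intro s hs
      have h1 := ((hf.contDiffAt (hJo.mem_nhds hs)).differentiableAt (by simp)).hasDerivAt
      have h2 := (hPd s hs).neg.cexp
      have h3 := (h1.mul h2).deriv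
      have h4 := h0 s hs
      refine h3.trans ?_
      simp only [hl, Pi.zero_apply, Pi.neg_apply]
      field_simp
      ring
  have hP0 : f t₀ = Complex.exp (P t₀) := by
    simp [hP, Complex.exp_log (h0 t₀ ht₀)]
  refine ⟨fun t => (P t).re, fun t => (P t).im, Complex.reCLM.contDiff.comp_contDiffOn hPs,
    Complex.imCLM.contDiff.comp_contDiffOn hPs, fun t ht => ?_⟩
  have h1 := hconst t ht
  rw [hP0, ← Complex.exp_add, add_neg_cancel, Complex.exp_zero, Complex.exp_neg] at h1
  rw [mul_comm Complex.I, Complex.re_add_im]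
  have h2 := Complex.exp_ne_zero (P t)
  field_simp at h1
  exact h1

/-- A transformation with the infinitesimal form at all points of a time-connected set is
given by parameter functions there. -/
theorem IsTimeConnected.exists_params {W : Set ExtVar} (hW : IsTimeConnected W) {φ : Var → Var}
    (h : ∀ q ∈ W, HasInfinitesimalForm φ q.1)
    (h0 : ∀ q ∈ W, q.1.2.2 ≠ 0 ∧ (φ q.1).2.2 ≠ 0) :
    ∃ p : Params, p.RegularOn (times W) ∧ (∀ t ∈ times W, deriv (deriv p.T) t = 0) ∧
      (∀ q ∈ W, deriv p.T q.1.1 = (fderiv ℝ φ q.1 (1, 0, 0)).1) ∧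
      ∀ q ∈ W, φ q.1 =
        (p.T q.1.1, p.newX q.1.1 q.1.2.1, p.newψ q.1.1 q.1.2.1 q.1.2.2) := by
  rcases W.eq_empty_or_nonempty with rfl | ⟨q₀, hq₀⟩
  · exact ⟨⟨1, 0, 0, 0, 0⟩, ⟨by simp, by simp [times], by simp [times], by simp [times],
      by simp [times], by simp [times]⟩, by simp [times], by simp, by simp⟩
  have hWn : ∀ q ∈ W, ∀ᶠ y in 𝓝 q, y ∈ W := fun q hq => hW.isOpen.mem_nhds hq
  set a : ℝ := (fderiv ℝ φ q₀.1 (1, 0, 0)).1 with ha_def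
  have ha : ∀ q ∈ W, (fderiv ℝ φ q.1 (1, 0, 0)).1 = a := by
    intro q hq
    refine IsPreconnected.eq_of_locally_eq
      (f := fun q : ExtVar => (fderiv ℝ φ q.1 (1, 0, 0)).1) hW.isPreconnected ?_ hq hq₀
    intro x hx
    exact mem_nhdsWithin_of_mem_nhds
      ((continuous_fst.tendsto x).eventually (h x hx).timeDeriv_const)
  have ha0 : a ≠ 0 := (h q₀ hq₀).timeDeriv_ne_zero
  set κ : ℝ := (fderiv ℝ φ q₀.1 (0, 1, 0)).2.1 with hκ_def
  have hκsq : κ ^ 2 = |a| := (h q₀ hq₀).space_sq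
  have hκ0 : κ ≠ 0 := by
    intro hk
    exact abs_ne_zero.2 ha0 (by rw [← hκsq, hk]; simp)
  -- The square of this derivative is the constant `|a|`, and continuity excludes a change of sign.
  have hκ : ∀ q ∈ W, (fderiv ℝ φ q.1 (0, 1, 0)).2.1 = κ := by
    intro q hq
    have hs : ∀ x ∈ W, (fderiv ℝ φ x.1 (0, 1, 0)).2.1 ^ 2 = κ ^ 2 := by
      intro x hx
      rw [(h x hx).space_sq, ha x hx, hκsq]
    refine IsPreconnected.eq_of_locally_eq
      (f := fun q : ExtVar => (fderiv ℝ φ q.1 (0, 1, 0)).2.1) hW.isPreconnected ?_ hq hq₀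
    intro x hx
    refine mem_nhdsWithin_of_mem_nhds ?_
    have hc : ContinuousAt (fun q : ExtVar => (fderiv ℝ φ q.1 (0, 1, 0)).2.1) x :=
      ContinuousAt.comp (g := fun z => (fderiv ℝ φ z (0, 1, 0)).2.1) (f := fun q : ExtVar => q.1)
        (contDiffAt_dirDeriv (e := (0, 1, 0)) (h x hx).contDiffAt).snd.fst.continuousAt
        continuousAt_fst
    have hne : (fderiv ℝ φ x.1 (0, 1, 0)).2.1 ≠ -(fderiv ℝ φ x.1 (0, 1, 0)).2.1 := by
      intro hh
      have h1 : (fderiv ℝ φ x.1 (0, 1, 0)).2.1 = 0 := by linarith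
      exact pow_ne_zero 2 hκ0 (by rw [← hs x hx, h1]; simp)
    filter_upwards [hWn x hx, hc.eventually_ne hne] with y hy hy'
    have h3 : (fderiv ℝ φ y.1 (0, 1, 0)).2.1 ^ 2 = (fderiv ℝ φ x.1 (0, 1, 0)).2.1 ^ 2 := by
      rw [hs y hy, hs x hx]
    exact (sq_eq_sq_iff_eq_or_eq_neg.1 h3).resolve_right hy'
  have hdiff : ∀ q ∈ W, HasFDerivAt φ (fderiv ℝ φ q.1) q.1 := fun q hq =>
    ((h q hq).contDiffAt.differentiableAt (by simp)).hasFDerivAt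
  have hJo := isOpen_times hW.isOpen
  -- time
  have hτf : ∀ q ∈ W, ∀ e, fderiv ℝ (fun z => (φ z).1) q.1 e = (fderiv ℝ φ q.1 e).1 := by
    intro q hq e
    rw [(hdiff q hq).fst.fderiv]
    rfl
  obtain ⟨T, hTs, hT⟩ := hW.exists_function_of_time (G := fun z => (φ z).1)
    (fun q hq => (h q hq).contDiffAt.fst)
    (fun q hq e he => by rw [hτf q hq]; exact (h q hq).time e he)
  have hTd : ∀ t ∈ times W, deriv T t = a := by
    rintro _ ⟨q, hq, rfl⟩
    rw [(hT q hq).2.deriv, hτf q hq, ha q hq]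
  -- space
  have hξf : ∀ q ∈ W, ∀ e, fderiv ℝ (fun z : Var => (φ z).2.1 - κ * z.2.1) q.1 e =
      (fderiv ℝ φ q.1 e).2.1 - κ * e.2.1 := by
    intro q hq e
    have h1 : HasFDerivAt (fun z : Var => (φ z).2.1 - κ * z.2.1) _ q.1 :=
      (hdiff q hq).snd.fst.sub (projX.hasFDerivAt.const_mul κ)
    rw [h1.fderiv]
    rfl
  have hdec : ∀ e : Var, e.1 = 0 → e = e.2.1 • ((0, 1, 0) : Var) + vert e.2.2 := by
    intro e he
    ext <;> simp [vert_apply, he]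
  obtain ⟨X, hXs, hX⟩ := hW.exists_function_of_time (G := fun z : Var => (φ z).2.1 - κ * z.2.1)
    (fun q hq => (h q hq).contDiffAt.snd.fst.sub
      (contDiffAt_const.mul projX.contDiff.contDiffAt))
    (fun q hq e he => by
      rw [hξf q hq]
      conv_lhs => rw [hdec e he, map_add, map_smul]
      simp only [Prod.snd_add, Prod.fst_add, Prod.smul_snd, Prod.smul_fst,
        (h q hq).space_vert, hκ q hq, smul_eq_mul, show (vert e.2.2).2.1 = 0 from rfl]
      ring)
  have hXd : ∀ q ∈ W, deriv X q.1.1 = (fderiv ℝ φ q.1 (1, 0, 0)).2.1 := by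
    intro q hq
    rw [(hX q hq).2.deriv, hξf q hq]
    simp
  have hX's : ContDiffOn ℝ ∞ (deriv X) (times W) :=
    ((contDiffOn_infty_iff_deriv_of_isOpen hJo).1 hXs).2
  -- the multiplier of `ψ`
  set c : ℝ → ℂ := fun t => Complex.I / 2 * ((κ * deriv X t / a : ℝ) : ℂ) with hc
  set G : Var → ℂ := fun z => (φ z).2.2 * (hatL a z.2.2)⁻¹ * Complex.exp (-c z.1 * (z.2.1 : ℝ))
    with hG
  have hGs : ∀ q ∈ W, ContDiffAt ℝ ∞ G q.1 := by
    intro q hq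
    have h1 : ContDiffAt ℝ ∞ (deriv X) q.1.1 := hX's.contDiffAt (hJo.mem_nhds ⟨q, hq, rfl⟩)
    have h2 : ContDiffAt ℝ ∞ (fun z : Var => deriv X z.1) q.1 :=
      ContDiffAt.comp (f := fun z : Var => z.1) q.1 h1 contDiffAt_fst
    have h3 : ContDiffAt ℝ ∞ (fun z : Var => ((κ * deriv X z.1 / a : ℝ) : ℂ)) q.1 :=
      Complex.ofRealCLM.contDiff.contDiffAt.comp q.1
        ((contDiffAt_const.mul h2).div_const a)
    have h4 : ContDiffAt ℝ ∞ (fun z : Var => ((z.2.1 : ℝ) : ℂ)) q.1 :=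
      Complex.ofRealCLM.contDiff.contDiffAt.comp q.1 projX.contDiff.contDiffAt
    refine ((h q hq).contDiffAt.snd.snd.mul
      (((hatL a).contDiff.contDiffAt.comp q.1 projψ.contDiff.contDiffAt).inv ?_)).mul
      (((contDiffAt_const.mul h3).neg.mul h4).cexp)
    change hatL a q.1.2.2 ≠ 0
    rw [hatL_apply]
    exact hat_ne_zero (h0 q hq).1
  -- The logarithmic derivative of `ψ̃` in directions with `t` fixed is that of `ψ̂ exp(c x)`, so
  -- the quotient `G` depends only on `t`.
  obtain ⟨E, hEs, hE⟩ := hW.exists_function_of_time (G := G) hGs (fun q hq e he => by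
    refine dirDeriv_eq_of_hasDerivAt ((hGs q hq).differentiableAt (by simp)) ?_
    have dz := hasDerivAt_add_smul q.1 e 0
    have dψ : HasDerivAt (fun r : ℝ => (q.1 + r • e).2.2) e.2.2 0 := dz.snd.snd
    have dx : HasDerivAt (fun r : ℝ => (q.1 + r • e).2.1) e.2.1 0 := dz.snd.fst
    have dφ := hasDerivAt_apply_line ((h q hq).contDiffAt.differentiableAt (by simp)) e
    have dη : HasDerivAt (fun r : ℝ => (φ (q.1 + r • e)).2.2) (fderiv ℝ φ q.1 e).2.2 0 :=
      dφ.snd.snd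
    have dh : HasDerivAt (fun r : ℝ => hatL a (q.1 + r • e).2.2) (hatL a e.2.2) 0 :=
      (hatL a).hasFDerivAt.comp_hasDerivAt (0 : ℝ) dψ
    have hh0 : hat a q.1.2.2 ≠ 0 := hat_ne_zero (h0 q hq).1
    have dexp := (dx.ofReal_comp.const_mul (-c q.1.1)).cexp
    have tot := (dη.div dh (by simpa [hatL_apply] using hh0)).mul dexp
    have hfun : (fun s : ℝ => G (q.1 + s • e)) = ((fun r : ℝ => (φ (q.1 + r • e)).2.2) /
        fun r : ℝ => hatL a (q.1 + r • e).2.2) *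
        fun r : ℝ => Complex.exp (-c q.1.1 * (((q.1 + r • e).2.1 : ℝ) : ℂ)) := by
      funext s
      simp [hG, he, div_eq_mul_inv]
    rw [hfun]
    refine tot.congr_deriv ?_
    have e1 : (fderiv ℝ φ q.1 e).2.2 = e.2.1 * (c q.1.1 * (φ q.1).2.2)
        + (φ q.1).2.2 * (hat a e.2.2 / hat a q.1.2.2) := by
      conv_lhs => rw [hdec e he, map_add, map_smul]
      simp only [Prod.snd_add, Prod.smul_snd, (h q hq).vert_vert, (h q hq).vert_space,
        ha q hq, hκ q hq, ← hXd q hq, Complex.real_smul, hc]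
      push_cast
      ring
    rw [e1]
    simp only [zero_smul, add_zero, Pi.div_apply, hatL_apply]
    field_simp
    ring)
  have hηE : ∀ q ∈ W, (φ q.1).2.2 =
      hat a q.1.2.2 * Complex.exp (c q.1.1 * (q.1.2.1 : ℝ)) * E q.1.1 := by
    intro q hq
    rw [← (hE q hq).1, hG]
    simp only [hatL_apply, neg_mul, Complex.exp_neg]
    have h1 : hat a q.1.2.2 ≠ 0 := hat_ne_zero (h0 q hq).1
    have h2 := Complex.exp_ne_zero (c q.1.1 * (q.1.2.1 : ℝ))
    field_simp
  obtain ⟨Θ, Ψ, hΘ, hΨ, hlog⟩ := exists_smooth_log hJo hW.isPreconnected_times hEs (by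
    rintro _ ⟨q, hq, rfl⟩ hh
    have := hηE q hq
    rw [hh, mul_zero] at this
    exact (h0 q hq).2 this)
  have hsqrt : √|a| = |κ| := by rw [← hκsq, Real.sqrt_sq_eq_abs]
  have hεκ : Real.sign κ * |κ| = κ := real_sign_mul_abs κ
  have hε : Real.sign κ = 1 ∨ Real.sign κ = -1 := by
    rcases lt_or_gt_of_ne hκ0 with hk | hk
    · right; exact Real.sign_of_neg hk
    · left; exact Real.sign_of_pos hk
  refine ⟨⟨Real.sign κ, T, X, Θ, Ψ⟩, ⟨hε, hTs, hXs, hΘ, hΨ, ?_⟩, ?_, ?_, ?_⟩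
  · intro t ht
    simpa [hTd t ht] using ha0
  · intro t ht
    have h1 : deriv T =ᶠ[𝓝 t] fun _ => a := by
      filter_upwards [hJo.mem_nhds ht] with s hs using hTd s hs
    change deriv (deriv T) t = 0
    rw [h1.deriv_eq, deriv_const]
  · intro q hq
    rw [ha q hq]
    exact hTd _ ⟨q, hq, rfl⟩
  · intro q hq
    have ht : q.1.1 ∈ times W := ⟨q, hq, rfl⟩
    have hT2 : deriv (deriv T) q.1.1 = 0 := by
      have h1 : deriv T =ᶠ[𝓝 q.1.1] fun _ => a := by
        filter_upwards [hJo.mem_nhds ht] with s hs using hTd s hs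
      rw [h1.deriv_eq, deriv_const]
    ext : 1
    · exact (hT q hq).1
    ext : 1
    · change _ = Real.sign κ * q.1.2.1 * √|deriv T q.1.1| + X q.1.1
      rw [hTd _ ht, hsqrt, ← (hX q hq).1]
      linear_combination (-q.1.2.1) * hεκ
    · rw [hηE q hq, hlog _ ht, mul_assoc, ← Complex.exp_add]
      simp only [Params.newψ, Params.ε', hTd _ ht, hT2, hsqrt]
      congr 2
      -- With `ε = sign κ` and `κ² = |a|` one has `ε ε'/|κ| = κ/a`.
      have h3 : Real.sign κ * Real.sign a * deriv X q.1.1 / |κ| * q.1.2.1 =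
          κ * deriv X q.1.1 / a * q.1.2.1 := by
        have h4 : |κ| ≠ 0 := abs_ne_zero.2 hκ0
        have h5 : a = Real.sign a * |κ| ^ 2 := by
          rw [sq_abs, hκsq, real_sign_mul_abs]
        have h6 : Real.sign a * Real.sign a = 1 := by
          rcases lt_or_gt_of_ne ha0 with hk | hk
          · simp [Real.sign_of_neg hk]
          · simp [Real.sign_of_pos hk]
        have h7 : Real.sign κ * Real.sign a / |κ| = κ / a := by
          rw [div_eq_div_iff h4 ha0]
          linear_combination Real.sign κ * Real.sign a * h5 + Real.sign κ * |κ| ^ 2 * h6 + |κ| * hεκ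
        linear_combination deriv X q.1.1 * q.1.2.1 * h7
      rw [h3, hc]
      push_cast
      simp
      ring

/-! ### Action of the parametrized transformations on equations. -/

namespace Params

variable {p : Params} {t a : ℝ}

theorem newX_eq (ht : deriv p.T t = a) (x : ℝ) :
    p.newX t x = p.ε * √|a| * x + p.X t := by
  rw [newX, ht]
  ring

/-- The coefficient of `x` in the exponent of the multiplier of `ψ`. -/
def slope (p : Params) (a t : ℝ) : ℂ :=
  Complex.I / 2 * ((p.ε * Real.sign a * deriv p.X t / √|a| : ℝ) : ℂ)

theorem newψ_eq (ht : deriv p.T t = a) (ht2 : deriv (deriv p.T) t = 0) (x : ℝ) (ψ : ℂ) :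
    p.newψ t x ψ =
      Complex.exp (p.slope a t * x + p.Θ t + Complex.I * p.Ψ t) * hat a ψ := by
  rw [newψ, ht, ht2, ε', ht, slope, mul_comm]
  congr 2
  push_cast
  ring

theorem deriv_deriv_eq_zero (hT : ∀ᶠ s in 𝓝 t, deriv p.T s = a) : deriv (deriv p.T) t = 0 := by
  have h : deriv p.T =ᶠ[𝓝 t] fun _ => a := hT
  rw [h.deriv_eq, deriv_const]

theorem newS_eq (hT : ∀ᶠ s in 𝓝 t, deriv p.T s = a) (x : ℝ) (s : ℂ) :
    p.newS t x s = hat a s / (|a| : ℝ)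
      + ((p.ε * Real.sign a / (2 * √|a|) * (deriv (deriv p.X) t / a) * x : ℝ) : ℂ)
      + ((deriv p.Ψ t : ℝ) - Complex.I * (deriv p.Θ t : ℝ)) / (a : ℂ)
      - ((deriv p.X t : ℝ) : ℂ) ^ 2 / (4 * (a : ℂ) ^ 2) := by
  have h1 : deriv (deriv p.T) t = 0 := deriv_deriv_eq_zero hT
  have h2 : deriv (deriv (deriv p.T)) t = 0 := by
    have h : deriv (deriv p.T) =ᶠ[𝓝 t] fun _ => 0 :=
      hT.eventually_nhds.mono fun s hs => deriv_deriv_eq_zero hs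
    rw [h.deriv_eq, deriv_const]
  have h3 : deriv (fun r => deriv p.X r / deriv p.T r) t = deriv (deriv p.X) t / a := by
    have h : (fun r => deriv p.X r / deriv p.T r) =ᶠ[𝓝 t] fun r => deriv p.X r / a := by
      filter_upwards [hT] with r hr
      rw [hr]
    rw [h.deriv_eq, deriv_div_const]
  rw [newS, h1, h2, h3, ε', hT.self_of_nhds]
  simp

/-- Only the first term of `newS` depends on `s`, so knowing the image of one value of `S`
determines the images of all. -/
theorem newS_sub (x : ℝ) (s s' : ℂ) :
    p.newS t x s - p.newS t x s' =
      (hat (deriv p.T t) s - hat (deriv p.T t) s') / (|deriv p.T t| : ℝ) := by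
  simp only [newS]
  ring

/-- The effect of a transformation of the given form on the left-hand side of an equation. -/
theorem transform_identity {φ : Var → Var} {u v : ℝ × ℝ → ℂ} {x : ℝ}
    (hφ : ∀ᶠ z : Var in 𝓝 (t, x, u (t, x)),
      φ z = (p.T z.1, p.newX z.1 z.2.1, p.newψ z.1 z.2.1 z.2.2))
    (hε : p.ε = 1 ∨ p.ε = -1) (ha : a ≠ 0) (hT : ∀ᶠ s in 𝓝 t, deriv p.T s = a)
    (hX : ContDiffAt ℝ ∞ p.X t) (hΘ : ContDiffAt ℝ ∞ p.Θ t) (hΨ : ContDiffAt ℝ ∞ p.Ψ t)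
    (hu : ContDiffAt ℝ ∞ u (t, x)) (hv : ContDiffAt ℝ ∞ v (indep (φ (t, x, u (t, x)))))
    (hm : MapsGraph φ u v (t, x)) (s : ℂ) :
    ∃ C : ℂ, C ≠ 0 ∧
      Complex.I * fderiv ℝ v (indep (φ (t, x, u (t, x)))) (1, 0)
        + fderiv ℝ (fderiv ℝ v) (indep (φ (t, x, u (t, x)))) (0, 1) (0, 1)
        + p.newS t x s * (φ (t, x, u (t, x))).2.2 =
      C * hat a (Complex.I * fderiv ℝ u (t, x) (1, 0)
        + fderiv ℝ (fderiv ℝ u) (t, x) (0, 1) (0, 1) + s * u (t, x)) := by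
  set κ : ℝ := p.ε * √|a| with hκ
  have hφ0 := hφ.self_of_nhds
  have hTt := hT.self_of_nhds
  have hp : indep (φ (t, x, u (t, x))) = (p.T t, κ * x + p.X t) := by
    rw [hφ0]
    simp only [indep, newX_eq hTt, hκ]
  rw [hp] at hv ⊢
  have hv2 := hv.of_le two_le_infty
  have hu2 := hu.of_le two_le_infty
  set M : ℝ → ℝ → ℂ := fun r y =>
    Complex.exp (p.slope a r * y + p.Θ r + Complex.I * p.Ψ r) with hM
  have hcont : Filter.Tendsto (fun q : ℝ × ℝ => ((q.1, q.2, u q) : Var)) (𝓝 (t, x))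
      (𝓝 (t, x, u (t, x))) :=
    (continuousAt_fst.prodMk (continuousAt_snd.prodMk hu.continuousAt)).tendsto
  have hev : ∀ᶠ q : ℝ × ℝ in 𝓝 (t, x),
      v (p.T q.1, κ * q.2 + p.X q.1) = M q.1 q.2 * hatL a (u q) := by
    filter_upwards [hm, hcont.eventually hφ, continuousAt_fst.eventually hT.eventually_nhds]
      with q h1 h2 h3
    rw [h2] at h1
    have h3' : deriv p.T q.1 = a := h3.self_of_nhds
    simp only [indep, newX_eq h3', newψ_eq h3' (deriv_deriv_eq_zero h3)] at h1
    rw [hatL_apply]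
    exact h1
  have hTd : HasDerivAt p.T a t := by
    rw [← hTt]
    exact (differentiableAt_of_deriv_ne_zero (by rwa [hTt])).hasDerivAt
  have hXd : HasDerivAt p.X (deriv p.X t) t := (hX.differentiableAt (by simp)).hasDerivAt
  have hX2 : HasDerivAt (deriv p.X) (deriv (deriv p.X) t) t := by
    have h1 : ContDiffAt ℝ ∞ (fun r => fderiv ℝ p.X r 1) t :=
      (hX.fderiv_right (m := ∞) (by simp)).clm_apply contDiffAt_const
    exact (h1.differentiableAt (by simp)).hasDerivAt
  have hΘd : HasDerivAt p.Θ (deriv p.Θ t) t := (hΘ.differentiableAt (by simp)).hasDerivAt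
  have hΨd : HasDerivAt p.Ψ (deriv p.Ψ t) t := (hΨ.differentiableAt (by simp)).hasDerivAt
  set g := M t x * hat a (u (t, x)) with hg
  have hψ : (φ (t, x, u (t, x))).2.2 = g := by
    rw [hφ0]
    simp only [newψ_eq hTt (deriv_deriv_eq_zero hT), hg, hM]
  set c := p.slope a t with hc
  set ux := hat a (fderiv ℝ u (t, x) (0, 1))
  set ut := hat a (fderiv ℝ u (t, x) (1, 0))
  set uxx := hat a (fderiv ℝ (fderiv ℝ u) (t, x) (0, 1) (0, 1))
  set Dv := fderiv ℝ v (p.T t, κ * x + p.X t)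
  -- derivatives along `x`
  have hα : ∀ y, HasDerivAt (fun y : ℝ => ((p.T t, κ * y + p.X t) : ℝ × ℝ)) (0, κ) y := by
    intro y
    have := ((hasDerivAt_id y).const_mul κ).add_const (p.X t)
    simpa using (hasDerivAt_const y (p.T t)).prodMk this
  obtain ⟨v1, v2⟩ := hasDerivAt_comp_curve (f := v)
    (α := fun y : ℝ => ((p.T t, κ * y + p.X t) : ℝ × ℝ)) (α' := fun _ => (0, κ)) (s := x)
    hv2 (.of_forall hα) (hasDerivAt_const _ _)
  obtain ⟨u1, u2⟩ := hasDerivAt_comp_curve (f := u)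
    (α := fun y : ℝ => ((t, y) : ℝ × ℝ)) (α' := fun _ => (0, 1)) (s := x)
    hu2 (.of_forall fun y => (hasDerivAt_const y t).prodMk (hasDerivAt_id y))
    (hasDerivAt_const _ _)
  have hMx : ∀ y, HasDerivAt (fun y => M t y) (c * M t y) y := by
    intro y
    have h1 : HasDerivAt (fun y : ℝ => ((y : ℝ) : ℂ)) 1 y := Complex.ofRealCLM.hasDerivAt
    have h2 := (((h1.const_mul c).add_const (p.Θ t : ℂ)).add_const
      (Complex.I * p.Ψ t)).cexp
    refine h2.congr_deriv ?_
    simp only [hM, hc]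
    ring
  have g1 : ∀ᶠ y in 𝓝 x, HasDerivAt (fun y => M t y * hatL a (u (t, y)))
      (c * (M t y * hatL a (u (t, y))) + M t y * hatL a (fderiv ℝ u (t, y) (0, 1))) y := by
    filter_upwards [u1] with y hy
    have := (hMx y).mul ((hatL a).hasFDerivAt.comp_hasDerivAt y hy)
    refine this.congr_deriv ?_
    simp only [Function.comp_apply]
    ring
  have g2 := (g1.self_of_nhds.const_mul c).add
    ((hMx x).mul ((hatL a).hasFDerivAt.comp_hasDerivAt x u2))
  have hxline : ∀ᶠ y in 𝓝 x, v (p.T t, κ * y + p.X t) = M t y * hatL a (u (t, y)) := by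
    have h1 : Filter.Tendsto (fun y : ℝ => ((t, y) : ℝ × ℝ)) (𝓝 x) (𝓝 (t, x)) :=
      (continuousAt_const.prodMk continuousAt_id).tendsto
    exact h1.eventually hev
  have d1 : ∀ᶠ y in 𝓝 x, fderiv ℝ v (p.T t, κ * y + p.X t) (0, κ) =
      c * (M t y * hatL a (u (t, y))) + M t y * hatL a (fderiv ℝ u (t, y) (0, 1)) := by
    filter_upwards [v1, g1, hxline.eventually_nhds] with y h1 h2 h3
    exact h1.unique (h2.congr_of_eventuallyEq h3)
  have d2 := v2.unique (g2.congr_of_eventuallyEq d1)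
  have d1 := d1.self_of_nhds
  have hκv : ((0, κ) : ℝ × ℝ) = κ • (0, 1) := by simp
  simp only [hκv, map_smul, _root_.smul_apply, Function.comp_apply, hatL_apply, map_zero,
    add_zero, Complex.real_smul] at d1 d2
  -- derivative along `t`
  have hβ : HasDerivAt (fun r : ℝ => ((p.T r, κ * x + p.X r) : ℝ × ℝ)) (a, deriv p.X t) t :=
    hTd.prodMk (hXd.const_add (κ * x))
  have v3 := HasFDerivAt.comp_hasDerivAt (f := fun r : ℝ => ((p.T r, κ * x + p.X r) : ℝ × ℝ)) t
    (hv.differentiableAt (by simp)).hasFDerivAt hβ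
  have u3 := HasFDerivAt.comp_hasDerivAt (f := fun r : ℝ => ((r, x) : ℝ × ℝ)) t
    (hu.differentiableAt (by simp)).hasFDerivAt
    ((hasDerivAt_id t).prodMk (hasDerivAt_const t x))
  set c' : ℂ := Complex.I / 2 * ((p.ε * Real.sign a * deriv (deriv p.X) t / √|a| : ℝ) : ℂ)
    with hc'
  have hMt : HasDerivAt (fun r => M r x)
      ((c' * x + deriv p.Θ t + Complex.I * deriv p.Ψ t) * M t x) t := by
    have h1 := (((hX2.const_mul (p.ε * Real.sign a)).div_const √|a|).ofReal_comp).const_mul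
      (Complex.I / 2)
    have h2 := (((h1.mul_const (x : ℂ)).add hΘd.ofReal_comp).add
      (hΨd.ofReal_comp.const_mul Complex.I)).cexp
    refine h2.congr_deriv ?_
    simp only [hM, hc', slope, Pi.add_apply]
    ring
  have g3 := hMt.mul ((hatL a).hasFDerivAt.comp_hasDerivAt t u3)
  have htline : ∀ᶠ r in 𝓝 t, v (p.T r, κ * x + p.X r) = M r x * hatL a (u (r, x)) := by
    have h1 : Filter.Tendsto (fun r : ℝ => ((r, x) : ℝ × ℝ)) (𝓝 t) (𝓝 (t, x)) :=
      (continuousAt_id.prodMk continuousAt_const).tendsto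
    exact h1.eventually hev
  have d3 := v3.unique (g3.congr_of_eventuallyEq htline)
  have hav : ((a, deriv p.X t) : ℝ × ℝ) = a • (1, 0) + deriv p.X t • (0, 1) := by simp
  simp only [hav, map_add, map_smul, Function.comp_apply, hatL_apply, Complex.real_smul] at d3
  -- algebra
  have hκ2 : κ ^ 2 = |a| := by
    rw [hκ, mul_pow, Real.sq_sqrt (abs_nonneg a)]
    rcases hε with h | h <;> simp [h]
  have hsa : Real.sign a * |a| = a := real_sign_mul_abs a
  have hs2 : Real.sign a * Real.sign a = 1 := by
    rcases lt_or_gt_of_ne ha with hk | hk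
    · simp [Real.sign_of_neg hk]
    · simp [Real.sign_of_pos hk]
  set σ := Real.sign a with hσ
  have hκ0 : κ ≠ 0 := by
    intro h
    rw [h] at hκ2
    exact abs_ne_zero.2 ha (by rw [← hκ2]; simp)
  have hsq0 : √|a| ≠ 0 := by
    intro h
    exact hκ0 (by rw [hκ, h, mul_zero])
  -- This uses `ε² = 1`; from here on only `κ` is needed in place of `ε` and `√|a|`.
  have hεκ : p.ε / √|a| = 1 / κ := by
    rw [hκ, div_eq_div_iff hsq0 (by rwa [← hκ])]
    rcases hε with h | h <;> simp [h]
  have hcv : c = Complex.I / 2 * ((σ * deriv p.X t / κ : ℝ) : ℂ) := by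
    rw [hc, slope]
    congr 2
    calc p.ε * σ * deriv p.X t / √|a| = σ * deriv p.X t * (p.ε / √|a|) := by ring
      _ = _ := by rw [hεκ]; ring
  have hcv' : c' = Complex.I / 2 * ((σ * deriv (deriv p.X) t / κ : ℝ) : ℂ) := by
    rw [hc']
    congr 2
    calc p.ε * σ * deriv (deriv p.X) t / √|a| =
        σ * deriv (deriv p.X) t * (p.ε / √|a|) := by ring
      _ = _ := by rw [hεκ]; ring
  have hSX : p.ε * σ / (2 * √|a|) * (deriv (deriv p.X) t / a) * x =
      σ * deriv (deriv p.X) t * x / (2 * κ * a) := by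
    calc _ = σ * deriv (deriv p.X) t * x / (2 * a) * (p.ε / √|a|) := by field_simp
      _ = _ := by rw [hεκ]; field_simp
  have hκc : (κ : ℂ) ≠ 0 := by exact_mod_cast hκ0
  have hac : (a : ℂ) ≠ 0 := by exact_mod_cast ha
  have hσc : (σ : ℂ) * σ = 1 := by exact_mod_cast hs2
  have hκ2c : (κ : ℂ) ^ 2 = σ * a := by
    have : κ ^ 2 = σ * a := by linear_combination hκ2 + σ * hsa - |a| * hs2
    exact_mod_cast this
  have habs : ((|a| : ℝ) : ℂ) = σ * a := by rw [← hκ2]; exact_mod_cast hκ2c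
  have hσ0 : (σ : ℂ) ≠ 0 := by
    intro h
    rw [h] at hσc
    simp at hσc
  have hI : hat a Complex.I = Complex.I * σ := by
    have : (SignType.sign a : ℝ) = σ := by
      rcases lt_or_gt_of_ne ha with hk | hk
      · simp [hσ, Real.sign_of_neg hk, sign_neg hk]
      · simp [hσ, Real.sign_of_pos hk, sign_pos hk]
    rw [hat_I a ha, this]
  refine ⟨M t x / (|a| : ℝ), ?_, ?_⟩
  · rw [habs]
    exact div_ne_zero (Complex.exp_ne_zero _) (mul_ne_zero hσ0 hac)
  · rw [hψ, newS_eq hT, hat_add, hat_add, hat_mul, hat_mul, hI, habs, hSX]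
    change Complex.I * Dv (1, 0) + _ + _ = _ / _ * (Complex.I * σ * ut + uxx + hat a s * _)
    have e1 : Dv (0, 1) = (c * g + M t x * ux) / κ := by
      rw [eq_div_iff hκc]
      linear_combination d1
    have e2 : fderiv ℝ (fderiv ℝ v) (p.T t, κ * x + p.X t) (0, 1) (0, 1) =
        (c * (c * g + M t x * ux) + (c * M t x * ux + M t x * uxx)) / (κ : ℂ) ^ 2 := by
      rw [eq_div_iff (pow_ne_zero 2 hκc)]
      linear_combination d2
    have e3 : Dv (1, 0) = ((c' * x + deriv p.Θ t + Complex.I * deriv p.Ψ t) * g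
        + M t x * ut - deriv p.X t * Dv (0, 1)) / a := by
      rw [eq_div_iff hac]
      linear_combination d3
    rw [e2, e3, e1, hcv, hcv', hκ2c]
    push_cast
    have hκi : (κ : ℂ)⁻¹ * (κ : ℂ)⁻¹ = (σ : ℂ) * (a : ℂ)⁻¹ := by
      have h1 : (κ : ℂ)⁻¹ * (κ : ℂ)⁻¹ = ((κ : ℂ) ^ 2)⁻¹ := by rw [sq, mul_inv]
      have h2 : (σ : ℂ)⁻¹ = σ := by
        rw [inv_eq_iff_eq_inv]
        exact eq_inv_of_mul_eq_one_left hσc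
      rw [h1, hκ2c, mul_inv, h2]
    have h2 : (σ : ℂ)⁻¹ = σ := by
      rw [inv_eq_iff_eq_inv]
      exact eq_inv_of_mul_eq_one_left hσc
    simp only [div_eq_mul_inv, mul_inv, h2, hg]
    set X₁ : ℂ := ((deriv p.X t : ℝ) : ℂ)
    set X₂ : ℂ := ((deriv (deriv p.X) t : ℝ) : ℂ)
    set G : ℂ := M t x * hat a (u (t, x))
    -- With inverses as monomials, the identity follows from `I² = -1`, `σ² = 1` and `κ⁻² = σ a⁻¹`,
    -- where `σ` denotes the sign of `a`.
    linear_combination (2⁻¹ * σ * X₂ * (κ : ℂ)⁻¹ * x * (a : ℂ)⁻¹ * G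
        + (deriv p.Ψ t : ℝ) * G * (a : ℂ)⁻¹ - 4⁻¹ * X₁ ^ 2 * (a : ℂ)⁻¹ ^ 2 * G) * Complex.I_sq
      + (-Complex.I * M t x * ut * (a : ℂ)⁻¹ + Complex.I * X₁ * M t x * ux * (κ : ℂ)⁻¹ * (a : ℂ)⁻¹
        + X₁ ^ 2 * (a : ℂ)⁻¹ ^ 2 * G * (-Complex.I ^ 2 / 2 + Complex.I ^ 2 / 4 * (σ ^ 2 + 1))) * hσc
      + (-Complex.I ^ 2 * σ / 2 + Complex.I ^ 2 * σ ^ 3 / 4) * X₁ ^ 2 * (a : ℂ)⁻¹ * G * hκi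

end Params

namespace Params

variable {p : Params} {t a : ℝ}

theorem RegularOn.eventually_deriv_T {I : Set ℝ} (h : p.RegularOn I) (hI : IsOpen I)
    (h2 : ∀ s ∈ I, deriv (deriv p.T) s = 0) (ht : t ∈ I) :
    ∀ᶠ s in 𝓝 t, deriv p.T s = deriv p.T t := by
  obtain ⟨r, hr, hball⟩ := Metric.isOpen_iff.1 hI t ht
  have hd := ((contDiffOn_infty_iff_deriv_of_isOpen hI).1 h.contDiffOn_T).2
  filter_upwards [Metric.ball_mem_nhds t hr] with s hs
  exact Metric.isOpen_ball.is_const_of_deriv_eq_zero (convex_ball t r).isPreconnected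
    ((hd.differentiableOn (by simp)).mono hball) (fun y hy => h2 y (hball hy)) hs
    (Metric.mem_ball_self hr)

theorem RegularOn.deriv_T_eq {I : Set ℝ} (h : p.RegularOn I) (hI : IsOpen I)
    (hc : IsPreconnected I) (h2 : ∀ s ∈ I, deriv (deriv p.T) s = 0) {s : ℝ} (ht : t ∈ I)
    (hs : s ∈ I) : deriv p.T s = deriv p.T t := by
  have hd := ((contDiffOn_infty_iff_deriv_of_isOpen hI).1 h.contDiffOn_T).2
  exact hI.is_const_of_deriv_eq_zero hc (hd.differentiableOn (by simp)) h2 hs ht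

theorem newS_mul_add (x : ℝ) (σ V : ℂ) (r : ℝ) :
    p.newS t x (σ * r + V) = p.newσ t σ * r + p.newS t x V := by
  simp only [newS, newσ, hat_add, hat_mul, hat_ofReal]
  ring

theorem newψ_ne_zero {x : ℝ} {ψ : ℂ} (hψ : ψ ≠ 0) : p.newψ t x ψ ≠ 0 :=
  mul_ne_zero (hat_ne_zero hψ) (Complex.exp_ne_zero _)

/-- The hat preserves the norm, and every term of the exponent except `Θ` is purely imaginary. -/
theorem log_norm_newψ {x : ℝ} {ψ : ℂ} (hψ : ψ ≠ 0) :
    Real.log ‖p.newψ t x ψ‖ = Real.log ‖ψ‖ + p.Θ t := by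
  rw [newψ, norm_mul, norm_hat, Complex.norm_exp, Real.log_mul (norm_ne_zero_iff.2 hψ)
    (Real.exp_ne_zero _), Real.log_exp]
  congr 1
  have h1 : ∀ r : ℝ, (Complex.I / 8 * (r : ℂ)).re = 0 := fun r => by simp
  have h2 : ∀ r : ℝ, (Complex.I / 2 * (r : ℂ)).re = 0 := fun r => by simp
  rw [Complex.add_re, Complex.add_re, Complex.add_re, h1, h2]
  simp

/-- As `ln|ψ̃| = ln|ψ| + Θ`, expressing the logarithmic part of `S̃` through the new logarithm costs
`σ̃ Θ`, which is absorbed in the potential. -/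
theorem newV_eq (ha : a ≠ 0) (hT : ∀ᶠ s in 𝓝 t, deriv p.T s = a)
    (x : ℝ) (σ V : ℂ) : p.newV t x σ V = p.newS t x V - p.newσ t σ * p.Θ t := by
  have hTt := hT.self_of_nhds
  have h0 : 0 ≤ |a| := abs_nonneg a
  have h1 : |a| ^ (3 / 2 : ℝ) = |a| * √|a| := by
    rw [Real.sqrt_eq_rpow, ← Real.rpow_one_add' h0 (by norm_num)]
    norm_num
  have h2 : p.ε * deriv (deriv p.X) t / (2 * (|a| * √|a|)) * x =
      p.ε * Real.sign a / (2 * √|a|) * (deriv (deriv p.X) t / a) * x := by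
    have hs := real_sign_mul_abs a
    have h3 : 1 / |a| = Real.sign a / a := by
      rw [div_eq_div_iff (abs_ne_zero.2 ha) ha]
      linear_combination -hs
    calc _ = p.ε * deriv (deriv p.X) t / (2 * √|a|) * x * (1 / |a|) := by
          simp only [div_eq_mul_inv, mul_inv]; ring
      _ = _ := by rw [h3]; ring
  rw [newV, newS_eq hT, newσ, hTt, h1, h2]
  push_cast
  ring

/-- The transformation of the arbitrary element `S` induced by that of `σ` and `V`. -/
theorem newS_S (ha : a ≠ 0) (hT : ∀ᶠ s in 𝓝 t, deriv p.T s = a)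
    {x : ℝ} {ψ : ℂ} (hψ : ψ ≠ 0) (θ : Equation) :
    p.newS t x (θ.S (t, x, ψ)) = p.newσ t θ.σ * (Real.log ‖p.newψ t x ψ‖ : ℂ)
      + p.newV t x θ.σ (θ.V (t, x)) := by
  rw [newV_eq ha hT, log_norm_newψ hψ, Equation.S, newS_mul_add]
  simp only [indep]
  push_cast
  ring

end Params

/-! ### From admissibility to the form, and back. -/

/-- The Jacobian of `(t̃, x̃)` along any graph is triangular with diagonal entries `T_t` and `x̃_x`,
both non-zero. -/
theorem HasInfinitesimalForm.nonvertical {φ : Var → Var} {z : Var}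
    (h : HasInfinitesimalForm φ z) (a b : ℂ) (k : ℝ × ℝ)
    (hk : indep (fderiv ℝ φ z (k.1, k.2, k.1 * b + k.2 * a)) = 0) : k = 0 := by
  have hξ : (fderiv ℝ φ z (0, 1, 0)).2.1 ≠ 0 := by
    intro h0
    have h1 := h.space_sq
    rw [h0] at h1
    exact abs_ne_zero.2 h.timeDeriv_ne_zero (by rw [← h1]; simp)
  have h1 : ((k.1, k.2, k.1 * b + k.2 * a) : Var) =
      k.1 • (1, 0, 0) + k.2 • (0, 1, 0) + vert (k.1 * b + k.2 * a) := by
    ext <;> simp [vert_apply]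
  rw [h1, map_add, map_add, map_smul, map_smul] at hk
  simp only [indep, Prod.mk_eq_zero] at hk
  obtain ⟨h2, h3⟩ := hk
  simp only [Prod.fst_add, Prod.snd_add, Prod.smul_fst, Prod.smul_snd, smul_eq_mul,
    h.time _ (show ((0, 1, 0) : Var).1 = 0 from rfl), h.space_vert,
    h.time _ (show (vert (k.1 * b + k.2 * a)).1 = 0 from rfl), mul_zero, add_zero] at h2 h3
  have h4 : k.1 = 0 := by simpa [h.timeDeriv_ne_zero] using h2
  have h5 : k.2 = 0 := by simpa [h4, hξ] using h3
  exact Prod.ext h4 h5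

/-- The transformation of the arbitrary element is determined by that of the variables. -/
theorem CarriesOn.S_eq {φ : OpenPartialHomeomorph Var Var} {N : Set Var} {θ θ' : Equation}
    {z : Var} (hφ : IsPointTransformation φ) (hC : CarriesOn φ N θ θ') (hN : IsOpen N)
    (hz : z ∈ N) {p : Params} {I : Set ℝ} (hp : p.RegularOn I) (hI : IsOpen I)
    (h2 : ∀ s ∈ I, deriv (deriv p.T) s = 0) (ht : z.1 ∈ I)
    (hform : ∀ᶠ y in 𝓝 z, φ y = (p.T y.1, p.newX y.1 y.2.1, p.newψ y.1 y.2.1 y.2.2)) :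
    θ'.S (φ z) = p.newS z.1 z.2.1 (θ.S z) := by
  obtain ⟨t, x, ψ⟩ := z
  have hI' := hI.mem_nhds ht
  have hinf := hC.hasInfinitesimalForm hφ hN hz
  -- A test jet with `u_x = u_xx = 0` that satisfies the equation. Its image satisfies the new
  -- equation both with `θ'.S` and with `newS`, and `ψ̃ ≠ 0` can be cancelled.
  set b : ℂ := Complex.I * (θ.S (t, x, ψ) * ψ) with hb
  set u := quadJet (t, x) ψ 0 b 0 0 with hudef
  have hus : ContDiffAt ℝ ∞ u (t, x) := (contDiff_quadJet _ _ _ _ _ _).contDiffAt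
  have hu0 : u (t, x) = ψ := quadJet_self _ _ _ _ _ _
  have hud := fderiv_quadJet (t, x) ψ 0 b 0 0
  rw [← hudef] at hud
  obtain ⟨v, hv, hm⟩ := exists_mapsGraph (φ := φ) (u := u) (p := (t, x))
    (by simpa only [hu0] using hinf.contDiffAt) hus
    (fun k hk => hinf.nonvertical 0 b k (by simpa only [hu0, hud] using hk))
  obtain ⟨C, hC0, hid⟩ := Params.transform_identity (p := p) (φ := φ) (u := u) (v := v)
    (t := t) (x := x) (by simpa only [hu0] using hform) hp.ε_eq (hp.deriv_T_ne_zero t ht)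
    (hp.eventually_deriv_T hI h2 ht) (hp.contDiffOn_X.contDiffAt hI')
    (hp.contDiffOn_Θ.contDiffAt hI') (hp.contDiffOn_Ψ.contDiffAt hI') hus hv hm
    (θ.S (t, x, ψ))
  have h1 := hC.holdsAt_iff (t, x) u v (by simpa only [hu0] using hz) hus hv hm
  rw [θ.holdsAt_iff_fderiv (hus.of_le two_le_infty),
    θ'.holdsAt_iff_fderiv (hv.of_le two_le_infty)] at h1
  have hvψ : v (indep (φ (t, x, ψ))) = (φ (t, x, ψ)).2.2 := by
    have := hm.self_of_nhds
    simpa only [hu0] using this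
  rw [(hud _).1, (hud _).2] at h1 hid
  simp only [hu0, hvψ] at h1 hid
  have hz0 : Complex.I * (((1 : ℝ) : ℂ) * b + ((0 : ℝ) : ℂ) * 0)
      + (((0 : ℝ) : ℂ) ^ 2 * 0 + ((1 : ℝ) : ℂ) ^ 2 * 0) + θ.S (t, x, ψ) * ψ = 0 := by
    rw [hb]
    push_cast
    linear_combination (θ.S (t, x, ψ) * ψ) * Complex.I_mul_I
  have h3 := h1.1 hz0
  rw [hz0] at hid
  have h4 : hat (deriv p.T t) 0 = 0 := by simp [hat]
  rw [h4, mul_zero] at hid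
  have h5 : (φ (t, x, ψ)).2.2 ≠ 0 := (hC.mapsTo_domain _ hz).2
  apply mul_right_cancel₀ h5
  change θ'.S (φ (t, x, ψ)) * _ = p.newS t x _ * _
  have h6 : θ'.S (φ (t, x, ψ)) = θ'.S ((indep (φ (t, x, ψ))).1, (indep (φ (t, x, ψ))).2,
    (φ (t, x, ψ)).2.2) := rfl
  rw [h6]
  linear_combination h3 - hid

/-- A transformation of the given form maps an equation to the one with the transformed
arbitrary element. -/
theorem carriesOn_of_form {φ : OpenPartialHomeomorph Var Var} {N : Set Var} {θ θ' : Equation}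
    (hN : IsOpen N) (hsource : N ⊆ φ.source) (hdom : N ⊆ θ.domain)
    (hdom' : ∀ z ∈ N, φ z ∈ θ'.domain)
    {p : Params} {I : Set ℝ} (hp : p.RegularOn I) (hI : IsOpen I)
    (h2 : ∀ s ∈ I, deriv (deriv p.T) s = 0) (ht : ∀ z ∈ N, z.1 ∈ I)
    (hform : ∀ y ∈ N, φ y = (p.T y.1, p.newX y.1 y.2.1, p.newψ y.1 y.2.1 y.2.2))
    (hS : ∀ z ∈ N, θ'.S (φ z) = p.newS z.1 z.2.1 (θ.S z)) : CarriesOn φ N θ θ' where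
  subset_source := hsource
  subset_domain := hdom
  mapsTo_domain := hdom'
  holdsAt_iff := by
    rintro ⟨t, x⟩ u v hz hu hv hm
    have htI := ht _ hz
    have hI' := hI.mem_nhds htI
    obtain ⟨C, hC0, hid⟩ := Params.transform_identity (p := p) (φ := φ) (u := u) (v := v)
      (t := t) (x := x) (Filter.eventually_of_mem (hN.mem_nhds hz) hform) hp.ε_eq
      (hp.deriv_T_ne_zero t htI)
      (hp.eventually_deriv_T hI h2 htI) (hp.contDiffOn_X.contDiffAt hI')
      (hp.contDiffOn_Θ.contDiffAt hI') (hp.contDiffOn_Ψ.contDiffAt hI') hu hv hm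
      (θ.S (t, x, u (t, x)))
    have hvψ : v (indep (φ (t, x, u (t, x)))) = (φ (t, x, u (t, x))).2.2 := hm.self_of_nhds
    rw [θ.holdsAt_iff_fderiv (hu.of_le two_le_infty),
      θ'.holdsAt_iff_fderiv (hv.of_le two_le_infty), hvψ]
    have h6 : θ'.S ((indep (φ (t, x, u (t, x)))).1, (indep (φ (t, x, u (t, x)))).2,
        (φ (t, x, u (t, x))).2.2) = p.newS t x (θ.S (t, x, u (t, x))) := hS _ hz
    simp only at h6 hid ⊢
    rw [h6, hid]
    simp only [mul_eq_zero, hC0, false_or]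
    constructor
    · intro h
      rw [h]
      simp [hat]
    · intro h
      by_contra h0
      exact hat_ne_zero h0 h

theorem Equation.isOpen_domain (θ : Equation) : IsOpen θ.domain :=
  (θ.isOpen_dom.preimage (continuous_fst.prodMk continuous_snd.fst)).inter
    (isOpen_ne.preimage continuous_snd.snd)

theorem Equation.contDiffOn_S (θ : Equation) : ContDiffOn ℝ ∞ θ.S θ.domain := by
  have h1 : ContDiffOn ℝ ∞ (fun z : Var => Real.log ‖z.2.2‖) θ.domain :=
    (contDiff_snd.snd.contDiffOn.norm ℝ fun z hz => hz.2).log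
      fun z hz => norm_ne_zero_iff.2 hz.2
  have h2 : ContDiffOn ℝ ∞ (fun z : Var => θ.V (indep z)) θ.domain :=
    θ.contDiffOn_V.comp (f := indep) (contDiff_fst.prodMk contDiff_snd.fst).contDiffOn
      fun z hz => hz.1
  exact (contDiffOn_const.mul (Complex.ofRealCLM.contDiff.comp_contDiffOn h1)).add h2

/-- An arbitrary element can have any value at a given point. -/
theorem Equation.exists_S_eq {z : Var} (hz : z.2.2 ≠ 0) (s : ℂ) :
    ∃ θ : Equation, z ∈ θ.domain ∧ θ.S z = s :=
  ⟨⟨Set.univ, isOpen_univ, 1, one_ne_zero, fun _ => s - Real.log ‖z.2.2‖, contDiffOn_const⟩,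
    ⟨Set.mem_univ _, hz⟩, by simp [Equation.S]⟩

theorem isTimeConnected_ball (q : ExtVar) (r : ℝ) : IsTimeConnected (Metric.ball q r) where
  isOpen := Metric.isOpen_ball
  isPreconnected := (convex_ball q r).isPreconnected
  isPreconnected_section t :=
    ((convex_ball q r).inter ((convex_singleton t).linear_preimage
      (LinearMap.fst ℝ ℝ (ℝ × ℂ) ∘ₗ LinearMap.fst ℝ Var ℂ))).isPreconnected

theorem Params.RegularOn.exists_T_eq {p : Params} {I : Set ℝ} (hp : p.RegularOn I)
    (hI : IsOpen I) (hc : IsPreconnected I) (h2 : ∀ s ∈ I, deriv (deriv p.T) s = 0) :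
    ∃ a b : ℝ, a ≠ 0 ∧ ∀ t ∈ I, deriv p.T t = a ∧ p.T t = a * t + b := by
  rcases I.eq_empty_or_nonempty with rfl | ⟨t₀, ht₀⟩
  · exact ⟨1, 0, one_ne_zero, by simp⟩
  have hT := fun t ht => hp.deriv_T_eq hI hc h2 ht₀ (s := t) ht
  have hd : ∀ t ∈ I, HasDerivAt (fun s => p.T s - deriv p.T t₀ * s) 0 t := by
    intro t ht
    have h1 := (differentiableAt_of_deriv_ne_zero (hp.deriv_T_ne_zero t ht)).hasDerivAt
    rw [hT t ht] at h1
    exact (h1.sub ((hasDerivAt_id t).const_mul _)).congr_deriv (by simp)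
  refine ⟨deriv p.T t₀, p.T t₀ - deriv p.T t₀ * t₀, hp.deriv_T_ne_zero _ ht₀,
    fun t ht => ⟨hT t ht, ?_⟩⟩
  have := hI.is_const_of_deriv_eq_zero hc
    (fun s hs => (hd s hs).differentiableAt.differentiableWithinAt) (fun s hs => (hd s hs).deriv)
    ht ht₀
  linarith

/-- A transformation of the given form with `T_tt = 0` maps equations to equations. -/
theorem Params.RegularOn.exists_equation {p : Params} {I : Set ℝ} (hp : p.RegularOn I)
    (hI : IsOpen I) (hc : IsPreconnected I) (h2 : ∀ s ∈ I, deriv (deriv p.T) s = 0)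
    (θ : Equation) :
    ∃ θ' : Equation, ∀ z ∈ θ.domain, z.1 ∈ I →
      ((p.T z.1, p.newX z.1 z.2.1, p.newψ z.1 z.2.1 z.2.2) : Var) ∈ θ'.domain ∧
      θ'.S (p.T z.1, p.newX z.1 z.2.1, p.newψ z.1 z.2.1 z.2.2) =
        p.newS z.1 z.2.1 (θ.S z) := by
  obtain ⟨a, b, ha, hT⟩ := hp.exists_T_eq hI hc h2
  set κ : ℝ := p.ε * √|a| with hκ
  have hκ0 : κ ≠ 0 := by
    refine mul_ne_zero ?_ (Real.sqrt_ne_zero'.2 (abs_pos.2 ha))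
    rcases hp.ε_eq with h | h <;> simp [h]
  -- Since `T` is affine on `I`, the inverse of `(t, x) ↦ (t̃, x̃)` is explicit; the new potential
  -- is `newV` pulled back by it.
  set ti : ℝ × ℝ → ℝ := fun y => (y.1 - b) / a with hti
  set xi : ℝ × ℝ → ℝ := fun y => (y.2 - p.X (ti y)) / κ with hxi
  have htis : ContDiff ℝ ∞ ti := by fun_prop
  set U : Set (ℝ × ℝ) := ti ⁻¹' I with hU
  have hUo : IsOpen U := hI.preimage htis.continuous
  have hcomp : ∀ {f : ℝ → ℝ}, ContDiffOn ℝ ∞ f I → ContDiffOn ℝ ∞ (fun y => f (ti y)) U :=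
    fun hf => hf.comp htis.contDiffOn fun y hy => hy
  have hderiv : ∀ {f : ℝ → ℝ}, ContDiffOn ℝ ∞ f I → ContDiffOn ℝ ∞ (deriv f) I :=
    fun hf => ((contDiffOn_infty_iff_deriv_of_isOpen hI).1 hf).2
  have hxis : ContDiffOn ℝ ∞ xi U :=
    (contDiff_snd.contDiffOn.sub (hcomp hp.contDiffOn_X)).div_const κ
  have hgs : ContDiffOn ℝ ∞ (fun y => (ti y, xi y)) U := htis.contDiffOn.prodMk hxis
  have hre : ∀ {f : ℝ × ℝ → ℝ} {s : Set (ℝ × ℝ)}, ContDiffOn ℝ ∞ f s →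
      ContDiffOn ℝ ∞ (fun y => (f y : ℂ)) s :=
    fun hf => Complex.ofRealCLM.contDiff.comp_contDiffOn hf
  set dom : Set (ℝ × ℝ) := U ∩ (fun y => (ti y, xi y)) ⁻¹' θ.dom with hdom
  have hsub : dom ⊆ U := Set.inter_subset_left
  have hVs : ContDiffOn ℝ ∞ (fun y => p.newV (ti y) (xi y) θ.σ (θ.V (ti y, xi y))) dom := by
    have h : ContDiffOn ℝ ∞ (fun y => hatL a (θ.V (ti y, xi y)) / (|a| : ℝ)
        + ((p.ε * deriv (deriv p.X) (ti y) / (2 * |a| ^ (3 / 2 : ℝ)) * xi y : ℝ) : ℂ)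
        - hat a θ.σ * ((p.Θ (ti y) / |a| : ℝ) : ℂ)
        - ((1 / 4 * (deriv p.X (ti y) ^ 2 / a ^ 2) : ℝ) : ℂ)
        + ((deriv p.Ψ (ti y) / a : ℝ) : ℂ)
        - Complex.I * ((deriv p.Θ (ti y) / a : ℝ) : ℂ)) dom := by
      have e1 := (hatL a).contDiff.comp_contDiffOn
        (θ.contDiffOn_V.comp (hgs.mono hsub) fun y hy => hy.2)
      have e2 := ((contDiffOn_const (c := p.ε)).mul (hcomp (hderiv (hderiv hp.contDiffOn_X)))
        |>.div_const (2 * |a| ^ (3 / 2 : ℝ))).mul hxis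
      have e3 := (hcomp hp.contDiffOn_Θ).div_const |a|
      have e4 := (contDiffOn_const (c := (1 / 4 : ℝ))).mul
        (((hcomp (hderiv hp.contDiffOn_X)).pow 2).div_const (a ^ 2))
      have e5 := (hcomp (hderiv hp.contDiffOn_Ψ)).div_const a
      have e6 := (hcomp (hderiv hp.contDiffOn_Θ)).div_const a
      exact (((((e1.div_const _).add (hre (e2.mono hsub))).sub
        (contDiffOn_const.mul (hre (e3.mono hsub)))).sub (hre (e4.mono hsub))).add
        (hre (e5.mono hsub))).sub (contDiffOn_const.mul (hre (e6.mono hsub)))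
    refine h.congr fun y hy => ?_
    simp only [newV, (hT _ (hsub hy)).1, hatL_apply]
  refine ⟨⟨dom, hgs.continuousOn.isOpen_inter_preimage hUo θ.isOpen_dom, hat a θ.σ / (|a| : ℝ),
    div_ne_zero (hat_ne_zero θ.σ_ne_zero) (by simpa using ha), _, hVs⟩, ?_⟩
  rintro ⟨t, x, ψ⟩ hz ht
  have hTt := hT t ht
  have h1 : ti (p.T t, p.newX t x) = t := by
    simp only [hti, hTt.2]
    field_simp
    ring
  have h2 : xi (p.T t, p.newX t x) = x := by
    simp only [hxi]
    rw [h1, newX_eq hTt.1, ← hκ]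
    field_simp
    ring
  refine ⟨⟨⟨?_, ?_⟩, newψ_ne_zero hz.2⟩, ?_⟩
  · change ti (p.T t, p.newX t x) ∈ I
    rwa [h1]
  · change (ti (p.T t, p.newX t x), xi (p.T t, p.newX t x)) ∈ θ.dom
    rw [h1, h2]
    exact hz.1
  · have h3 : ∀ᶠ s in 𝓝 t, deriv p.T s = a := by
      filter_upwards [hI.mem_nhds ht] with s hs using (hT s hs).1
    rw [newS_S ha h3 hz.2, newσ, hTt.1]
    change _ * _ + p.newV (ti (p.T t, p.newX t x)) (xi (p.T t, p.newX t x)) θ.σ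
      (θ.V (ti (p.T t, p.newX t x), xi (p.T t, p.newX t x))) = _
    rw [h1, h2]

theorem HasFormOn.base_eq {P : ExtTransformation} {p : Params} {W : Set ExtVar}
    (h : HasFormOn P p W) {q : ExtVar} (hq : q ∈ W) :
    P.base q.1 = (p.T q.1.1, p.newX q.1.1 q.1.2.1, p.newψ q.1.1 q.1.2.1 q.1.2.2) := by
  rw [← P.ext_fst q (h.subset_source hq), h.ext_eq q hq]
  rfl

/-- Membership is local, and a small ball around a point of the graph of `θ` is time-connected; on
the part of the graph inside it the parameters give the new equation. -/
theorem mem_equivalenceGroup_of_form {P : ExtTransformation}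
    (h : ∀ W ⊆ P.ext.source, IsTimeConnected W → ∃ p, HasFormOn P p W) :
    P ∈ equivalenceGroup := by
  intro θ z hz hs
  obtain ⟨r, hr, hball⟩ := Metric.isOpen_iff.1 P.ext.open_source _ hs
  set W := Metric.ball (z, θ.S z) r
  have hW : IsTimeConnected W := isTimeConnected_ball _ _
  obtain ⟨p, hp⟩ := h W hball hW
  have hI := isOpen_times hW.isOpen
  obtain ⟨θ', hθ'⟩ := hp.regularOn.exists_equation hI hW.isPreconnected_times
    hp.deriv_deriv_T θ
  set N : Set Var := θ.domain ∩ (fun y => (y, θ.S y)) ⁻¹' W with hN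
  have hNo : IsOpen N := (continuousOn_id.prodMk θ.contDiffOn_S.continuousOn).isOpen_inter_preimage
    θ.isOpen_domain hW.isOpen
  have ht : ∀ y ∈ N, y.1 ∈ times W := fun y hy => ⟨_, hy.2, rfl⟩
  have hbase : ∀ y ∈ N, P.base y = (p.T y.1, p.newX y.1 y.2.1, p.newψ y.1 y.2.1 y.2.2) :=
    fun y hy => hp.base_eq hy.2
  have hdom : ∀ y ∈ N, P.base y ∈ θ'.domain := fun y hy => by
    rw [hbase y hy]
    exact (hθ' y hy.1 (ht y hy)).1
  have hS : ∀ y ∈ N, θ'.S (P.base y) = p.newS y.1 y.2.1 (θ.S y) := fun y hy => by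
    rw [hbase y hy]
    exact (hθ' y hy.1 (ht y hy)).2
  refine ⟨θ', N, hNo, ⟨hz, Metric.mem_ball_self hr⟩, fun y hy => ⟨hy.1, hball hy.2, hdom y hy, ?_⟩,
    carriesOn_of_form hNo (fun y hy => ?_) (fun y hy => hy.1) hdom hp.regularOn hI
      hp.deriv_deriv_T ht hbase hS⟩
  · rw [hS y hy, hp.ext_eq _ hy.2]
    rfl
  · rw [P.base_source]
    exact ⟨_, hball hy.2, rfl⟩

/-- Every point of `W` lies on the graph of some arbitrary element, so the infinitesimal form holds
everywhere on `W`. The parameters come from the projection alone; the `S`-component is then checked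
at each point with its own pair of equations. -/
theorem exists_form_of_mem_equivalenceGroup {P : ExtTransformation} (hP : P ∈ equivalenceGroup)
    {W : Set ExtVar} (hsub : W ⊆ P.ext.source) (hW : IsTimeConnected W) :
    ∃ p, HasFormOn P p W := by
  have hsource : ∀ q ∈ W, q.1 ∈ P.base.source := fun q hq => by
    rw [P.base_source]
    exact ⟨q, hsub hq, rfl⟩
  have hb := P.isPointTransformation_base
  have hcarry : ∀ q ∈ W, ∃ (θ θ' : Equation) (N : Set Var), θ.S q.1 = q.2 ∧ IsOpen N ∧ q.1 ∈ N ∧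
      P.ActsOn N θ θ' ∧ CarriesOn P.base N θ θ' := by
    intro q hq
    obtain ⟨θ, hθ, hS⟩ := Equation.exists_S_eq (hb.source_ne_zero _ (hsource q hq)) q.2
    obtain ⟨θ', N, h⟩ := hP θ q.1 hθ (by rw [hS]; exact hsub hq)
    exact ⟨θ, θ', N, hS, h⟩
  obtain ⟨p, hp, h2, -, hform⟩ := hW.exists_params (φ := P.base)
    (fun q hq => by
      obtain ⟨θ, θ', N, -, hN, hz, -, hC⟩ := hcarry q hq
      exact hC.hasInfinitesimalForm hb hN hz)
    (fun q hq => ⟨hb.source_ne_zero _ (hsource q hq),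
      hb.target_ne_zero _ (P.base.map_source (hsource q hq))⟩)
  refine ⟨p, hsub, hp, h2, fun q hq => ?_⟩
  obtain ⟨θ, θ', N, hS, hN, hz, hA, hC⟩ := hcarry q hq
  have hloc : ∀ᶠ y in 𝓝 q.1,
      P.base y = (p.T y.1, p.newX y.1 y.2.1, p.newψ y.1 y.2.1 y.2.2) := by
    have hc : Filter.Tendsto (fun y : Var => ((y, q.2) : ExtVar)) (𝓝 q.1) (𝓝 q) :=
      (continuousAt_id.prodMk continuousAt_const).tendsto
    filter_upwards [hc.eventually (hW.isOpen.mem_nhds hq)] with y hy using hform _ hy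
  have h3 := hC.S_eq hb hN hz hp (isOpen_times hW.isOpen) h2 ⟨q, hq, rfl⟩ hloc
  have h4 := (hA _ hz).2.2.2
  rw [hS] at h3 h4
  refine Prod.ext ?_ ?_
  · rw [P.ext_fst q (hsub hq), hform q hq]
    rfl
  · exact h4.trans h3

/-! ### Extension to the arbitrary element, and normalization. -/

section Extension

variable {A : Var → ℝ} {D : Var → ℂ} {s : Set Var}

theorem contDiffOn_of_locally_const (hA : ∀ z ∈ s, ∀ᶠ y in 𝓝 z, A y = A z) :
    ContDiffOn ℝ ∞ A s := fun z hz =>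
  (contDiffAt_const.congr_of_eventuallyEq (f := fun _ => A z) (hA z hz)).contDiffWithinAt

/-- As `A` is locally constant, the hat is locally the identity or locally the conjugation. -/
theorem contDiffOn_hat {f : ExtVar → ℂ} (hs : IsOpen s)
    (hA : ∀ z ∈ s, ∀ᶠ y in 𝓝 z, A y = A z) (hf : ContDiffOn ℝ ∞ f (s ×ˢ Set.univ)) :
    ContDiffOn ℝ ∞ (fun q : ExtVar => hat (A q.1) (f q)) (s ×ˢ Set.univ) := by
  intro q hq
  have h1 : ContDiffAt ℝ ∞ f q := hf.contDiffAt ((hs.prod isOpen_univ).mem_nhds hq)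
  have h2 : ContDiffAt ℝ ∞ (fun y => hatL (A q.1) (f y)) q :=
    (hatL (A q.1)).contDiff.contDiffAt.comp q h1
  refine (h2.congr_of_eventuallyEq ?_).contDiffWithinAt
  filter_upwards [(continuous_fst.tendsto q).eventually (hA q.1 hq.1)] with y hy
  rw [hy, hatL_apply]

theorem contDiffOn_abs_fst (hA0 : ∀ z ∈ s, A z ≠ 0) (hA : ∀ z ∈ s, ∀ᶠ y in 𝓝 z, A y = A z) :
    ContDiffOn ℝ ∞ (fun q : ExtVar => ((|A q.1| : ℝ) : ℂ)) (s ×ˢ Set.univ) :=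
  Complex.ofRealCLM.contDiff.comp_contDiffOn
    (((contDiffOn_of_locally_const hA).comp contDiff_fst.contDiffOn fun _ hq => hq.1).abs
      fun _ hq => hA0 _ hq.1)

theorem contDiffOn_affine (hs : IsOpen s) (hA0 : ∀ z ∈ s, A z ≠ 0)
    (hA : ∀ z ∈ s, ∀ᶠ y in 𝓝 z, A y = A z) (hD : ContDiffOn ℝ ∞ D s) :
    ContDiffOn ℝ ∞ (fun q : ExtVar => hat (A q.1) q.2 / (|A q.1| : ℝ) + D q.1)
      (s ×ˢ Set.univ) := by
  simp only [div_eq_mul_inv]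
  refine ((contDiffOn_hat hs hA contDiffOn_snd).mul
    ((contDiffOn_abs_fst hA0 hA).inv fun q hq => ?_)).add
    (hD.comp contDiff_fst.contDiffOn fun _ hq => hq.1)
  simpa using hA0 _ hq.1

theorem contDiffOn_affine_symm (hs : IsOpen s) (hA0 : ∀ z ∈ s, A z ≠ 0)
    (hA : ∀ z ∈ s, ∀ᶠ y in 𝓝 z, A y = A z) (hD : ContDiffOn ℝ ∞ D s) :
    ContDiffOn ℝ ∞ (fun q : ExtVar => hat (A q.1) ((|A q.1| : ℝ) * (q.2 - D q.1)))
      (s ×ˢ Set.univ) :=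
  contDiffOn_hat hs hA ((contDiffOn_abs_fst hA0 hA).mul
    (contDiffOn_snd.sub (hD.comp contDiff_fst.contDiffOn fun _ hq => hq.1)))

/-- Every point transformation extends to the arbitrary element by `S̃ = Ŝ/|A| + D` where `A` is
a non-vanishing locally constant function of the variables and `D` a smooth one. -/
theorem exists_extension {φ : OpenPartialHomeomorph Var Var} (hφ : IsPointTransformation φ)
    (hA0 : ∀ z ∈ φ.source, A z ≠ 0) (hA : ∀ z ∈ φ.source, ∀ᶠ y in 𝓝 z, A y = A z)
    (hD : ContDiffOn ℝ ∞ D φ.source) :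
    ∃ P : ExtTransformation, P.base = φ ∧ P.ext.source = φ.source ×ˢ Set.univ ∧
      ∀ q, P.ext q = (φ q.1, hat (A q.1) q.2 / (|A q.1| : ℝ) + D q.1) := by
  have hm : ∀ y ∈ φ.target, φ.symm y ∈ φ.source := fun y hy => φ.map_target hy
  have hsymm : ContDiffOn ℝ ∞ (fun q : ExtVar => φ.symm q.1) (φ.target ×ˢ Set.univ) :=
    hφ.contDiffOn_symm.comp contDiff_fst.contDiffOn fun q hq => hq.1
  have h1 : ContDiffOn ℝ ∞ (fun q : ExtVar =>
      ((φ q.1, hat (A q.1) q.2 / (|A q.1| : ℝ) + D q.1) : ExtVar)) (φ.source ×ˢ Set.univ) :=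
    (hφ.contDiffOn.comp contDiff_fst.contDiffOn fun q hq => hq.1).prodMk
      (contDiffOn_affine φ.open_source hA0 hA hD)
  have h2 : ContDiffOn ℝ ∞ (fun q : ExtVar => ((φ.symm q.1, hat (A (φ.symm q.1))
      ((|A (φ.symm q.1)| : ℝ) * (q.2 - D (φ.symm q.1)))) : ExtVar)) (φ.target ×ˢ Set.univ) :=
    hsymm.prodMk ((contDiffOn_affine_symm φ.open_source hA0 hA hD).comp
      (hsymm.prodMk contDiffOn_snd) fun q hq => ⟨hm _ hq.1, Set.mem_univ _⟩)
  refine ⟨{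
    ext := {
      toFun := fun q => (φ q.1, hat (A q.1) q.2 / (|A q.1| : ℝ) + D q.1)
      invFun := fun q => (φ.symm q.1, hat (A (φ.symm q.1))
        ((|A (φ.symm q.1)| : ℝ) * (q.2 - D (φ.symm q.1))))
      source := φ.source ×ˢ Set.univ
      target := φ.target ×ˢ Set.univ
      map_source' := fun q hq => ⟨φ.map_source hq.1, Set.mem_univ _⟩
      map_target' := fun q hq => ⟨φ.map_target hq.1, Set.mem_univ _⟩
      left_inv' := fun q hq => ?_
      right_inv' := fun q hq => ?_
      open_source := φ.open_source.prod isOpen_univ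
      open_target := φ.open_target.prod isOpen_univ
      continuousOn_toFun := h1.continuousOn
      continuousOn_invFun := h2.continuousOn }
    base := φ
    contDiffOn_ext := h1
    contDiffOn_ext_symm := h2
    isPointTransformation_base := hφ
    base_source := ?_
    ext_fst := fun _ _ => rfl }, rfl, rfl, fun _ => rfl⟩
  · simp only [φ.left_inv hq.1, add_sub_cancel_right]
    rw [mul_div_cancel₀ _ (by simpa using hA0 _ hq.1), hat_hat]
  · have h3 := hA0 _ (hm _ hq.1)
    simp only [φ.right_inv hq.1, hat_hat]
    rw [mul_div_cancel_left₀ _ (by simpa using h3), sub_add_cancel]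
  · ext z
    simp

end Extension

/-- The extension of `φ` is affine in `S` with the forced slope, and its translation part is chosen
so that `θ.S` goes to `θ'.S`. By `CarriesOn.S_eq`, `newS` takes the same value there and has the
same slope, so the two agree for every `S`. -/
theorem isNormalizedClass : IsNormalizedClass := by
  rintro θ θ' φ ⟨hφ, hC⟩
  have hinf : ∀ z ∈ φ.source, HasInfinitesimalForm φ z :=
    fun z hz => hC.hasInfinitesimalForm hφ φ.open_source hz
  set A : Var → ℝ := fun z => (fderiv ℝ φ z (1, 0, 0)).1 with hAdef
  have hA0 : ∀ z ∈ φ.source, A z ≠ 0 := fun z hz => (hinf z hz).timeDeriv_ne_zero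
  have hA : ∀ z ∈ φ.source, ∀ᶠ y in 𝓝 z, A y = A z := fun z hz => (hinf z hz).timeDeriv_const
  set B : Var → ℂ := fun z => hat (A z) (θ.S z) / (|A z| : ℝ) with hB
  have hθS : ContDiffOn ℝ ∞ θ.S φ.source := θ.contDiffOn_S.mono hC.subset_domain
  have hBs : ContDiffOn ℝ ∞ B φ.source := by
    have h := (contDiffOn_affine (D := 0) φ.open_source hA0 hA contDiffOn_const).comp
      (contDiffOn_id.prodMk hθS) fun z hz => ⟨hz, Set.mem_univ _⟩
    refine h.congr fun z _ => ?_
    simp [hB]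
  have hDs : ContDiffOn ℝ ∞ (fun z => θ'.S (φ z) - B z) φ.source :=
    (θ'.contDiffOn_S.comp hφ.contDiffOn hC.mapsTo_domain).sub hBs
  obtain ⟨P, hbase, hsource, hext⟩ := exists_extension hφ hA0 hA hDs
  refine ⟨P, mem_equivalenceGroup_of_form fun W hW hWt => ?_, hbase, fun z hz =>
    ⟨hC.subset_domain hz, by rw [hsource]; exact ⟨hz, Set.mem_univ _⟩, by
      rw [hbase]; exact hC.mapsTo_domain z hz, by rw [hext, hbase]; simp [hB]⟩⟩
  have hWs : ∀ q ∈ W, q.1 ∈ φ.source := fun q hq => by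
    have := hW hq
    rw [hsource] at this
    exact this.1
  obtain ⟨p, hp, h2, hpT, hform⟩ := hWt.exists_params (φ := φ) (fun q hq => hinf _ (hWs q hq))
    fun q hq => ⟨hφ.source_ne_zero _ (hWs q hq), hφ.target_ne_zero _ (φ.map_source (hWs q hq))⟩
  refine ⟨p, hW, hp, h2, fun q hq => ?_⟩
  have hloc : ∀ᶠ y in 𝓝 q.1, φ y = (p.T y.1, p.newX y.1 y.2.1, p.newψ y.1 y.2.1 y.2.2) := by
    have hc : Filter.Tendsto (fun y : Var => ((y, q.2) : ExtVar)) (𝓝 q.1) (𝓝 q) :=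
      (continuousAt_id.prodMk continuousAt_const).tendsto
    filter_upwards [hc.eventually (hWt.isOpen.mem_nhds hq)] with y hy using hform _ hy
  have h3 := hC.S_eq hφ φ.open_source (hWs q hq) hp (isOpen_times hWt.isOpen) h2
    ⟨q, hq, rfl⟩ hloc
  rw [hext]
  refine Prod.ext (hform q hq) ?_
  have h4 := Params.newS_sub (p := p) (t := q.1.1) q.1.2.1 q.2 (θ.S q.1)
  have h5 : deriv p.T q.1.1 = A q.1 := hpT q hq
  rw [h5] at h4
  simp only [h3, hB, Params.toFun]
  linear_combination -h4

/-! ### Transformation of `(σ, V)` and realization of all parameters. -/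

/-- The transformation of `(σ, V)` corresponding to that of the arbitrary element `S`. -/
theorem HasFormOn.actsOn_iff {P : ExtTransformation} {p : Params} {W : Set ExtVar}
    (hp : HasFormOn P p W) (hW : IsOpen W) {θ θ' : Equation} {N : Set Var} (hN : IsOpen N)
    (h : ∀ z ∈ N, z ∈ θ.domain ∧ (z, θ.S z) ∈ W ∧ P.base z ∈ θ'.domain) :
    P.ActsOn N θ θ' ↔ ∀ z ∈ N, θ'.σ = p.newσ z.1 θ.σ ∧
      θ'.V (p.T z.1, p.newX z.1 z.2.1) = p.newV z.1 z.2.1 θ.σ (θ.V (z.1, z.2.1)) := by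
  have hS : ∀ z ∈ N, (P.ext (z, θ.S z)).2 = p.newσ z.1 θ.σ *
      (Real.log ‖p.newψ z.1 z.2.1 z.2.2‖ : ℂ) + p.newV z.1 z.2.1 θ.σ (θ.V (z.1, z.2.1)) := by
    intro z hz
    obtain ⟨hz1, hz2, -⟩ := h z hz
    have ht : z.1 ∈ times W := ⟨_, hz2, rfl⟩
    rw [hp.ext_eq _ hz2, ← Params.newS_S (hp.regularOn.deriv_T_ne_zero _ ht)
      (hp.regularOn.eventually_deriv_T (isOpen_times hW) hp.deriv_deriv_T ht) hz1.2]
    rfl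
  have hS' : ∀ z ∈ N, θ'.S (P.base z) = θ'.σ * (Real.log ‖p.newψ z.1 z.2.1 z.2.2‖ : ℂ)
      + θ'.V (p.T z.1, p.newX z.1 z.2.1) := by
    intro z hz
    rw [hp.base_eq (h z hz).2.1]
    rfl
  constructor
  · intro hA z hz
    have hz0 : z.2.2 ≠ 0 := (h z hz).1.2
    have hc : Filter.Tendsto (fun r : ℝ => ((z.1, z.2.1, r * z.2.2) : Var)) (𝓝[>] 1) (𝓝 z) := by
      have : ContinuousAt (fun r : ℝ => ((z.1, z.2.1, r * z.2.2) : Var)) 1 := by fun_prop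
      simpa [ContinuousAt] using this.tendsto.mono_left (nhdsWithin_le_nhds (s := Set.Ioi 1))
    -- Rescaling `ψ` by a real `r > 1` close to 1 keeps `(t, x)` and changes both logarithms by `log
    -- r ≠ 0`; subtracting the two relations isolates `σ`, and then `V`.
    obtain ⟨r, hrN, hr1⟩ :=
      ((hc.eventually (hN.mem_nhds hz)).and self_mem_nhdsWithin).exists
    have hr : 1 < r := hr1
    have e1 := (hA z hz).2.2.2
    have e2 := (hA _ hrN).2.2.2
    rw [hS _ hz, hS' _ hz, Params.log_norm_newψ hz0] at e1
    rw [hS _ hrN, hS' _ hrN, Params.log_norm_newψ (h _ hrN).1.2] at e2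
    have hr0 : (r : ℝ) ≠ 0 := by positivity
    simp only [norm_mul, Complex.norm_real, Real.norm_eq_abs,
      Real.log_mul (abs_ne_zero.2 hr0) (norm_ne_zero_iff.2 hz0), Real.log_abs] at e2
    push_cast at e1 e2
    have hlog : (Real.log r : ℂ) ≠ 0 := by exact_mod_cast (Real.log_pos hr).ne'
    have hσ : θ'.σ = p.newσ z.1 θ.σ := mul_right_cancel₀ hlog (by linear_combination e1 - e2)
    refine ⟨hσ, ?_⟩
    rw [hσ] at e1
    linear_combination -e1
  · intro hA z hz
    obtain ⟨hz1, hz2, hz3⟩ := h z hz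
    refine ⟨hz1, hp.subset_source hz2, hz3, ?_⟩
    rw [hS _ hz, hS' _ hz, (hA z hz).1, (hA z hz).2]

theorem exists_pointTransformation {p : Params} {I : Set ℝ} (hI : IsOpen I)
    (hc : IsPreconnected I) (hp : p.RegularOn I) (h2 : ∀ t ∈ I, deriv (deriv p.T) t = 0) :
    ∃ φ : OpenPartialHomeomorph Var Var, IsPointTransformation φ ∧
      φ.source = {z | z.1 ∈ I ∧ z.2.2 ≠ 0} ∧
      ∀ z, φ z = (p.T z.1, p.newX z.1 z.2.1, p.newψ z.1 z.2.1 z.2.2) := by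
  obtain ⟨a, b, ha, hT⟩ := hp.exists_T_eq hI hc h2
  set κ : ℝ := p.ε * √|a| with hκ
  have hκ0 : κ ≠ 0 := by
    refine mul_ne_zero ?_ (Real.sqrt_ne_zero'.2 (abs_pos.2 ha))
    rcases hp.ε_eq with h | h <;> simp [h]
  set ti : Var → ℝ := fun y => (y.1 - b) / a with hti
  set xi : Var → ℝ := fun y => (y.2.1 - p.X (ti y)) / κ with hxi
  set E : ℝ → ℝ → ℂ := fun t x => p.slope a t * x + p.Θ t + Complex.I * p.Ψ t with hE
  set F : Var → Var := fun z => (p.T z.1, p.newX z.1 z.2.1, p.newψ z.1 z.2.1 z.2.2) with hF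
  -- The inverse: the exponential factor is removed first, and the hat, being an involution, is
  -- applied again.
  set G : Var → Var := fun y =>
    (ti y, xi y, hat a (Complex.exp (-E (ti y) (xi y)) * y.2.2)) with hG
  set s : Set Var := {z | z.1 ∈ I ∧ z.2.2 ≠ 0} with hs
  set s' : Set Var := {y | ti y ∈ I ∧ y.2.2 ≠ 0} with hs'
  have htis : ContDiff ℝ ∞ ti := by fun_prop
  have hso : IsOpen s := (hI.preimage continuous_fst).inter
    (isOpen_ne.preimage continuous_snd.snd)
  have hso' : IsOpen s' := (hI.preimage htis.continuous).inter
    (isOpen_ne.preimage continuous_snd.snd)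
  have hX' : ContDiffOn ℝ ∞ (deriv p.X) I :=
    ((contDiffOn_infty_iff_deriv_of_isOpen hI).1 hp.contDiffOn_X).2
  have hre : ∀ {f : Var → ℝ} {u : Set Var}, ContDiffOn ℝ ∞ f u →
      ContDiffOn ℝ ∞ (fun y => (f y : ℂ)) u :=
    fun hf => Complex.ofRealCLM.contDiff.comp_contDiffOn hf
  have hEs : ∀ {f g : Var → ℝ} {u : Set Var}, ContDiffOn ℝ ∞ f u → ContDiffOn ℝ ∞ g u →
      (∀ y ∈ u, f y ∈ I) → ContDiffOn ℝ ∞ (fun y => E (f y) (g y)) u := by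
    intro f g u hf hg hm
    have e1 := ((contDiffOn_const (c := p.ε * Real.sign a)).mul (hX'.comp hf hm)).div_const √|a|
    exact ((((contDiffOn_const (c := Complex.I / 2)).mul (hre e1)).mul (hre hg)).add
      (hre (hp.contDiffOn_Θ.comp hf hm))).add
      (contDiffOn_const.mul (hre (hp.contDiffOn_Ψ.comp hf hm)))
  have hFeq : ∀ z ∈ s, F z = (a * z.1 + b, κ * z.2.1 + p.X z.1,
      Complex.exp (E z.1 z.2.1) * hatL a z.2.2) := by
    intro z hz
    simp only [hF, (hT _ hz.1).2, Params.newX_eq (hT _ hz.1).1, Params.newψ_eq (hT _ hz.1).1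
      (h2 _ hz.1), hatL_apply, hE, hκ]
  have hFs : ContDiffOn ℝ ∞ F s := by
    have e1 : ContDiffOn ℝ ∞ (fun z : Var => a * z.1 + b) s := by fun_prop
    have e2 : ContDiffOn ℝ ∞ (fun z : Var => κ * z.2.1 + p.X z.1) s :=
      (contDiffOn_const.mul contDiff_snd.fst.contDiffOn).add
        (hp.contDiffOn_X.comp contDiff_fst.contDiffOn fun _ hz => hz.1)
    have e3 : ContDiffOn ℝ ∞ (fun z : Var => Complex.exp (E z.1 z.2.1) * hatL a z.2.2) s :=
      (hEs contDiff_fst.contDiffOn contDiff_snd.fst.contDiffOn fun _ hz => hz.1).cexp.mul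
        ((hatL a).contDiff.comp_contDiffOn contDiff_snd.snd.contDiffOn)
    exact (e1.prodMk (e2.prodMk e3)).congr hFeq
  have hxis : ContDiffOn ℝ ∞ xi s' :=
    (contDiff_snd.fst.contDiffOn.sub
      (hp.contDiffOn_X.comp htis.contDiffOn fun _ hy => hy.1)).div_const κ
  have hGs : ContDiffOn ℝ ∞ G s' := by
    have e3 : ContDiffOn ℝ ∞
        (fun y : Var => hatL a (Complex.exp (-E (ti y) (xi y)) * y.2.2)) s' :=
      (hatL a).contDiff.comp_contDiffOn ((hEs htis.contDiffOn hxis fun _ hy => hy.1).neg.cexp.mul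
        contDiff_snd.snd.contDiffOn)
    refine (htis.contDiffOn.prodMk (hxis.prodMk e3)).congr fun y _ => ?_
    simp only [hG, hatL_apply]
  have hGF : ∀ z ∈ s, G (F z) = z ∧ F z ∈ s' := by
    intro z hz
    rw [hFeq z hz]
    have h1 : ti (a * z.1 + b, κ * z.2.1 + p.X z.1,
        Complex.exp (E z.1 z.2.1) * hatL a z.2.2) = z.1 := by
      simp only [hti]
      field_simp
      ring
    have h3 : xi (a * z.1 + b, κ * z.2.1 + p.X z.1,
        Complex.exp (E z.1 z.2.1) * hatL a z.2.2) = z.2.1 := by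
      simp only [hxi]
      rw [h1]
      field_simp
      ring
    refine ⟨?_, ?_, ?_⟩
    · simp only [hG]
      rw [h1, h3, ← mul_assoc, ← Complex.exp_add, neg_add_cancel, Complex.exp_zero, one_mul,
        hatL_apply, hat_hat]
    · rw [h1]
      exact hz.1
    · rw [hatL_apply]
      exact mul_ne_zero (Complex.exp_ne_zero _) (hat_ne_zero hz.2)
  have hFG : ∀ y ∈ s', F (G y) = y ∧ G y ∈ s := by
    intro y hy
    have hGy : G y ∈ s :=
      ⟨hy.1, hat_ne_zero (mul_ne_zero (Complex.exp_ne_zero _) hy.2)⟩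
    refine ⟨?_, hGy⟩
    rw [hFeq _ hGy]
    simp only [hG, hatL_apply, hat_hat]
    rw [← mul_assoc, ← Complex.exp_add, add_neg_cancel, Complex.exp_zero, one_mul]
    have h1 : a * ti y + b = y.1 := by
      simp only [hti]
      field_simp
      ring
    have h3 : κ * xi y + p.X (ti y) = y.2.1 := by
      simp only [hxi]
      field_simp
      ring
    rw [h1, h3]
  exact ⟨{
    toFun := F
    invFun := G
    source := s
    target := s'
    map_source' := fun z hz => (hGF z hz).2
    map_target' := fun y hy => (hFG y hy).2
    left_inv' := fun z hz => (hGF z hz).1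
    right_inv' := fun y hy => (hFG y hy).1
    open_source := hso
    open_target := hso'
    continuousOn_toFun := hFs.continuousOn
    continuousOn_invFun := hGs.continuousOn },
    ⟨hFs, hGs, fun z hz => hz.2, fun y hy => hy.2⟩, rfl, fun _ => rfl⟩

theorem exists_mem_equivalenceGroup {p : Params} {I : Set ℝ} (hI : IsOpen I)
    (hc : IsPreconnected I) (hp : p.RegularOn I) (h2 : ∀ t ∈ I, deriv (deriv p.T) t = 0) :
    ∃ P ∈ equivalenceGroup, P.ext.source = {q | q.1.1 ∈ I ∧ q.1.2.2 ≠ 0} ∧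
      HasFormOn P p P.ext.source := by
  obtain ⟨φ, hφ, hsource, hform⟩ := exists_pointTransformation hI hc hp h2
  obtain ⟨a, b, ha, hT⟩ := hp.exists_T_eq hI hc h2
  have hI1 : ∀ z ∈ φ.source, z.1 ∈ I := fun z hz => by
    rw [hsource] at hz
    exact hz.1
  have hev : ∀ t ∈ I, ∀ᶠ s in 𝓝 t, deriv p.T s = a := fun t ht => by
    filter_upwards [hI.mem_nhds ht] with s hs using (hT s hs).1
  have hcomp : ∀ {f : ℝ → ℝ}, ContDiffOn ℝ ∞ f I →
      ContDiffOn ℝ ∞ (fun z : Var => f z.1) φ.source :=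
    fun hf => hf.comp contDiff_fst.contDiffOn hI1
  have hderiv : ∀ {f : ℝ → ℝ}, ContDiffOn ℝ ∞ f I → ContDiffOn ℝ ∞ (deriv f) I :=
    fun hf => ((contDiffOn_infty_iff_deriv_of_isOpen hI).1 hf).2
  have hre : ∀ {f : Var → ℝ}, ContDiffOn ℝ ∞ f φ.source →
      ContDiffOn ℝ ∞ (fun y => (f y : ℂ)) φ.source :=
    fun hf => Complex.ofRealCLM.contDiff.comp_contDiffOn hf
  -- The translation part of the affine map `s ↦ newS` is its value at `s = 0`.
  have hD : ContDiffOn ℝ ∞ (fun z : Var => p.newS z.1 z.2.1 0) φ.source := by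
    have e1 := ((contDiffOn_const (c := p.ε * Real.sign a / (2 * √|a|))).mul
      ((hcomp (hderiv (hderiv hp.contDiffOn_X))).div_const a)).mul
      (contDiff_snd.fst.contDiffOn (s := φ.source))
    have e2 := ((hre (hcomp (hderiv hp.contDiffOn_Ψ))).sub ((contDiffOn_const (c := Complex.I)).mul
      (hre (hcomp (hderiv hp.contDiffOn_Θ))))).div_const (a : ℂ)
    have e3 := ((hre (hcomp (hderiv hp.contDiffOn_X))).pow 2).div_const (4 * (a : ℂ) ^ 2)
    refine (((contDiffOn_const (c := hat a 0 / (|a| : ℝ))).add (hre e1)).add e2 |>.sub e3).congr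
      fun z hz => ?_
    exact Params.newS_eq (hev _ (hI1 z hz)) _ _
  obtain ⟨P, hbase, hPs, hext⟩ := exists_extension hφ (A := fun _ => a) (fun _ _ => ha)
    (fun _ _ => .of_forall fun _ => rfl) hD
  have hPs' : P.ext.source = {q | q.1.1 ∈ I ∧ q.1.2.2 ≠ 0} := by
    rw [hPs, hsource]
    ext q
    simp
  have hsub : times P.ext.source ⊆ I := by
    rintro _ ⟨q, hq, rfl⟩
    rw [hPs'] at hq
    exact hq.1
  have hP : ∀ W ⊆ P.ext.source, HasFormOn P p W := by
    intro W hW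
    have hW' : times W ⊆ I := (Set.image_mono hW).trans hsub
    refine ⟨hW, ⟨hp.ε_eq, hp.contDiffOn_T.mono hW', hp.contDiffOn_X.mono hW',
      hp.contDiffOn_Θ.mono hW', hp.contDiffOn_Ψ.mono hW',
      fun t ht => hp.deriv_T_ne_zero t (hW' ht)⟩, fun t ht => h2 t (hW' ht), fun q hq => ?_⟩
    rw [hext, hform]
    refine Prod.ext rfl ?_
    have h4 := Params.newS_sub (p := p) (t := q.1.1) q.1.2.1 q.2 0
    have h5 : hat a 0 = 0 := by simp [hat]
    rw [(hT _ (hW' ⟨q, hq, rfl⟩)).1, h5, sub_zero] at h4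
    simp only [Params.toFun]
    linear_combination -h4
  exact ⟨P, mem_equivalenceGroup_of_form fun W hW _ => ⟨p, hP W hW⟩, hPs', hP _ subset_rfl⟩

end LogSchrodinger

end

theorem mainTheorem6 :
    -- the transformations of the equivalence group are those of the given form with `T_tt = 0`
    (∀ P : LogSchrodinger.ExtTransformation,
      P ∈ LogSchrodinger.equivalenceGroup ↔
        ∀ W : Set LogSchrodinger.ExtVar, W ⊆ P.ext.source → LogSchrodinger.IsTimeConnected W →
          ∃ p : LogSchrodinger.Params, LogSchrodinger.HasFormOn P p W) ∧
    -- all values of the parameters with `T_tt = 0` are realized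
    (∀ (I : Set ℝ) (p : LogSchrodinger.Params), IsOpen I → IsPreconnected I → p.RegularOn I →
      (∀ t ∈ I, deriv (deriv p.T) t = 0) →
        ∃ P ∈ LogSchrodinger.equivalenceGroup,
          P.ext.source = {q | q.1.1 ∈ I ∧ q.1.2.2 ≠ 0} ∧
          LogSchrodinger.HasFormOn P p P.ext.source) ∧
    -- the corresponding transformations of `σ` and `V`
    (∀ P ∈ LogSchrodinger.equivalenceGroup,
      ∀ (p : LogSchrodinger.Params) (W : Set LogSchrodinger.ExtVar), IsOpen W →
        LogSchrodinger.HasFormOn P p W →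
      ∀ (θ θ' : LogSchrodinger.Equation) (N : Set LogSchrodinger.Var), IsOpen N →
        (∀ z ∈ N, z ∈ θ.domain ∧ (z, θ.S z) ∈ W ∧ P.base z ∈ θ'.domain) →
        (P.ActsOn N θ θ' ↔
          ∀ z ∈ N, θ'.σ = p.newσ z.1 θ.σ ∧
            θ'.V (p.T z.1, p.newX z.1 z.2.1) =
              p.newV z.1 z.2.1 θ.σ (θ.V (z.1, z.2.1)))) ∧
    -- the class is normalized
    LogSchrodinger.IsNormalizedClass :=
  ⟨fun _ => ⟨fun hP _ hsub hW => LogSchrodinger.exists_form_of_mem_equivalenceGroup hP hsub hW,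
      LogSchrodinger.mem_equivalenceGroup_of_form⟩,
    fun _ _ hI hc hp h2 => LogSchrodinger.exists_mem_equivalenceGroup hI hc hp h2,
    fun _ _ _ _ hW hp _ _ _ hN h => hp.actsOn_iff hW hN h,
    LogSchrodinger.isNormalizedClass⟩
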